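/- **Theorem 5.1.** *Setting.* Let $\Omega\in(0,1)$, $\theta>0$, $\mu\in\mathbb R$, $M>1$; put $\widetilde\Omega=2\Omega/\theta$, $C=\frac{(1-\Omega)^2}{4\Omega}$, $\Theta=\begin{pmatrix}0&-\theta\\ \theta&0\end{pmatrix}$, and let $\gamma^0,\gamma^1$ be complex $2\times2$ matrices with $\gamma^\mu\gamma^\nu+\gamma^\nu\gamma^\mu=-2\delta^{\mu\nu}\mathbb 1_2$; write $\slashed a=\gamma^0a_0+\gamma^1a_1$. For $0<\alpha<1$ and $m,n,k,l\in\mathbb N$ let $\Gamma^\alpha_{m,n;k,l}=0$ unless $m+k=n+l$, and, when $n=m+h$, $k=l+h$ with $h\in\mathbb Z$, $$\Gamma^{\alpha}_{m,m+h;l+h,l}=\Big(\frac{\sqrt{1-\alpha}}{1+C\alpha}\Big)^{m+l+h}(1-\alpha)^{-h/2}\sum_{u=0}^{\min(m,l)}\mathcal A(m,l,h,u)\Big(\frac{C\alpha(1+\Omega)}{\sqrt{1-\alpha}\,(1-\Omega)}\Big)^{m+l-2u},$$ $\mathcal A(m,l,h,u)=\sqrt{\binom{m}{m-u}\binom{m+h}{m-u}\binom{l}{l-u}\binom{l+h}{l-u}}$.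 For a kernel $\Gamma$ set $$\begin{aligned}{}[x^0,\Gamma]_{m,n;k,l}=2\pi\theta\sqrt{\tfrac\theta8}\,\big\{&\sqrt{m+1}\,\Gamma_{m+1,n;k,l}-\sqrt l\,\Gamma_{m,n;k,l-1}+\sqrt m\,\Gamma_{m-1,n;k,l}-\sqrt{l+1}\,\Gamma_{m,n;k,l+1}\\&+\sqrt{n+1}\,\Gamma_{m,n+1;k,l}-\sqrt k\,\Gamma_{m,n;k-1,l}+\sqrt n\,\Gamma_{m,n-1;k,l}-\sqrt{k+1}\,\Gamma_{m,n;k+1,l}\big\},\end{aligned}$$ $$\begin{aligned}{}[x^1,\Gamma]_{m,n;k,l}=2\imath\pi\theta\sqrt{\tfrac\theta8}\,\big\{&\sqrt{m+1}\,\Gamma_{m+1,n;k,l}-\sqrt l\,\Gamma_{m,n;k,l-1}-\sqrt m\,\Gamma_{m-1,n;k,l}+\sqrt{l+1}\,\Gamma_{m,n;k,l+1}\\&-\sqrt{n+1}\,\Gamma_{m,n+1;k,l}+\sqrt k\,\Gamma_{m,n;k-1,l}+\sqrt n\,\Gamma_{m,n-1;k,l}-\sqrt{k+1}\,\Gamma_{m,n;k+1,l}\big\},\end{aligned}$$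 and $[\widetilde x^{\nu},\Gamma]=\sum_\rho 2(\Theta^{-1})_{\nu\rho}[x^\rho,\Gamma]$. The commutator and mass parts of the (matrix basis) integrand of the propagator of the non-commutative Gross–Neveu model are $$G^{\alpha,\mathrm{comm}}_{m,n;k,l}=\Big(\imath\widetilde\Omega\tfrac{2-\alpha}{\alpha}[\slashed x,\Gamma^\alpha]_{m,n;k,l}+\Omega[\slashed{\widetilde x},\Gamma^\alpha]_{m,n;k,l}\Big)S_\alpha,\qquad G^{\alpha,\mathrm{mass}}_{m,n;k,l}=-\mu\,\Gamma^\alpha_{m,n;k,l}\,S_\alpha,$$ $S_\alpha=\frac{2-\alpha}{2\sqrt{1-\alpha}}\mathbb 1_2-\imath\frac{\alpha}{2\sqrt{1-\alpha}}\gamma^0\gamma^1$, and their parts in the slice $i\ge1$ are $$G^{i,\bullet}_{m,n;k,l}=-\frac{2\Omega}{\theta^2\pi^2}\int_{M^{-2i}}^{M^{-2(i-1)}}d\alpha\;G^{\alpha,\bullet}_{m,n;k,l}.$$ *Claim.* There are a constant $c>0$ depending only on $\Omega$ and $M$, and a constant $K>0$ depending on $\Omega,M,\theta,\mu$ and the matrices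 $\gamma^\mu$, such that for all $i\ge1$ and all $m,n,k,l\in\mathbb N$ with $h=n-m\ge0$ and $p=l-m\ge0$ the integrals above converge absolutely, and for every $\alpha\in[M^{-2i},M^{-2(i-1)}]$, with $p'=\max(0,\min(l-m,k-n))$, $$|G^{i,\mathrm{comm}}_{m,n;k,l}|\le KM^{-i}\bigg(\chi(\alpha k>1)\frac{\exp\{-\frac{cp^2}{1+kM^{-2i}}-\frac{cM^{-2i}}{1+k}(h-\frac k{1+C})^2\}}{1+\sqrt{kM^{-2i}}}+\min(1,(\alpha k)^{p'})\,e^{-ckM^{-2i}-cp}\bigg),$$ $$|G^{i,\mathrm{mass}}_{m,n;k,l}|\le KM^{-2i}\bigg(\chi(\alpha k>1)\frac{\exp\{-\frac{cp^2}{1+kM^{-2i}}-\frac{cM^{-2i}}{1+k}(h-\frac k{1+C})^2\}}{1+\sqrt{kM^{-2i}}}+\min(1,(\alpha k)^{p})\,e^{-ckM^{-2i}-cp}\bigg).$$ Here $\chi(\alpha k>1)$ is $1$ if $\alpha k>1$ and $0$ otherwise, $(\alpha k)^0=1$, and $|\cdot|$ of a $2\times2$ matrix is the largest modulus of its entries.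 (If $k=m+h+p$, or $k=m+h+p+1$, then $p'=p$.) -/

import Mathlib

open Set MeasureTheory

namespace GrossNeveu

noncomputable section

/-- The function `C(Ω) = (1 - Ω)² / (4 Ω)`. -/
def C (Ω : ℝ) : ℝ := (1 - Ω) ^ 2 / (4 * Ω)

/-- `Ω̃ = 2 Ω / θ`. -/
def OmegaTilde (Ω θ : ℝ) : ℝ := 2 * Ω / θ

/-- The combinatorial factor
`𝒜(m,l,h,u) = √(binom m (m-u) · binom (m+h) (m-u) · binom l (l-u) · binom (l+h) (l-u))`,
written with `n = m + h` and `k = l + h`, for `u ≤ min m l`.  It vanishes for `u < m - n`. -/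
def binomFactor (m n k l u : ℕ) : ℝ :=
  √((m.choose (m - u) * n.choose (m - u) * l.choose (l - u) * k.choose (l - u) : ℕ) : ℝ)

/-- The matrix elements `Γ^α_{m,n;k,l}` of the parametric heat-type kernel, with magnetic field `B`.
With `n = m + h` and `k = l + h` (`h ∈ ℤ`) one has `m + l + h = n + l`.  The elements that do not
obey the conservation law `m + k = n + l` vanish. -/
def kernelB (B Ω α : ℝ) (m n k l : ℕ) : ℝ :=
  if m + k = n + l then
    (√(1 - α) / (1 + C Ω * α)) ^ (n + l)
      * (1 - α) ^ (-(B * ((n : ℝ) - (m : ℝ)) / (2 * Ω)))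
      * ∑ u ∈ Finset.range (min m l + 1), binomFactor m n k l u
          * (C Ω * α * (1 + Ω) / (√(1 - α) * (1 - Ω))) ^ (m + l - 2 * u)
  else 0

/-- The kernel `Γ^α` that enters the Gross–Neveu propagator: the critical case `B = Ω`. -/
def kernel (Ω α : ℝ) (m n k l : ℕ) : ℝ := kernelB Ω Ω α m n k l

/-- `[x⁰, Γ]_{m,n;k,l}` in the matrix basis.  A term with a negative index has coefficient
`√0 = 0`. -/
def commX0 (θ : ℝ) (Γ : ℕ → ℕ → ℕ → ℕ → ℝ) (m n k l : ℕ) : ℂ :=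
  ((2 * Real.pi * θ * √(θ / 8) *
    (√(m + 1) * Γ (m + 1) n k l - √l * Γ m n k (l - 1)
      + √m * Γ (m - 1) n k l - √(l + 1) * Γ m n k (l + 1)
      + √(n + 1) * Γ m (n + 1) k l - √k * Γ m n (k - 1) l
      + √n * Γ m (n - 1) k l - √(k + 1) * Γ m n (k + 1) l) : ℝ) : ℂ)

/-- `[x¹, Γ]_{m,n;k,l}` in the matrix basis. -/
def commX1 (θ : ℝ) (Γ : ℕ → ℕ → ℕ → ℕ → ℝ) (m n k l : ℕ) : ℂ :=
  Complex.I * ((2 * Real.pi * θ * √(θ / 8) *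
    (√(m + 1) * Γ (m + 1) n k l - √l * Γ m n k (l - 1)
      - √m * Γ (m - 1) n k l + √(l + 1) * Γ m n k (l + 1)
      - √(n + 1) * Γ m (n + 1) k l + √k * Γ m n (k - 1) l
      + √n * Γ m (n - 1) k l - √(k + 1) * Γ m n (k + 1) l) : ℝ) : ℂ)

/-- The vector `ν ↦ [x^ν, Γ]_{m,n;k,l}`. -/
def commX (θ : ℝ) (Γ : ℕ → ℕ → ℕ → ℕ → ℝ) (m n k l : ℕ) : Fin 2 → ℂ :=
  ![commX0 θ Γ m n k l, commX1 θ Γ m n k l]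

/-- The matrix `Θ` of the Moyal plane. -/
def Theta (θ : ℝ) : Matrix (Fin 2) (Fin 2) ℝ := !![0, -θ; θ, 0]

/-- The vector `ν ↦ [x̃^ν, Γ]_{m,n;k,l}`, where `x̃ = 2 Θ⁻¹ x`. -/
def commXTilde (θ : ℝ) (Γ : ℕ → ℕ → ℕ → ℕ → ℝ) (m n k l : ℕ) : Fin 2 → ℂ :=
  fun ν => ∑ ρ, ((2 * (Theta θ)⁻¹ ν ρ : ℝ) : ℂ) * commX θ Γ m n k l ρ

/-- `γ⁰, γ¹` form a two-dimensional representation of the Clifford algebra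
`{γ^μ, γ^ν} = -2 δ^{μν}`. -/
def IsCliffordRep (γ : Fin 2 → Matrix (Fin 2) (Fin 2) ℂ) : Prop :=
  ∀ μ ν, γ μ * γ ν + γ ν * γ μ = if μ = ν then (-2 : ℂ) • 1 else 0

/-- Feynman slash: `γ^μ a_μ` (Euclidean metric). -/
def slash (γ : Fin 2 → Matrix (Fin 2) (Fin 2) ℂ) (a : Fin 2 → ℂ) : Matrix (Fin 2) (Fin 2) ℂ :=
  ∑ ν, a ν • γ ν

/-- The spinorial factor `(2-α)/(2√(1-α)) 𝟙₂ - i α/(2√(1-α)) γ⁰γ¹`. -/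
def spinFactor (γ : Fin 2 → Matrix (Fin 2) (Fin 2) ℂ) (α : ℝ) : Matrix (Fin 2) (Fin 2) ℂ :=
  (((2 - α) / (2 * √(1 - α)) : ℝ) : ℂ) • 1
    - (Complex.I * ((α / (2 * √(1 - α)) : ℝ) : ℂ)) • (γ 0 * γ 1)

/-- The commutator part `G^{α,comm}_{m,n;k,l}` of the integrand of the propagator. -/
def Gcomm (γ : Fin 2 → Matrix (Fin 2) (Fin 2) ℂ) (Ω θ α : ℝ) (m n k l : ℕ) :
    Matrix (Fin 2) (Fin 2) ℂ :=
  ((Complex.I * ((OmegaTilde Ω θ * ((2 - α) / α) : ℝ) : ℂ)) •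
        slash γ (commX θ (kernel Ω α) m n k l)
      + (Ω : ℂ) • slash γ (commXTilde θ (kernel Ω α) m n k l))
    * spinFactor γ α

/-- The mass part `G^{α,mass}_{m,n;k,l}` of the integrand of the propagator. -/
def Gmass (γ : Fin 2 → Matrix (Fin 2) (Fin 2) ℂ) (Ω μ α : ℝ) (m n k l : ℕ) :
    Matrix (Fin 2) (Fin 2) ℂ :=
  (((-(μ * kernel Ω α m n k l) : ℝ) : ℂ) • (1 : Matrix (Fin 2) (Fin 2) ℂ)) * spinFactor γ α

/-- The contribution of the slice `i`, `α ∈ [M^{-2i}, M^{-2(i-1)}]`, with the normalization of the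
propagator, of a matrix-valued integrand; the integral is taken entrywise. -/
def slice (Ω θ M : ℝ) (i : ℕ) (F : ℝ → Matrix (Fin 2) (Fin 2) ℂ) : Matrix (Fin 2) (Fin 2) ℂ :=
  fun a b => ((-(2 * Ω / (θ ^ 2 * Real.pi ^ 2)) : ℝ) : ℂ) *
    ∫ α in (M ^ (-2 * (i : ℤ)))..(M ^ (-2 * ((i : ℤ) - 1))), F α a b

/-- Commutator part `G^{i,comm}_{m,n;k,l}` of the propagator in the slice `i`. -/
def GcommSlice (γ : Fin 2 → Matrix (Fin 2) (Fin 2) ℂ) (Ω θ M : ℝ) (i m n k l : ℕ) :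
    Matrix (Fin 2) (Fin 2) ℂ :=
  slice Ω θ M i (fun α => Gcomm γ Ω θ α m n k l)

/-- Mass part `G^{i,mass}_{m,n;k,l}` of the propagator in the slice `i`. -/
def GmassSlice (γ : Fin 2 → Matrix (Fin 2) (Fin 2) ℂ) (Ω θ μ M : ℝ) (i m n k l : ℕ) :
    Matrix (Fin 2) (Fin 2) ℂ :=
  slice Ω θ M i (fun α => Gmass γ Ω μ α m n k l)

/-- The bracket of the bounds, as a function of `h`, `p`, `k`, with `s` standing for `M^{-2i}`:
`χ(αk > 1) exp(-c p²/(1+ks) - c s/(1+k) (h - k/(1+C))²) / (1 + √(ks))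
  + min(1, (αk)^q) exp(-c k s - c p)`. -/
def bracket (Ω c s α : ℝ) (h p k q : ℕ) : ℝ :=
  (if 1 < α * k then
      Real.exp (-(c * p ^ 2 / (1 + k * s)) - c * s / (1 + k) * (h - k / (1 + C Ω)) ^ 2)
        / (1 + √(k * s))
    else 0)
  + min 1 ((α * k) ^ q) * Real.exp (-(c * k * s) - c * p)

end

end GrossNeveu

/-! Put X = 1 + Cα, q = (1+C)α/X, r = Cα/X, v = m-u and j = l-u. Each kernel entry is a sum over u
of square roots of products of four binomial probabilities: those of sizes m and l with parameter q,
those of sizes n and k with parameter r, at v, j, v, j respectively (`kernel_eq_sum_weight`). The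
q-half sums to at most one by AM-GM and the r-half is bounded uniformly, so the decay comes from
concentration of binomial variables.

The commutators would naively cost 1/α. Contiguous relations of the hypergeometric sum make the two
differences of each sector proportional (`ladder_up`), and the remaining difference is an average of
the centered variable (k+1)r - j divided by √(k+1) (`ladder_eq_sum`). Its standard deviation is of
order √(αk), so a factor √α is gained; this leaves α^(-1/2), and integration over a slice of length
of order M^(-2i) gives M^(-i).

Three regimes are estimated. If αk ≥ 1 and n is comparable to k, three of the four binomials are
exponentially tilted so that the u-dependence of the exponents cancels: this gives the Gaussian
decay in p and in h - k/(1+C), while the local limit bound gives 1/√(αk)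
(`exists_sums_le_of_large`). If n is much smaller than k, every admissible j is far above the mean
of the k-binomial and the sum is exponentially small in k (`exists_sums_le_of_far`). If αk is
bounded, Poisson bounds give powers of αk over factorials (`exists_sums_le_of_small`).
`exists_le_bracket` merges the regimes, uniformly over a slice.

In the spinor structure each sector carries a chiral combination γ⁰ ± iγ¹, on which the spin factor
acts as a scalar; only an integrable singularity (1-α)^(-1/2) remains, which matters for the first
slice. -/

namespace GrossNeveu

/-! ### Binomial probabilities: elementary bounds and exponential tilting -/

/-- The probability that a binomial variable with parameters `N`, `ρ` equals `j`. -/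
noncomputable def bin (N : ℕ) (ρ : ℝ) (j : ℕ) : ℝ := N.choose j * ρ ^ j * (1 - ρ) ^ (N - j)

theorem bin_nonneg {ρ : ℝ} (h0 : 0 ≤ ρ) (h1 : ρ ≤ 1) (N j : ℕ) : 0 ≤ bin N ρ j := by
  have := sub_nonneg.2 h1
  unfold bin; positivity

theorem bin_eq_zero {N j : ℕ} (h : N < j) (ρ : ℝ) : bin N ρ j = 0 := by
  simp [bin, Nat.choose_eq_zero_of_lt h]

theorem sum_bin (N : ℕ) (ρ : ℝ) : ∑ j ∈ Finset.range (N + 1), bin N ρ j = 1 := by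
  have := add_pow ρ (1 - ρ) N
  rw [add_sub_cancel, one_pow] at this
  rw [this]
  exact Finset.sum_congr rfl fun j _ => by unfold bin; ring

theorem sum_bin_le_one {ρ : ℝ} (h0 : 0 ≤ ρ) (h1 : ρ ≤ 1) (N : ℕ) (s : Finset ℕ) :
    ∑ j ∈ s, bin N ρ j ≤ 1 := by
  rw [← sum_bin N ρ]
  calc ∑ j ∈ s, bin N ρ j = ∑ j ∈ s with j < N + 1, bin N ρ j := by
        rw [Finset.sum_filter]
        refine Finset.sum_congr rfl fun j _ => ?_
        split_ifs with h
        · rfl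
        · exact bin_eq_zero (by omega) ρ
    _ ≤ _ := by
        refine Finset.sum_le_sum_of_subset_of_nonneg (fun j hj => ?_)
          fun j _ _ => bin_nonneg h0 h1 N j
        simpa using (Finset.mem_filter.1 hj).2

theorem bin_le_one {ρ : ℝ} (h0 : 0 ≤ ρ) (h1 : ρ ≤ 1) (N j : ℕ) : bin N ρ j ≤ 1 := by
  simpa using sum_bin_le_one h0 h1 N {j}

/-- Poisson-type bound, effective when the mean stays bounded. -/
theorem bin_le_pow_div_factorial {ρ : ℝ} (h0 : 0 ≤ ρ) (h1 : ρ ≤ 1) (N j : ℕ) :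
    bin N ρ j ≤ (N * ρ) ^ j / j.factorial := by
  have h2 : (1 - ρ) ^ (N - j) ≤ 1 := pow_le_one₀ (sub_nonneg.2 h1) (by linarith)
  have h3 : (N.choose j : ℝ) ≤ (N : ℝ) ^ j / j.factorial := Nat.choose_le_pow_div j N
  calc bin N ρ j ≤ N.choose j * ρ ^ j := mul_le_of_le_one_right (by positivity) h2
    _ ≤ (N : ℝ) ^ j / j.factorial * ρ ^ j := by gcongr
    _ = _ := by rw [mul_pow]; ring

theorem sum_sq_mul_bin (N : ℕ) (ρ : ℝ) :
    ∑ j ∈ Finset.range (N + 1), (N * ρ - j) ^ 2 * bin N ρ j = N * ρ * (1 - ρ) := by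
  have := congrArg (Polynomial.eval ρ) (bernsteinPolynomial.variance ℝ N)
  simpa [Polynomial.eval_finsetSum, bernsteinPolynomial, bin] using this

/-- A pointwise Chebyshev inequality: the left side is one term of the variance sum. -/
theorem sq_mul_bin_le {ρ : ℝ} (h0 : 0 ≤ ρ) (h1 : ρ ≤ 1) (N j : ℕ) :
    (N * ρ - j) ^ 2 * bin N ρ j ≤ N * ρ := by
  have hN : (0 : ℝ) ≤ N * ρ := by positivity
  rcases lt_or_ge N j with h | h
  · rw [bin_eq_zero h]; simpa using hN
  · calc (N * ρ - j) ^ 2 * bin N ρ j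
        ≤ ∑ j ∈ Finset.range (N + 1), (N * ρ - j) ^ 2 * bin N ρ j :=
          Finset.single_le_sum (f := fun j : ℕ => (N * ρ - j) ^ 2 * bin N ρ j)
            (fun i _ => mul_nonneg (sq_nonneg _) (bin_nonneg h0 h1 N i))
            (Finset.mem_range.2 (by omega))
      _ = N * ρ * (1 - ρ) := sum_sq_mul_bin N ρ
      _ ≤ N * ρ := mul_le_of_le_one_right hN (by linarith)

/-- Exponential change of the parameter of a Bernoulli variable. -/
noncomputable def tilt (ρ t : ℝ) : ℝ := ρ * Real.exp t / (1 - ρ + ρ * Real.exp t)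

section tilt

variable {ρ : ℝ}

theorem tilt_denom_pos (h0 : 0 ≤ ρ) (h1 : ρ ≤ 1) (t : ℝ) : 0 < 1 - ρ + ρ * Real.exp t := by
  rcases h1.lt_or_eq with h | h
  · have : 0 < 1 - ρ := by linarith
    positivity
  · subst h; simp [Real.exp_pos]

theorem one_sub_tilt (h0 : 0 ≤ ρ) (h1 : ρ ≤ 1) (t : ℝ) :
    1 - tilt ρ t = (1 - ρ) / (1 - ρ + ρ * Real.exp t) := by
  have := (tilt_denom_pos h0 h1 t).ne'
  unfold tilt; field_simp; ring

theorem tilt_nonneg (h0 : 0 ≤ ρ) (h1 : ρ ≤ 1) (t : ℝ) : 0 ≤ tilt ρ t :=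
  div_nonneg (by positivity) (tilt_denom_pos h0 h1 t).le

theorem tilt_le_one (h0 : 0 ≤ ρ) (h1 : ρ ≤ 1) (t : ℝ) : tilt ρ t ≤ 1 := by
  have := one_sub_tilt h0 h1 t
  have h2 : 0 ≤ (1 - ρ) / (1 - ρ + ρ * Real.exp t) :=
    div_nonneg (by linarith) (tilt_denom_pos h0 h1 t).le
  linarith

theorem tilt_denom_le (h0 : 0 ≤ ρ) (h1 : ρ ≤ 1) {t : ℝ} (ht : |t| ≤ 1) :
    1 - ρ + ρ * Real.exp t ≤ Real.exp 1 := by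
  have h2 : Real.exp t ≤ Real.exp 1 := Real.exp_le_exp.2 (abs_le.1 ht).2
  have h3 : 1 ≤ Real.exp 1 := Real.one_le_exp (by norm_num)
  nlinarith

/-- A bounded tilt changes the variance only by a constant factor, so the local limit bound survives
tilting. The constant combines e^t ≥ e^(-1) with a squared denominator at most e^2. -/
theorem tilt_mul_one_sub_tilt_ge (h0 : 0 ≤ ρ) (h1 : ρ ≤ 1) {t : ℝ} (ht : |t| ≤ 1) :
    Real.exp (-3) * (ρ * (1 - ρ)) ≤ tilt ρ t * (1 - tilt ρ t) := by
  rw [one_sub_tilt h0 h1, tilt, div_mul_div_comm, le_div_iff₀ (by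
    have := tilt_denom_pos h0 h1 t; positivity)]
  have hd := tilt_denom_le h0 h1 ht
  have hp := tilt_denom_pos h0 h1 t
  have h4 : (1 - ρ + ρ * Real.exp t) * (1 - ρ + ρ * Real.exp t) ≤ Real.exp 2 := by
    calc _ ≤ Real.exp 1 * Real.exp 1 := by gcongr
      _ = Real.exp 2 := by rw [← Real.exp_add]; norm_num
  have h5 : Real.exp (-1) ≤ Real.exp t := Real.exp_le_exp.2 (abs_le.1 ht).1
  have h6 : 0 ≤ ρ * (1 - ρ) := mul_nonneg h0 (by linarith)
  calc Real.exp (-3) * (ρ * (1 - ρ)) * ((1 - ρ + ρ * Real.exp t) * (1 - ρ + ρ * Real.exp t))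
      ≤ Real.exp (-3) * (ρ * (1 - ρ)) * Real.exp 2 := by gcongr
    _ = (ρ * (1 - ρ)) * Real.exp (-1) := by
        rw [show (-1 : ℝ) = -3 + 2 by norm_num, Real.exp_add]; ring
    _ ≤ (ρ * (1 - ρ)) * Real.exp t := by gcongr
    _ = _ := by ring

/-- Cramér's change of measure: the density of the original law with respect to the tilted one is
e^(-tj) times the moment generating function. -/
theorem bin_eq_bin_tilt (h0 : 0 ≤ ρ) (h1 : ρ ≤ 1) (t : ℝ) (N j : ℕ) :
    bin N ρ j =
      bin N (tilt ρ t) j * (Real.exp (-t * j) * (1 - ρ + ρ * Real.exp t) ^ N) := by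
  rcases lt_or_ge N j with h | h
  · simp [bin_eq_zero h]
  have hp := (tilt_denom_pos h0 h1 t).ne'
  unfold bin
  rw [one_sub_tilt h0 h1, tilt, div_pow, div_pow, mul_pow, ← Real.exp_nat_mul]
  set d := 1 - ρ + ρ * Real.exp t
  have h2 : d ^ N = d ^ j * d ^ (N - j) := by rw [← pow_add]; congr 1; omega
  have h3 : Real.exp (j * t) * Real.exp (-(j * t)) = 1 := by
    rw [← Real.exp_add, ← Real.exp_zero]; congr 1; ring
  rw [h2, neg_mul]
  field_simp
  linear_combination (-(N.choose j * ρ ^ j * (1 - ρ) ^ (N - j))) * h3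

/-- The moment generating function is bounded through e^t ≤ 1 + t + t² for |t| ≤ 1, which makes the
cost of a tilt quadratic. -/
theorem bin_le_bin_tilt (h0 : 0 ≤ ρ) (h1 : ρ ≤ 1) {t : ℝ} (ht : |t| ≤ 1) (N j : ℕ) :
    bin N ρ j ≤ bin N (tilt ρ t) j * Real.exp (-t * j + N * ρ * (t + t ^ 2)) := by
  rw [bin_eq_bin_tilt h0 h1 t N j]
  have hb := bin_nonneg (tilt_nonneg h0 h1 t) (tilt_le_one h0 h1 t) N j
  have h2 : 1 - ρ + ρ * Real.exp t ≤ Real.exp (ρ * (t + t ^ 2)) := by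
    have h3 : Real.exp t ≤ 1 + t + t ^ 2 := by
      have := Real.abs_exp_sub_one_sub_id_le ht
      linarith [(abs_le.1 this).2]
    have h4 := Real.add_one_le_exp (ρ * (t + t ^ 2))
    nlinarith
  gcongr
  calc Real.exp (-t * j) * (1 - ρ + ρ * Real.exp t) ^ N
      ≤ Real.exp (-t * j) * Real.exp (ρ * (t + t ^ 2)) ^ N := by
        gcongr
    _ = _ := by rw [← Real.exp_nat_mul, ← Real.exp_add]; congr 1; ring

end tilt

/-! ### Local limit bound for binomials by Fourier inversion -/

theorem integral_exp_int_mul_I (a : ℤ) :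
    ∫ x in (-Real.pi)..Real.pi, Complex.exp (a * Complex.I * x)
      = if a = 0 then 2 * (Real.pi : ℂ) else 0 := by
  split_ifs with h
  · subst h; simp; ring
  · have hc : (a : ℂ) * Complex.I ≠ 0 := mul_ne_zero (by exact_mod_cast h) Complex.I_ne_zero
    rw [integral_exp_mul_complex hc, div_eq_zero_iff]
    left
    rw [sub_eq_zero, Complex.exp_eq_exp_iff_exists_int]
    exact ⟨a, by push_cast; ring⟩

/-- The squared modulus for one Bernoulli variable is 1 - 2ρ(1-ρ)(1 - cos x), and 1 - cos x ≥ 2x²/π²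
on [-π, π]. -/
theorem norm_one_sub_add_mul_exp_pow_le {ρ : ℝ} (h0 : 0 ≤ ρ) (h1 : ρ ≤ 1) (N : ℕ) {x : ℝ}
    (hx : |x| ≤ Real.pi) :
    ‖(1 - ρ + ρ * Complex.exp (Complex.I * x)) ^ N‖
      ≤ Real.exp (-(2 * (N * ρ * (1 - ρ)) / Real.pi ^ 2) * x ^ 2) := by
  have hr : 0 ≤ ρ * (1 - ρ) := mul_nonneg h0 (by linarith)
  have h2 : ‖(1 - ρ + ρ * Complex.exp (Complex.I * x) : ℂ)‖ ^ 2
      = 1 - 2 * (ρ * (1 - ρ)) * (1 - Real.cos x) := by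
    rw [← Complex.normSq_eq_norm_sq, mul_comm Complex.I, Complex.exp_mul_I, ← Complex.ofReal_cos,
      ← Complex.ofReal_sin, Complex.normSq_apply]
    simp [-Complex.ofReal_cos, -Complex.ofReal_sin]
    nlinarith [Real.sin_sq_add_cos_sq x]
  have h3 := Real.cos_le_one_sub_mul_cos_sq hx
  have h4 : ‖(1 - ρ + ρ * Complex.exp (Complex.I * x) : ℂ)‖ ^ 2
      ≤ Real.exp (-(2 * (ρ * (1 - ρ)) / Real.pi ^ 2) * x ^ 2) ^ 2 := by
    rw [h2, ← Real.exp_nat_mul]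
    refine le_trans ?_ (Real.add_one_le_exp _)
    have : 2 * (ρ * (1 - ρ)) * (2 / Real.pi ^ 2 * x ^ 2)
        ≤ 2 * (ρ * (1 - ρ)) * (1 - Real.cos x) := by gcongr; linarith
    have h5 : ((2 : ℕ) : ℝ) * (-(2 * (ρ * (1 - ρ)) / Real.pi ^ 2) * x ^ 2)
        = -(2 * (ρ * (1 - ρ)) * (2 / Real.pi ^ 2 * x ^ 2)) := by push_cast; ring
    rw [h5]; linarith
  have h6 := le_of_sq_le_sq h4 (Real.exp_pos _).le
  rw [norm_pow]
  calc _ ≤ Real.exp (-(2 * (ρ * (1 - ρ)) / Real.pi ^ 2) * x ^ 2) ^ N := by gcongr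
    _ = _ := by rw [← Real.exp_nat_mul]; congr 1; ring

theorem integral_char_mul_exp {ρ : ℝ} {N j : ℕ} (hj : j ≤ N) :
    ∫ x in (-Real.pi)..Real.pi,
        (1 - ρ + ρ * Complex.exp (Complex.I * x)) ^ N * Complex.exp (-(j * Complex.I * x))
      = 2 * Real.pi * bin N ρ j := by
  have h : ∀ x : ℝ, (1 - ρ + ρ * Complex.exp (Complex.I * x)) ^ N
        * Complex.exp (-(j * Complex.I * x))
      = ∑ a ∈ Finset.range (N + 1),
        (bin N ρ a : ℂ) * Complex.exp (((a : ℤ) - (j : ℤ) : ℤ) * Complex.I * x) := by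
    intro x
    rw [add_comm, add_pow, Finset.sum_mul]
    refine Finset.sum_congr rfl fun a _ => ?_
    have : Complex.exp (((a : ℤ) - (j : ℤ) : ℤ) * Complex.I * x)
        = Complex.exp (Complex.I * x) ^ a * Complex.exp (-(j * Complex.I * x)) := by
      rw [← Complex.exp_nat_mul, ← Complex.exp_add]
      congr 1; push_cast; ring
    rw [this, bin]
    push_cast
    ring
  simp_rw [h]
  rw [intervalIntegral.integral_finsetSum]
  · simp_rw [intervalIntegral.integral_const_mul, integral_exp_int_mul_I]
    rw [Finset.sum_eq_single j]
    · simp; ring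
    · intro b _ hb
      rw [if_neg (by omega), mul_zero]
    · intro hj'
      exact absurd (Finset.mem_range.2 (by omega)) hj'
  · intro i _
    apply Continuous.intervalIntegrable
    fun_prop

/-- Fourier inversion bounds a probability by the integral of the modulus of the characteristic
function, which is dominated by a Gaussian. The clean constant 1 only needs π ≤ 8. -/
theorem bin_le_one_div_sqrt {ρ : ℝ} (h0 : 0 ≤ ρ) (h1 : ρ ≤ 1) {N : ℕ}
    (hN : 0 < N * ρ * (1 - ρ)) (j : ℕ) : bin N ρ j ≤ 1 / √(N * ρ * (1 - ρ)) := by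
  rcases lt_or_ge N j with h | hj
  · rw [bin_eq_zero h]; positivity
  set V := N * ρ * (1 - ρ) with hV
  have hpi := Real.pi_pos
  have hb : 0 < 2 * V / Real.pi ^ 2 := by positivity
  have key : 2 * Real.pi * bin N ρ j ≤ √(Real.pi / (2 * V / Real.pi ^ 2)) := by
    have h2 : ‖((2 * Real.pi * bin N ρ j : ℝ) : ℂ)‖ = 2 * Real.pi * bin N ρ j := by
      rw [Complex.norm_real, Real.norm_of_nonneg]
      have := bin_nonneg h0 h1 N j
      positivity
    rw [← h2]
    push_cast
    rw [← integral_char_mul_exp hj]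
    calc _ ≤ ∫ x in (-Real.pi)..Real.pi, Real.exp (-(2 * V / Real.pi ^ 2) * x ^ 2) := by
          apply intervalIntegral.norm_integral_le_of_norm_le (by linarith)
          · refine Filter.Eventually.of_forall fun x hx => ?_
            rw [norm_mul]
            have h3 : ‖Complex.exp (-(j * Complex.I * x))‖ = 1 := by
              rw [Complex.norm_exp]; simp
            rw [h3, mul_one]
            exact norm_one_sub_add_mul_exp_pow_le h0 h1 N (abs_le.2 ⟨hx.1.le, hx.2⟩)
          · apply Continuous.intervalIntegrable
            fun_prop
      _ ≤ ∫ x, Real.exp (-(2 * V / Real.pi ^ 2) * x ^ 2) := by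
          rw [intervalIntegral.integral_of_le (by linarith)]
          exact setIntegral_le_integral (integrable_exp_neg_mul_sq hb)
            (Filter.Eventually.of_forall fun x => (Real.exp_pos _).le)
      _ = _ := integral_gaussian _
  have h4 : √(Real.pi / (2 * V / Real.pi ^ 2)) ≤ 2 * Real.pi * (1 / √V) := by
    rw [show 2 * Real.pi * (1 / √V) = √((2 * Real.pi) ^ 2 / V) by
      rw [Real.sqrt_div (by positivity), Real.sqrt_sq (by positivity)]; ring]
    apply Real.sqrt_le_sqrt
    rw [div_div_eq_mul_div, div_le_div_iff₀ (by positivity) (by positivity)]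
    nlinarith [Real.pi_lt_four, mul_pos hN (sq_pos_of_pos hpi)]
  have := key.trans h4
  exact le_of_mul_le_mul_left this (by positivity)

/-! ### The kernel as a sum of geometric means of binomial probabilities -/

theorem C_pos {Ω : ℝ} (h0 : 0 < Ω) (h1 : Ω < 1) : 0 < C Ω := by
  have : 0 < 1 - Ω := by linarith
  unfold C; positivity

/-- The success probability attached to the indices `m`, `l`. -/
noncomputable def qpar (Ω α : ℝ) : ℝ := (1 + C Ω) * α / (1 + C Ω * α)

/-- The success probability attached to the indices `n`, `k`. -/
noncomputable def rpar (Ω α : ℝ) : ℝ := C Ω * α / (1 + C Ω * α)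

/-- The off-diagonal weight of the kernel. -/
noncomputable def ypar (Ω α : ℝ) : ℝ := C Ω * α * (1 + Ω) / (1 - Ω)

/-- Product of four binomial weights whose square root is a summand of the kernel. -/
noncomputable def weight (q r : ℝ) (m n k l u : ℕ) : ℝ :=
  √((bin m q (m - u) * bin l q (l - u)) * (bin n r (m - u) * bin k r (l - u)))

section algebra

variable {Ω α : ℝ}

theorem denom_pos (h0 : 0 < Ω) (h1 : Ω < 1) (ha : 0 ≤ α) : 0 < 1 + C Ω * α := by
  have := C_pos h0 h1
  positivity

theorem ypar_nonneg (h0 : 0 < Ω) (h1 : Ω < 1) (ha : 0 ≤ α) : 0 ≤ ypar Ω α := by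
  have := C_pos h0 h1
  have : 0 < 1 - Ω := by linarith
  unfold ypar; positivity

/-- This rests on ((1+Ω)/(1-Ω))² = (1+C)/C. -/
theorem ypar_sq (_ : 0 < Ω) (h1 : Ω < 1) : ypar Ω α ^ 2 = C Ω * (1 + C Ω) * α ^ 2 := by
  have : 1 - Ω ≠ 0 := by linarith
  unfold ypar C; field_simp; ring

theorem one_sub_qpar (h0 : 0 < Ω) (h1 : Ω < 1) (ha : 0 ≤ α) :
    1 - qpar Ω α = (1 - α) / (1 + C Ω * α) := by
  have := (denom_pos h0 h1 ha).ne'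
  unfold qpar; field_simp; ring

theorem one_sub_rpar (h0 : 0 < Ω) (h1 : Ω < 1) (ha : 0 ≤ α) :
    1 - rpar Ω α = 1 / (1 + C Ω * α) := by
  have := (denom_pos h0 h1 ha).ne'
  unfold rpar; field_simp; ring

theorem kernel_eq_zero {m n k l : ℕ} (h : m + k ≠ n + l) : kernel Ω α m n k l = 0 := by
  simp [kernel, kernelB, h]

/-- At the critical field B = Ω, the power (1-α)^(-h/2) combines with the other powers of √(1-α)
into the integer power (1-α)^u. -/
theorem kernel_eq_sum_binomFactor (h0 : 0 < Ω) (_ : Ω < 1) (ha1 : α < 1) {m n k l : ℕ}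
    (h : m + k = n + l) :
    kernel Ω α m n k l = ∑ u ∈ Finset.range (min m l + 1),
      binomFactor m n k l u * (ypar Ω α ^ (m + l - 2 * u) * (1 - α) ^ u
        / (1 + C Ω * α) ^ (n + l)) := by
  rw [kernel, kernelB, if_pos h, Finset.mul_sum]
  refine Finset.sum_congr rfl fun u hu => ?_
  have hu' : u ≤ min m l := by simpa [Nat.lt_succ_iff] using hu
  have hum : u ≤ m := hu'.trans (min_le_left _ _)
  have hul : u ≤ l := hu'.trans (min_le_right _ _)
  have hz : 0 < 1 - α := by linarith
  set w := √(1 - α) with hw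
  have hw0 : 0 < w := Real.sqrt_pos.2 hz
  have hww : 1 - α = w ^ 2 := (Real.sq_sqrt hz.le).symm
  have hp : (1 - α) ^ (-(Ω * ((n : ℝ) - m) / (2 * Ω))) = w ^ m / w ^ n := by
    rw [hww, ← Real.rpow_natCast w 2, ← Real.rpow_mul hw0.le]
    rw [show ((2 : ℕ) : ℝ) * (-(Ω * ((n : ℝ) - m) / (2 * Ω))) = (m : ℝ) - n by
      push_cast; field_simp; ring]
    rw [Real.rpow_sub hw0, Real.rpow_natCast, Real.rpow_natCast]
  have hy : C Ω * α * (1 + Ω) / (w * (1 - Ω)) = ypar Ω α / w := by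
    unfold ypar; rw [div_div, mul_comm w]
  have hpow : w ^ m * w ^ l = w ^ (m + l - 2 * u) * (w ^ 2) ^ u := by
    rw [← pow_mul, ← pow_add, ← pow_add]; congr 1; omega
  rw [hp, hy, div_pow, div_pow, hww, pow_add w n l]
  have h2 : w ^ n ≠ 0 := by positivity
  have h3 : w ^ (m + l - 2 * u) ≠ 0 := by positivity
  have h4 : w ^ n * w ^ l / (1 + C Ω * α) ^ (n + l) * (w ^ m / w ^ n) *
      (binomFactor m n k l u * (ypar Ω α ^ (m + l - 2 * u) / w ^ (m + l - 2 * u)))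
      = (w ^ m * w ^ l) / w ^ (m + l - 2 * u) *
        (binomFactor m n k l u * ypar Ω α ^ (m + l - 2 * u) / (1 + C Ω * α) ^ (n + l)) := by
    field_simp
  rw [h4, hpow, mul_div_cancel_left₀ _ h3]
  ring

/-- The parameters are made for this: qr = (y/X)², 1-q = (1-α)/X and 1-r = 1/X, so the four
probabilities multiply to the square of the summand. -/
theorem weight_eq (h0 : 0 < Ω) (h1 : Ω < 1) (ha : 0 ≤ α) (ha1 : α ≤ 1) {m n k l u : ℕ}
    (h : m + k = n + l) (hum : u ≤ m) (hul : u ≤ l) :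
    weight (qpar Ω α) (rpar Ω α) m n k l u =
      binomFactor m n k l u * (ypar Ω α ^ (m + l - 2 * u) * (1 - α) ^ u
        / (1 + C Ω * α) ^ (n + l)) := by
  have hX := denom_pos h0 h1 ha
  have hy := ypar_nonneg h0 h1 ha
  have hz : 0 ≤ 1 - α := by linarith
  rw [weight, binomFactor]
  set g := ypar Ω α ^ (m + l - 2 * u) * (1 - α) ^ u / (1 + C Ω * α) ^ (n + l) with hg
  have hg0 : 0 ≤ g := by positivity
  rw [← Real.sqrt_sq hg0, ← Real.sqrt_mul (by positivity)]
  congr 1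
  push_cast
  -- For n < m this case occurs; both sides then vanish.
  rcases lt_or_ge n (m - u) with hv | hv
  · simp [bin_eq_zero hv, Nat.choose_eq_zero_of_lt hv]
  have hqr : qpar Ω α * rpar Ω α = (ypar Ω α / (1 + C Ω * α)) ^ 2 := by
    rw [div_pow, ypar_sq h0 h1]; unfold qpar rpar; field_simp
  unfold bin
  rw [one_sub_qpar h0 h1 ha, one_sub_rpar h0 h1 ha]
  have e1 : m - (m - u) = u := by omega
  have e2 : l - (l - u) = u := by omega
  rw [e1, e2]
  have hpw : qpar Ω α ^ (m - u) * qpar Ω α ^ (l - u) * (rpar Ω α ^ (m - u) * rpar Ω α ^ (l - u))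
      * (((1 - α) / (1 + C Ω * α)) ^ u * ((1 - α) / (1 + C Ω * α)) ^ u)
      * ((1 / (1 + C Ω * α)) ^ (n - (m - u)) * (1 / (1 + C Ω * α)) ^ (k - (l - u))) = g ^ 2 := by
    rw [← pow_add, ← pow_add, ← mul_pow, hqr, ← pow_add, ← pow_add, hg]
    have e3 : m - u + (l - u) = m + l - 2 * u := by omega
    rw [e3]
    simp only [div_pow, mul_pow, one_pow]
    have hXX : (((1 + C Ω * α) ^ (n + l)) ^ 2) = ((1 + C Ω * α) ^ 2) ^ (m + l - 2 * u) *
        (1 + C Ω * α) ^ (u + u) * (1 + C Ω * α) ^ (n - (m - u) + (k - (l - u))) := by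
      rw [← pow_mul, ← pow_mul, ← pow_add, ← pow_add]; congr 1; omega
    rw [hXX, ← pow_mul, ← pow_mul, ← pow_mul, ← pow_mul, mul_comm 2 (m + l - 2 * u),
      show u + u = u * 2 by ring]
    field_simp
  rw [← hpw]; ring

/-- A kernel entry is a sum of geometric means of binomial weights. -/
theorem kernel_eq_sum_weight (h0 : 0 < Ω) (h1 : Ω < 1) (ha : 0 ≤ α) (ha1 : α < 1)
    {m n k l : ℕ} (h : m + k = n + l) :
    kernel Ω α m n k l = ∑ u ∈ Finset.range (min m l + 1),
      weight (qpar Ω α) (rpar Ω α) m n k l u := by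
  rw [kernel_eq_sum_binomFactor h0 h1 ha1 h]
  refine Finset.sum_congr rfl fun u hu => ?_
  have hu' : u ≤ min m l := by simpa [Nat.lt_succ_iff] using hu
  exact (weight_eq h0 h1 ha ha1.le h (hu'.trans (min_le_left _ _))
    (hu'.trans (min_le_right _ _))).symm

/-! ### Hypergeometric form of the kernel and its contiguous relations -/

/-- The divided power `y ^ a / a!`, extended by zero to negative `a`. -/
noncomputable def divPow (y : ℝ) (a : ℤ) : ℝ :=
  if 0 ≤ a then y ^ a.toNat / a.toNat.factorial else 0

theorem divPow_natCast (y : ℝ) (a : ℕ) : divPow y a = y ^ a / a.factorial := by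
  simp [divPow]

theorem divPow_of_neg (y : ℝ) {a : ℤ} (h : a < 0) : divPow y a = 0 := by
  simp [divPow, h]

/-- The one recursion behind all contiguous relations. Extension by zero makes it hold for every
integer, so boundary terms need no separate care. -/
theorem mul_divPow (y : ℝ) (a : ℤ) : a * divPow y a = y * divPow y (a - 1) := by
  rcases lt_trichotomy a 0 with h | h | h
  · rw [divPow_of_neg y h, divPow_of_neg y (by omega)]; simp
  · subst h; rw [divPow_of_neg y (by omega : (0 : ℤ) - 1 < 0)]; simp
  · obtain ⟨b, rfl⟩ : ∃ b : ℕ, a = (b + 1 : ℕ) := ⟨(a - 1).toNat, by omega⟩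
    rw [show ((b + 1 : ℕ) : ℤ) - 1 = (b : ℤ) by push_cast; ring, divPow_natCast, divPow_natCast,
      Nat.factorial_succ]
    have : (b.factorial : ℝ) ≠ 0 := by positivity
    push_cast
    rw [pow_succ]
    field_simp

/-- The summands of the hypergeometric sum of the kernel. -/
noncomputable def hyperTerm (y z : ℝ) (m l h : ℤ) (u : ℤ) : ℝ :=
  divPow y (m - u) * divPow y (l - u) * divPow z u * divPow 1 (h + u)

/-- The hypergeometric sum of the kernel. -/
noncomputable def hyper (y z : ℝ) (m l : ℕ) (h : ℤ) : ℝ :=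
  ∑ u ∈ Finset.range (m + 1), hyperTerm y z m l h u

theorem binomFactor_mul_eq {y z : ℝ} {m n k l u : ℕ} (h : m + k = n + l) (hum : u ≤ m)
    (hul : u ≤ l) :
    binomFactor m n k l u * (y ^ (m + l - 2 * u) * z ^ u) =
      √(m.factorial * n.factorial * k.factorial * l.factorial) *
        hyperTerm y z m l ((n : ℤ) - m) u := by
  obtain ⟨v, rfl⟩ := Nat.exists_eq_add_of_le hum
  obtain ⟨j, rfl⟩ := Nat.exists_eq_add_of_le hul
  have e1 : u + v - u = v := by omega
  have e2 : u + j - u = j := by omega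
  have e3 : u + v + (u + j) - 2 * u = v + j := by omega
  unfold hyperTerm binomFactor
  rw [e1, e2, e3]
  rw [show ((u + v : ℕ) : ℤ) - u = (v : ℕ) by push_cast; ring,
    show ((u + j : ℕ) : ℤ) - u = (j : ℕ) by push_cast; ring]
  rcases lt_or_ge n v with hv | hv
  · rw [divPow_of_neg 1 (by push_cast; omega), Nat.choose_eq_zero_of_lt hv]
    simp
  obtain ⟨w, rfl⟩ := Nat.exists_eq_add_of_le hv
  obtain rfl : k = w + j := by omega
  rw [show ((v + w : ℕ) : ℤ) - (u + v : ℕ) + u = (w : ℕ) by push_cast; ring]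
  simp only [divPow_natCast, one_pow]
  have c1 := Nat.add_choose_mul_factorial_mul_factorial u v
  have c2 := Nat.add_choose_mul_factorial_mul_factorial v w
  have c3 := Nat.add_choose_mul_factorial_mul_factorial u j
  have c4 := Nat.add_choose_mul_factorial_mul_factorial w j
  rw [← Nat.choose_symm_add] at c2
  have hf : ((u + v).factorial * (v + w).factorial * (w + j).factorial * (u + j).factorial : ℝ)
      = ((u + v).choose v * (v + w).choose v * (u + j).choose j * (w + j).choose j : ℕ)
        * (u.factorial * v.factorial * j.factorial * w.factorial : ℝ) ^ 2 := by
    rw [← c1, ← c2, ← c3, ← c4]; push_cast; ring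
  rw [hf, Real.sqrt_mul (by positivity), Real.sqrt_sq (by positivity), pow_add]
  have f1 : (u.factorial : ℝ) ≠ 0 := by positivity
  have f2 : (v.factorial : ℝ) ≠ 0 := by positivity
  have f3 : (j.factorial : ℝ) ≠ 0 := by positivity
  have f4 : (w.factorial : ℝ) ≠ 0 := by positivity
  field_simp

theorem hyperTerm_eq_zero (y z : ℝ) {m l : ℕ} (h : ℤ) {u : ℕ} (hu : min m l < u) :
    hyperTerm y z m l h u = 0 := by
  unfold hyperTerm
  rcases lt_or_ge m u with hm | hm
  · rw [divPow_of_neg y (by omega : (m : ℤ) - u < 0)]; simp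
  · rw [divPow_of_neg y (by omega : (l : ℤ) - u < 0)]; simp

/-- Terms beyond the smaller of m and l vanish, so sums with different ranges can be compared term
by term. -/
theorem hyper_eq_sum {y z : ℝ} {m l : ℕ} {h : ℤ} {R : ℕ} (hR : min m l < R) :
    hyper y z m l h = ∑ u ∈ Finset.range R, hyperTerm y z m l h u := by
  have key : ∀ R, min m l < R → ∑ u ∈ Finset.range R, hyperTerm y z m l h u =
      ∑ u ∈ Finset.range (min m l + 1), hyperTerm y z m l h u := fun R hR => by
    refine (Finset.sum_subset (fun a ha => ?_) fun a _ ha => ?_).symm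
    · have := Finset.mem_range.1 ha
      exact Finset.mem_range.2 (by omega)
    · have : ¬ a < min m l + 1 := fun h => ha (Finset.mem_range.2 h)
      exact hyperTerm_eq_zero y z h (by omega)
  rw [hyper, key R hR, key (m + 1) (by omega)]

theorem kernel_eq_hyper (h0 : 0 < Ω) (h1 : Ω < 1) (ha1 : α < 1) {m n k l : ℕ}
    (h : m + k = n + l) :
    kernel Ω α m n k l = √(m.factorial * n.factorial * k.factorial * l.factorial) *
      hyper (ypar Ω α) (1 - α) m l ((n : ℤ) - m) / (1 + C Ω * α) ^ (n + l) := by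
  rw [kernel_eq_sum_binomFactor h0 h1 ha1 h, hyper_eq_sum (Nat.lt_succ_self (min m l)),
    Finset.mul_sum, Finset.sum_div]
  refine Finset.sum_congr rfl fun u hu => ?_
  have hu' : u ≤ min m l := by simpa [Nat.lt_succ_iff] using hu
  rw [← binomFactor_mul_eq h (hu'.trans (min_le_left _ _)) (hu'.trans (min_le_right _ _))]
  ring

theorem sum_shift_hyperTerm {y z : ℝ} {m l : ℕ} {h : ℤ} :
    ∑ u ∈ Finset.range (m + 2), (u : ℝ) * hyperTerm y z (m + 1 : ℕ) l (h - 1) u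
      = if l = 0 then 0 else z * hyper y z m (l - 1) h := by
  rw [Finset.sum_range_succ']
  simp only [Nat.cast_zero, zero_mul, add_zero]
  have key : ∀ u : ℕ, ((u + 1 : ℕ) : ℝ) * hyperTerm y z (m + 1 : ℕ) l (h - 1) (u + 1 : ℕ)
      = z * hyperTerm y z m (l - 1) h u := fun u => by
    have := mul_divPow z ((u + 1 : ℕ) : ℤ)
    unfold hyperTerm
    rw [show ((u + 1 : ℕ) : ℤ) - 1 = u by push_cast; ring] at this
    rw [show ((m + 1 : ℕ) : ℤ) - (u + 1 : ℕ) = m - u by push_cast; ring,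
      show (l : ℤ) - (u + 1 : ℕ) = l - 1 - u by push_cast; ring,
      show h - 1 + ((u + 1 : ℕ) : ℤ) = h + u by push_cast; ring]
    push_cast at this ⊢
    linear_combination (divPow y (m - u) * divPow y (l - 1 - u) * divPow 1 (h + u)) * this
  simp_rw [key]
  split_ifs with hl
  · subst hl
    refine Finset.sum_eq_zero fun u _ => ?_
    unfold hyperTerm
    rw [divPow_of_neg y (by omega : ((0 : ℕ) : ℤ) - 1 - u < 0)]
    simp
  · rw [← Finset.mul_sum, hyper]
    obtain ⟨l, rfl⟩ := Nat.exists_eq_succ_of_ne_zero hl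
    simp

/-- Split m+1 = (m+1-u) + u under the sum: the first part lowers a power of y, the second a power of
z with a shift of u. -/
theorem succ_mul_hyper_succ {y z : ℝ} {m l : ℕ} {h : ℤ} :
    (m + 1) * hyper y z (m + 1) l (h - 1) = y * hyper y z m l (h - 1) +
      if l = 0 then 0 else z * hyper y z m (l - 1) h := by
  rw [← sum_shift_hyperTerm, hyper_eq_sum (m := m) (R := m + 2) (by omega), hyper,
    Finset.mul_sum, Finset.mul_sum, ← Finset.sum_add_distrib]
  refine Finset.sum_congr rfl fun u _ => ?_
  have := mul_divPow y (((m + 1 : ℕ) : ℤ) - u)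
  rw [show ((m + 1 : ℕ) : ℤ) - u - 1 = m - u by push_cast; ring] at this
  unfold hyperTerm
  push_cast at this ⊢
  linear_combination (divPow y (l - u) * divPow z u * divPow 1 (h - 1 + u)) * this

/-- Split l+h = (l-u) + (h+u) under the sum, each part lowering one divided power. -/
theorem add_mul_hyper {y z : ℝ} {m l : ℕ} {h : ℤ} :
    (l + h) * hyper y z m l h = hyper y z m l (h - 1) +
      if l = 0 then 0 else y * hyper y z m (l - 1) h := by
  have hl : ∑ u ∈ Finset.range (m + 1), ((l : ℝ) - u) * hyperTerm y z m l h u =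
      if l = 0 then 0 else y * hyper y z m (l - 1) h := by
    have key : ∀ u : ℕ, ((l : ℝ) - u) * hyperTerm y z m l h u
        = y * hyperTerm y z m (l - 1) h u := fun u => by
      have := mul_divPow y ((l : ℤ) - u)
      rw [show (l : ℤ) - u - 1 = l - 1 - u by ring] at this
      unfold hyperTerm
      push_cast at this ⊢
      linear_combination (divPow y (m - u) * divPow z u * divPow 1 (h + u)) * this
    simp_rw [key]
    split_ifs with hl
    · subst hl
      refine Finset.sum_eq_zero fun u _ => ?_
      unfold hyperTerm
      rw [divPow_of_neg y (by omega : ((0 : ℕ) : ℤ) - 1 - u < 0)]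
      simp
    · rw [← Finset.mul_sum, hyper]
      obtain ⟨l, rfl⟩ := Nat.exists_eq_succ_of_ne_zero hl
      simp
  rw [← hl, hyper, hyper, Finset.mul_sum, ← Finset.sum_add_distrib]
  refine Finset.sum_congr rfl fun u _ => ?_
  have := mul_divPow 1 (h + u)
  rw [show h + (u : ℤ) - 1 = h - 1 + u by ring] at this
  unfold hyperTerm
  push_cast at this ⊢
  linear_combination (divPow y (m - u) * divPow y (l - u) * divPow z u) * this

end algebra

/-! ### Ladder identities: the differences inside the commutators -/

section ladder

variable {Ω α : ℝ}

theorem sqrt_succ_mul_sqrt_factorial (m : ℕ) (x : ℝ) :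
    √((m : ℝ) + 1) * √((m + 1).factorial * x) = (m + 1) * √(m.factorial * x) := by
  rw [← Real.sqrt_mul (by positivity), Nat.factorial_succ]
  rw [show ((m : ℝ) + 1) * (((m + 1) * m.factorial : ℕ) * x)
    = ((m : ℝ) + 1) ^ 2 * (m.factorial * x) by push_cast; ring]
  rw [Real.sqrt_mul (by positivity), Real.sqrt_sq (by positivity)]

theorem sqrt_succ_mul_sqrt_factorial' (m : ℕ) (x : ℝ) :
    √((m : ℝ) + 1) * √(m.factorial * x) = √((m + 1).factorial * x) := by
  rw [← Real.sqrt_mul (by positivity), Nat.factorial_succ]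
  congr 1; push_cast; ring

theorem hyper_eq_zero (y z : ℝ) {m l : ℕ} {h : ℤ} (hm : h + m < 0) : hyper y z m l h = 0 := by
  refine Finset.sum_eq_zero fun u hu => ?_
  have := Finset.mem_range.1 hu
  unfold hyperTerm
  rw [divPow_of_neg 1 (by omega : h + u < 0)]
  simp

/-- The two differences in the commutators that conserve the same index sum are proportional. -/
theorem ladder_up (h0 : 0 < Ω) (h1 : Ω < 1) (ha : 0 < α) (ha1 : α < 1) {m n k l : ℕ}
    (h : m + 1 + k = n + l) :
    √((m : ℝ) + 1) * kernel Ω α (m + 1) n k l - √l * kernel Ω α m n k (l - 1)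
      = (1 + Ω) / (1 - Ω) *
        (√n * kernel Ω α m (n - 1) k l - √((k : ℝ) + 1) * kernel Ω α m n (k + 1) l) := by
  have hX := denom_pos h0 h1 ha.le
  set X := 1 + C Ω * α with hXdef
  set y := ypar Ω α with hy
  set z := 1 - α with hz
  set W := √(m.factorial * n.factorial * k.factorial * l.factorial : ℝ) with hW
  obtain ⟨N, hN⟩ : ∃ N, n + l = N + 1 := ⟨n + l - 1, by omega⟩
  have t1 : √((m : ℝ) + 1) * kernel Ω α (m + 1) n k l
      = W * ((m + 1) * hyper y z (m + 1) l ((n : ℤ) - m - 1)) / X ^ (N + 1) := by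
    rw [kernel_eq_hyper h0 h1 ha1 h, ← hN]
    have := sqrt_succ_mul_sqrt_factorial m (n.factorial * k.factorial * l.factorial)
    simp only [← mul_assoc] at this
    rw [show (n : ℤ) - (m + 1 : ℕ) = n - m - 1 by push_cast; ring, ← mul_div_assoc, ← mul_assoc,
      this, hW]
    ring
  have t4 : √((k : ℝ) + 1) * kernel Ω α m n (k + 1) l
      = W * (((l : ℝ) + ((n : ℤ) - m : ℤ)) * hyper y z m l ((n : ℤ) - m)) / X ^ (N + 1) := by
    rw [kernel_eq_hyper h0 h1 ha1 (by omega), ← hN]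
    have := sqrt_succ_mul_sqrt_factorial k (m.factorial * n.factorial * l.factorial)
    rw [show ((k + 1).factorial : ℝ) * (m.factorial * n.factorial * l.factorial)
      = m.factorial * n.factorial * (k + 1).factorial * l.factorial by ring,
      show (k.factorial : ℝ) * (m.factorial * n.factorial * l.factorial)
      = m.factorial * n.factorial * k.factorial * l.factorial by ring] at this
    have hk : ((k : ℝ) + 1) = (l : ℝ) + ((n : ℤ) - m : ℤ) := by
      have : (m : ℝ) + 1 + k = n + l := by exact_mod_cast h
      push_cast; linarith
    rw [← mul_div_assoc, ← mul_assoc, this, ← hW, hk]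
    ring
  have t2 : √l * kernel Ω α m n k (l - 1)
      = W * (if l = 0 then 0 else hyper y z m (l - 1) ((n : ℤ) - m)) / X ^ N := by
    split_ifs with hl
    · simp [hl]
    · obtain ⟨l, rfl⟩ := Nat.exists_eq_succ_of_ne_zero hl
      rw [Nat.succ_eq_add_one, Nat.add_sub_cancel, kernel_eq_hyper h0 h1 ha1 (by omega),
        show n + l = N by omega]
      have := sqrt_succ_mul_sqrt_factorial' l (m.factorial * n.factorial * k.factorial)
      rw [mul_comm (l.factorial : ℝ), mul_comm ((l + 1).factorial : ℝ)] at this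
      push_cast
      rw [← mul_div_assoc, ← mul_assoc, this]
  have t3 : √n * kernel Ω α m (n - 1) k l
      = W * hyper y z m l ((n : ℤ) - m - 1) / X ^ N := by
    rcases Nat.eq_zero_or_pos n with hn | hn
    · subst hn
      -- For n = 0 the truncated index n - 1 is harmless: the coefficient √n vanishes on one side,
      -- the hypergeometric sum on the other.
      rw [hyper_eq_zero y z (by push_cast; omega)]
      simp
    · obtain ⟨n, rfl⟩ := Nat.exists_eq_succ_of_ne_zero hn.ne'
      rw [Nat.succ_eq_add_one, Nat.add_sub_cancel, kernel_eq_hyper h0 h1 ha1 (by omega),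
        show n + l = N by omega]
      have := sqrt_succ_mul_sqrt_factorial' n (m.factorial * k.factorial * l.factorial)
      rw [show ((n + 1).factorial : ℝ) * (m.factorial * k.factorial * l.factorial)
        = m.factorial * (n + 1).factorial * k.factorial * l.factorial by ring,
        show (n.factorial : ℝ) * (m.factorial * k.factorial * l.factorial)
        = m.factorial * n.factorial * k.factorial * l.factorial by ring] at this
      rw [show ((n + 1 : ℕ) : ℤ) - m - 1 = n - m by push_cast; ring]
      push_cast
      rw [← mul_div_assoc, ← mul_assoc, this]
  -- Both sides now involve only the sums at (m, l, h-1) and (m, l-1, h). Their coefficients match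
  -- because y = (1+Ω)/(1-Ω)·(X-1) and y² = (X-1)(X-z).
  rw [t1, t2, t3, t4, succ_mul_hyper_succ, add_mul_hyper]
  have hC := C_pos h0 h1
  have hratio : y = (1 + Ω) / (1 - Ω) * (X - 1) := by
    rw [hy, hXdef]; unfold ypar; ring
  have hy2 : y ^ 2 = (X - 1) * (X - z) := by
    rw [hy, ypar_sq h0 h1, hXdef, hz]; ring
  have hX1 : X - 1 ≠ 0 := by rw [hXdef]; simp; exact ⟨hC.ne', ha.ne'⟩
  have h1Ω : 1 - Ω ≠ 0 := by linarith
  have e : (1 + Ω) / (1 - Ω) = y / (X - 1) := by rw [hratio]; field_simp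
  rw [e]
  split_ifs
  · field_simp
    ring
  · field_simp
    linear_combination (W * X ^ N * hyper y z m (l - 1) ((n : ℤ) - m)) * hy2

/-- Exchanging the pairs (m,n) and (l,k) carries one conservation sector to the other, so the ladder
identities are needed in one sector only. -/
theorem kernel_swap (h0 : 0 < Ω) (h1 : Ω < 1) (ha : 0 ≤ α) (ha1 : α < 1) (m n k l : ℕ) :
    kernel Ω α l k n m = kernel Ω α m n k l := by
  by_cases h : m + k = n + l
  · rw [kernel_eq_sum_weight h0 h1 ha ha1 h, kernel_eq_sum_weight h0 h1 ha ha1 (by omega),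
      min_comm]
    refine Finset.sum_congr rfl fun u _ => ?_
    unfold weight
    congr 1; ring
  · rw [kernel_eq_zero h, kernel_eq_zero (by omega)]

theorem natCast_mul_bin_pred {N v : ℕ} (hv : v ≤ N) (ρ : ℝ) :
    ((N : ℝ) + 1) * bin N ρ v * (1 - ρ) = (N + 1 - v) * bin (N + 1) ρ v := by
  have h := Nat.add_one_mul_choose_eq N (N - v)
  have h2 : (N + 1) * N.choose v = (N + 1).choose v * (N + 1 - v) := by
    rw [← Nat.choose_symm hv, ← Nat.choose_symm (by omega : v ≤ N + 1)]
    rw [show N + 1 - v = N - v + 1 by omega]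
    exact h
  have h3 : ((N : ℝ) + 1) * N.choose v = (N + 1).choose v * (N + 1 - v) := by
    have := congrArg (Nat.cast : ℕ → ℝ) h2
    rw [Nat.cast_mul, Nat.cast_mul, Nat.cast_sub (by omega)] at this
    exact_mod_cast this
  unfold bin
  rw [show N + 1 - v = N - v + 1 by omega, pow_succ]
  linear_combination (ρ ^ v * (1 - ρ) ^ (N - v) * (1 - ρ)) * h3

/-- Raising n-1 and k by one multiplies the two r-binomials by (n-v)/(n(1-r)) and
(k+1-j)/((k+1)(1-r)). The conservation law gives n-v = k+1-j, so the square root of the product is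
rational in this number. -/
theorem weight_pred {q r : ℝ} (hr1 : r < 1) {m n k l u : ℕ}
    (h : m + 1 + k = n + l) (hum : u ≤ m) (hul : u ≤ l) :
    √n * weight q r m (n - 1) k l u
      = ((k : ℝ) + 1 - (l - u : ℕ)) / (√((k : ℝ) + 1) * (1 - r)) * weight q r m n (k + 1) l u := by
  have hr : 0 < 1 - r := by linarith
  have hk : (0 : ℝ) < k + 1 := by positivity
  rcases lt_or_ge n (m - u) with hv | hv
  · unfold weight
    rw [bin_eq_zero (by omega : n - 1 < m - u), bin_eq_zero hv]
    simp
  have hd : ((k : ℝ) + 1 - (l - u : ℕ)) = n - (m - u : ℕ) := by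
    rw [Nat.cast_sub hum, Nat.cast_sub hul]
    have : (m : ℝ) + 1 + k = n + l := by exact_mod_cast h
    linarith
  have hd0 : (0 : ℝ) ≤ n - (m - u : ℕ) := by rw [sub_nonneg]; exact_mod_cast hv
  -- At n = m-u the factor n-v vanishes; the left side vanishes as well, through √n if n = 0 and
  -- otherwise because n-1 < m-u.
  rcases hv.eq_or_lt with hv' | hv'
  · rw [hd, ← hv']
    rcases Nat.eq_zero_or_pos (m - u) with h3 | h3
    · simp [h3]
    · unfold weight
      rw [bin_eq_zero (by omega : m - u - 1 < m - u)]
      simp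
  obtain ⟨n, rfl⟩ : ∃ n', n = n' + 1 := ⟨n - 1, by omega⟩
  rw [Nat.add_sub_cancel]
  have b1 := natCast_mul_bin_pred (by omega : m - u ≤ n) r
  have b2 := natCast_mul_bin_pred (by omega : l - u ≤ k) r
  unfold weight
  rw [hd]
  push_cast at hd0 ⊢
  set d : ℝ := (n : ℝ) + 1 - (m - u : ℕ) with hddef
  set s := √((k : ℝ) + 1) with hs
  have hs0 : 0 < s := Real.sqrt_pos.2 hk
  have hss : s ^ 2 = k + 1 := Real.sq_sqrt hk.le
  have hc : 0 ≤ d / (s * (1 - r)) := by positivity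
  rw [← Real.sqrt_sq hc, ← Real.sqrt_mul (by positivity), ← Real.sqrt_mul (by positivity)]
  congr 1
  have hd' : (k : ℝ) + 1 - (l - u : ℕ) = d := by rw [hd]; push_cast; rfl
  rw [hd'] at b2
  rw [div_pow, mul_pow, hss]
  have hk' := hk.ne'
  have hr' := hr.ne'
  field_simp
  linear_combination (bin m q (m - u) * bin l q (l - u)) *
    (bin k r (l - u) * (k + 1) * (1 - r) * b1 + d * bin (n + 1) r (m - u) * b2)

/-- The commutator difference as a centered binomial average. -/
theorem ladder_eq_sum (h0 : 0 < Ω) (h1 : Ω < 1) (ha : 0 ≤ α) (ha1 : α < 1) {m n k l : ℕ}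
    (h : m + 1 + k = n + l) :
    √n * kernel Ω α m (n - 1) k l - √((k : ℝ) + 1) * kernel Ω α m n (k + 1) l =
      (1 + C Ω * α) / √((k : ℝ) + 1) * ∑ u ∈ Finset.range (min m l + 1),
        weight (qpar Ω α) (rpar Ω α) m n (k + 1) l u *
          (((k : ℝ) + 1) * rpar Ω α - (l - u : ℕ)) := by
  have hX := denom_pos h0 h1 ha
  have hr := one_sub_rpar h0 h1 ha
  have hr1 : rpar Ω α < 1 := by
    have : 0 < 1 / (1 + C Ω * α) := by positivity
    linarith
  have hC := C_pos h0 h1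

  have e1 : √n * kernel Ω α m (n - 1) k l = ∑ u ∈ Finset.range (min m l + 1),
      √n * weight (qpar Ω α) (rpar Ω α) m (n - 1) k l u := by
    rcases Nat.eq_zero_or_pos n with hn | hn
    · simp [hn]
    · rw [kernel_eq_sum_weight h0 h1 ha ha1 (by omega), Finset.mul_sum]
  rw [e1, kernel_eq_sum_weight h0 h1 ha ha1 (by omega), Finset.mul_sum, Finset.mul_sum,
    ← Finset.sum_sub_distrib]
  refine Finset.sum_congr rfl fun u hu => ?_
  have hu' : u ≤ min m l := by simpa [Nat.lt_succ_iff] using hu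
  rw [weight_pred hr1 h (hu'.trans (min_le_left _ _)) (hu'.trans (min_le_right _ _)), hr]
  have hk : (0 : ℝ) < k + 1 := by positivity
  set s := √((k : ℝ) + 1) with hs
  have hs0 : 0 < s := Real.sqrt_pos.2 hk
  have hss : s ^ 2 = k + 1 := Real.sq_sqrt hk.le
  -- The centering appears here: from rX = X-1, the combination (k+1-j)X - (k+1) equals X((k+1)r -
  -- j).
  have hrX : rpar Ω α * (1 + C Ω * α) = 1 + C Ω * α - 1 := by unfold rpar; field_simp; ring
  rw [← hss]
  field_simp
  linear_combination (-s ^ 2 * weight (qpar Ω α) (rpar Ω α) m n (k + 1) l u) * hrX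

end ladder

/-! ### Summing the weights, with and without tilting -/

section sums

variable {q r : ℝ} {m n k l : ℕ}

theorem weight_nonneg (q r : ℝ) (m n k l u : ℕ) : 0 ≤ weight q r m n k l u := Real.sqrt_nonneg _

theorem sum_bin_sub_le (h0 : 0 ≤ q) (h1 : q ≤ 1) (h : m ≤ l) :
    ∑ u ∈ Finset.range (m + 1), bin l q (l - u) ≤ 1 := by
  have hinj : Set.InjOn (fun u => l - u) (Finset.range (m + 1)) := by
    intro a ha b hb hab
    simp only [Finset.coe_range, Set.mem_Iio] at ha hb
    simp only at hab
    omega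
  rw [← Finset.sum_image (f := fun j => bin l q j) hinj]
  exact sum_bin_le_one h0 h1 l _

/-- By AM-GM each term is at most the mean of two probabilities. -/
theorem sum_sqrt_bin_mul_bin_le {q₁ q₂ : ℝ} (h0 : 0 ≤ q₁) (h1 : q₁ ≤ 1) (h0' : 0 ≤ q₂)
    (h1' : q₂ ≤ 1) (h : m ≤ l) :
    ∑ u ∈ Finset.range (m + 1), √(bin m q₁ (m - u) * bin l q₂ (l - u)) ≤ 1 := by
  have key : ∀ u ∈ Finset.range (m + 1), √(bin m q₁ (m - u) * bin l q₂ (l - u))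
      ≤ (bin m q₁ (m - u) + bin l q₂ (l - u)) / 2 := fun u _ => by
    have a := bin_nonneg h0 h1 m (m - u)
    have b := bin_nonneg h0' h1' l (l - u)
    rw [Real.sqrt_le_left (by positivity)]
    nlinarith [sq_nonneg (bin m q₁ (m - u) - bin l q₂ (l - u))]
  refine (Finset.sum_le_sum key).trans ?_
  rw [← Finset.sum_div, Finset.sum_add_distrib]
  have := sum_bin_sub_le h0 h1 (le_refl m)
  have := sum_bin_sub_le h0' h1' h
  linarith

/-- The q-half carries the summation over u, while the r-half together with f is only bounded
pointwise. -/
theorem sum_weight_mul_le {f : ℕ → ℝ} {β : ℝ} (h0 : 0 ≤ q) (h1 : q ≤ 1) (h : m ≤ l)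
    (hβ : 0 ≤ β) (hf : ∀ u, u ≤ m → 0 ≤ f u)
    (hb : ∀ u, u ≤ m → f u ^ 2 * (bin n r (m - u) * bin k r (l - u)) ≤ β ^ 2) :
    ∑ u ∈ Finset.range (m + 1), weight q r m n k l u * f u ≤ β := by
  calc _ ≤ ∑ u ∈ Finset.range (m + 1), √(bin m q (m - u) * bin l q (l - u)) * β := by
        refine Finset.sum_le_sum fun u hu => ?_
        have hu' : u ≤ m := by have := Finset.mem_range.1 hu; omega
        have a := bin_nonneg h0 h1 m (m - u)
        have b := bin_nonneg h0 h1 l (l - u)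
        unfold weight
        rw [← Real.sqrt_sq hβ, ← Real.sqrt_mul (by positivity)]
        calc _ = √((bin m q (m - u) * bin l q (l - u)) * (bin n r (m - u) * bin k r (l - u)))
              * √(f u ^ 2) := by rw [Real.sqrt_sq (hf u hu')]
          _ = √((bin m q (m - u) * bin l q (l - u)) * (f u ^ 2 *
              (bin n r (m - u) * bin k r (l - u)))) := by
              rw [← Real.sqrt_mul' _ (sq_nonneg _)]; congr 1; ring
          _ ≤ _ := Real.sqrt_le_sqrt (by gcongr; exact hb u hu')
    _ ≤ 1 * β := by
        rw [← Finset.sum_mul]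
        gcongr
        exact sum_sqrt_bin_mul_bin_le h0 h1 h0 h1 h
    _ = β := one_mul β

/-- Exponential change of parameters in the four binomial weights at once. -/
theorem weight_mul_exp_le (hq0 : 0 ≤ q) (hq1 : q ≤ 1) (hr0 : 0 ≤ r) (hr1 : r ≤ 1)
    {t τ e₃ e₄ : ℝ} (hτ : |τ| ≤ 1) (h3 : |-t - τ - 2 * e₃| ≤ 1) (h4 : |t - 2 * e₄| ≤ 1)
    (h : m + k = n + l) {u : ℕ} (hum : u ≤ m) (hml : m ≤ l) :
    weight q r m n k l u
        * Real.exp (-e₃ * ((m - u : ℕ) - n * r) - e₄ * ((l - u : ℕ) - k * r)) ≤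
      √(bin m (tilt q τ) (m - u) * bin l q (l - u)) *
        √(bin n (tilt r (-t - τ - 2 * e₃)) (m - u) * bin k (tilt r (t - 2 * e₄)) (l - u)) *
        Real.exp ((-(t * (l - m : ℕ) * (1 - r)) + τ * (m * q - n * r) + m * q * τ ^ 2
          + n * r * (-t - τ - 2 * e₃) ^ 2 + k * r * (t - 2 * e₄) ^ 2) / 2) := by
  set t₃ := -t - τ - 2 * e₃ with ht₃
  set t₄ := t - 2 * e₄ with ht₄
  have b1 := bin_le_bin_tilt hq0 hq1 hτ m (m - u)
  have b3 := bin_le_bin_tilt hr0 hr1 h3 n (m - u)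
  have b4 := bin_le_bin_tilt hr0 hr1 h4 k (l - u)
  have n1 := bin_nonneg hq0 hq1 m (m - u)
  have n2 := bin_nonneg hq0 hq1 l (l - u)
  have n3 := bin_nonneg hr0 hr1 n (m - u)
  have n4 := bin_nonneg hr0 hr1 k (l - u)
  have n1' := bin_nonneg (tilt_nonneg hq0 hq1 τ) (tilt_le_one hq0 hq1 τ) m (m - u)
  have n3' := bin_nonneg (tilt_nonneg hr0 hr1 t₃) (tilt_le_one hr0 hr1 t₃) n (m - u)
  have n4' := bin_nonneg (tilt_nonneg hr0 hr1 t₄) (tilt_le_one hr0 hr1 t₄) k (l - u)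
  set E₁ := -τ * (m - u : ℕ) + m * q * (τ + τ ^ 2)
  set E₃ := -t₃ * (m - u : ℕ) + n * r * (t₃ + t₃ ^ 2)
  set E₄ := -t₄ * (l - u : ℕ) + k * r * (t₄ + t₄ ^ 2)
  have hw : weight q r m n k l u ≤ √(bin m (tilt q τ) (m - u) * bin l q (l - u)) *
      √(bin n (tilt r t₃) (m - u) * bin k (tilt r t₄) (l - u)) *
        Real.exp ((E₁ + E₃ + E₄) / 2) := by
    have hexp : Real.exp ((E₁ + E₃ + E₄) / 2)
        = √(Real.exp E₁ * Real.exp E₃ * Real.exp E₄) := by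
      rw [← Real.exp_add, ← Real.exp_add, Real.exp_half]
    rw [hexp, ← Real.sqrt_mul (by positivity), ← Real.sqrt_mul (by positivity)]
    apply Real.sqrt_le_sqrt
    calc _ ≤ ((bin m (tilt q τ) (m - u) * Real.exp E₁) * bin l q (l - u)) *
          ((bin n (tilt r t₃) (m - u) * Real.exp E₃)
            * (bin k (tilt r t₄) (l - u) * Real.exp E₄)) := by gcongr
      _ = _ := by ring
  refine (mul_le_mul_of_nonneg_right hw (Real.exp_pos _).le).trans_eq ?_
  rw [mul_assoc (_ * _) (Real.exp _) (Real.exp _), ← Real.exp_add]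
  congr 2
  have c1 : ((m - u : ℕ) : ℝ) = m - u := Nat.cast_sub hum
  have c2 : ((l - u : ℕ) : ℝ) = l - u := Nat.cast_sub (hum.trans hml)
  have c3 : ((l - m : ℕ) : ℝ) = l - m := Nat.cast_sub hml
  have c4 : (k : ℝ) = n + l - m := by
    have : (m : ℝ) + k = n + l := by exact_mod_cast h
    linarith
  simp only [E₁, E₃, E₄, c1, c2, c3, ht₃, ht₄]
  rw [c4]
  ring

theorem sum_weight_mul_exp_le (hq0 : 0 ≤ q) (hq1 : q ≤ 1) (hr0 : 0 ≤ r) (hr1 : r ≤ 1)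
    {t τ e₃ e₄ β : ℝ} (hτ : |τ| ≤ 1) (h3 : |-t - τ - 2 * e₃| ≤ 1) (h4 : |t - 2 * e₄| ≤ 1)
    (h : m + k = n + l) (hml : m ≤ l) (hβ : 0 ≤ β)
    (hb : ∀ v j, bin n (tilt r (-t - τ - 2 * e₃)) v * bin k (tilt r (t - 2 * e₄)) j ≤ β ^ 2) :
    ∑ u ∈ Finset.range (m + 1), weight q r m n k l u
        * Real.exp (-e₃ * ((m - u : ℕ) - n * r) - e₄ * ((l - u : ℕ) - k * r)) ≤
      β * Real.exp ((-(t * (l - m : ℕ) * (1 - r)) + τ * (m * q - n * r) + m * q * τ ^ 2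
          + n * r * (-t - τ - 2 * e₃) ^ 2 + k * r * (t - 2 * e₄) ^ 2) / 2) := by
  set E := Real.exp ((-(t * (l - m : ℕ) * (1 - r)) + τ * (m * q - n * r) + m * q * τ ^ 2
          + n * r * (-t - τ - 2 * e₃) ^ 2 + k * r * (t - 2 * e₄) ^ 2) / 2)
  calc _ ≤ ∑ u ∈ Finset.range (m + 1),
        √(bin m (tilt q τ) (m - u) * bin l q (l - u)) * (β * E) := by
        refine Finset.sum_le_sum fun u hu => ?_
        have hu' : u ≤ m := by have := Finset.mem_range.1 hu; omega
        refine (weight_mul_exp_le hq0 hq1 hr0 hr1 hτ h3 h4 h hu' hml).trans ?_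
        rw [mul_assoc]
        have : √(bin n (tilt r (-t - τ - 2 * e₃)) (m - u) *
            bin k (tilt r (t - 2 * e₄)) (l - u)) ≤ β := by
          rw [Real.sqrt_le_left hβ]
          exact hb _ _
        gcongr
    _ ≤ 1 * (β * E) := by
        rw [← Finset.sum_mul]
        gcongr
        exact sum_sqrt_bin_mul_bin_le (tilt_nonneg hq0 hq1 τ) (tilt_le_one hq0 hq1 τ) hq0 hq1 hml
    _ = β * E := one_mul _

/-- Write l-u = (l-m) + (m-u) and use a!b! ≤ (a+b)!; what remains is a partial exponential series.
-/
theorem sum_pow_div_factorial_le {a : ℝ} (ha : 0 ≤ a) (h : m ≤ l) :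
    ∑ u ∈ Finset.range (m + 1), a ^ (l - u) / (l - u).factorial
      ≤ a ^ (l - m) / (l - m).factorial * Real.exp a := by
  have key : ∀ u ∈ Finset.range (m + 1), a ^ (l - u) / ((l - u).factorial : ℝ)
      ≤ a ^ (l - m) / (l - m).factorial * (a ^ (m - u) / (m - u).factorial) := fun u hu => by
    have hu' : u ≤ m := by have := Finset.mem_range.1 hu; omega
    rw [div_mul_div_comm, ← pow_add, show l - m + (m - u) = l - u by omega]
    have h2 : ((l - m).factorial : ℝ) * (m - u).factorial ≤ (l - u).factorial := by
      have := Nat.le_of_dvd (Nat.factorial_pos _)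
        (Nat.factorial_mul_factorial_dvd_factorial_add (l - m) (m - u))
      rw [show l - m + (m - u) = l - u by omega] at this
      exact_mod_cast this
    gcongr
  refine (Finset.sum_le_sum key).trans ?_
  rw [← Finset.mul_sum]
  gcongr
  have h2 := Finset.sum_range_reflect (fun i => a ^ i / (i.factorial : ℝ)) (m + 1)
  rw [Nat.add_sub_cancel] at h2
  exact h2.le.trans (Real.sum_le_exp_of_nonneg ha (m + 1))

end sums
-- Size of the two success probabilities
section parameters

variable {Ω α : ℝ}

theorem rpar_pos (h0 : 0 < Ω) (h1 : Ω < 1) (ha : 0 < α) : 0 < rpar Ω α := by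
  have := C_pos h0 h1
  unfold rpar; positivity

theorem rpar_le (h0 : 0 < Ω) (h1 : Ω < 1) (ha : 0 < α) : rpar Ω α ≤ C Ω * α := by
  have := C_pos h0 h1
  exact div_le_self (by positivity) (by nlinarith [mul_pos this ha])

theorem rpar_lt_one (h0 : 0 < Ω) (h1 : Ω < 1) (ha : 0 < α) : rpar Ω α < 1 := by
  have := C_pos h0 h1
  unfold rpar
  rw [div_lt_one (by positivity)]; linarith

theorem qpar_pos (h0 : 0 < Ω) (h1 : Ω < 1) (ha : 0 < α) : 0 < qpar Ω α := by
  have := C_pos h0 h1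
  unfold qpar; positivity

theorem qpar_le (h0 : 0 < Ω) (h1 : Ω < 1) (ha : 0 < α) : qpar Ω α ≤ (1 + C Ω) * α := by
  have := C_pos h0 h1
  exact div_le_self (by positivity) (by nlinarith [mul_pos this ha])

theorem qpar_lt_one (h0 : 0 < Ω) (h1 : Ω < 1) (ha : 0 < α) (ha1 : α < 1) : qpar Ω α < 1 := by
  have := C_pos h0 h1
  unfold qpar
  rw [div_lt_one (by positivity)]; linarith

theorem rpar_le_qpar (h0 : 0 < Ω) (h1 : Ω < 1) (ha : 0 < α) : rpar Ω α ≤ qpar Ω α := by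
  have := C_pos h0 h1
  unfold rpar qpar
  gcongr
  linarith

theorem inv_le_one_sub_rpar (h0 : 0 < Ω) (h1 : Ω < 1) (ha : 0 < α) (ha1 : α < 1) : 1 / (1 + C Ω) ≤ 1 - rpar Ω α := by
  have := C_pos h0 h1
  rw [one_sub_rpar h0 h1 ha.le]
  gcongr
  nlinarith

theorem rpar_ge (h0 : 0 < Ω) (h1 : Ω < 1) (ha : 0 < α) (ha1 : α < 1) : C Ω / (1 + C Ω) * α ≤ rpar Ω α := by
  have := C_pos h0 h1
  unfold rpar
  rw [div_mul_eq_mul_div]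
  gcongr
  nlinarith

end parameters

/-! ### Large αk with n comparable to k: tilting and the local limit bound -/

/-- The tilt parameter that produces the decay in `p`. -/
noncomputable def tiltP (Ω α : ℝ) (p k : ℕ) : ℝ :=
  min (1 / 4) (p * (1 / (1 + C Ω)) / (10 * (k * qpar Ω α)))

/-- The exponential rate produced by the change of parameters. -/
noncomputable def rate (Ω α : ℝ) (m n k p : ℕ) : ℝ :=
  tiltP Ω α p k * p * (1 / (1 + C Ω)) / 4
    + (m * qpar Ω α - n * rpar Ω α) ^ 2 / (32 * (k * qpar Ω α))

section large

variable {Ω α : ℝ} {m n k l : ℕ}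

/-- Each of the two r-binomials contributes (αk)^(-1/2) in the application; after the square root in
the weights one such factor survives. -/
theorem bin_tilt_mul_bin_tilt_le {r ε κ : ℝ} (hr0 : 0 ≤ r) (hr1 : r ≤ 1) {t₃ t₄ : ℝ}
    (h3 : |t₃| ≤ 1) (h4 : |t₄| ≤ 1) (hκ : 0 < κ) (hn : κ ≤ n * (r * (1 - r)))
    (hk : κ ≤ k * (r * (1 - r))) (hε : ε = Real.exp (-3)) (v j : ℕ) :
    bin n (tilt r t₃) v * bin k (tilt r t₄) j ≤ (1 / √(ε * κ)) ^ 2 := by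
  have hε0 : 0 < ε := hε ▸ Real.exp_pos _
  have key : ∀ (N : ℕ) (t : ℝ) (i : ℕ), |t| ≤ 1 → κ ≤ N * (r * (1 - r)) →
      bin N (tilt r t) i ≤ 1 / √(ε * κ) := fun N t i ht hN => by
    have g := tilt_mul_one_sub_tilt_ge hr0 hr1 ht
    have g2 : ε * κ ≤ N * tilt r t * (1 - tilt r t) := by
      rw [hε]
      calc _ ≤ Real.exp (-3) * (N * (r * (1 - r))) := by gcongr
        _ = N * (Real.exp (-3) * (r * (1 - r))) := by ring
        _ ≤ N * (tilt r t * (1 - tilt r t)) := by gcongr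
        _ = _ := by ring
    have g3 : 0 < ε * κ := by positivity
    refine (bin_le_one_div_sqrt (tilt_nonneg hr0 hr1 t) (tilt_le_one hr0 hr1 t)
      (g3.trans_le g2) i).trans ?_
    gcongr
  rw [sq]
  exact mul_le_mul (key n t₃ v h3 hn) (key k t₄ j h4 hk)
    (bin_nonneg (tilt_nonneg hr0 hr1 t₄) (tilt_le_one hr0 hr1 t₄) k j) (by positivity)

/-- The quadratic costs add up to 5Qt² + 4Qτ² plus a bounded contribution of e₃ and e₄. The size of
t makes 5Qt² at most half the gain tpλ, and τ = -δ/(8Q) minimizes τδ + 4Qτ². -/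
theorem tilt_exponent_le {Q A B D t τ p lam r e₃ e₄ c : ℝ} (hQ : 0 < Q) (hA : A ≤ Q)
    (hA0 : 0 ≤ A) (hB : B ≤ Q) (hB0 : 0 ≤ B) (hD : D ≤ Q) (ht : 0 ≤ t)
    (htp : 10 * Q * t ≤ p * lam) (hlam : lam ≤ 1 - r) (hp : 0 ≤ p) (δ : ℝ)
    (hτ : τ = -δ / (8 * Q)) (h3 : A * e₃ ^ 2 ≤ c / 64) (h4 : B * e₄ ^ 2 ≤ c / 64) :
    (-(t * p * (1 - r)) + τ * δ + D * τ ^ 2 + A * (-t - τ - 2 * e₃) ^ 2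
      + B * (t - 2 * e₄) ^ 2) / 2 ≤ c / 6 - (t * p * lam / 4 + δ ^ 2 / (32 * Q)) := by
  have i1 : t * p * lam ≤ t * p * (1 - r) := by gcongr
  have i2 : D * τ ^ 2 ≤ Q * τ ^ 2 := by gcongr
  have i3 : A * (-t - τ - 2 * e₃) ^ 2 ≤ Q * (3 * t ^ 2 + 3 * τ ^ 2) + 3 / 16 * c := by
    have j1 : (-t - τ - 2 * e₃) ^ 2 ≤ 3 * t ^ 2 + 3 * τ ^ 2 + 12 * e₃ ^ 2 := by
      nlinarith [sq_nonneg (t - τ), sq_nonneg (t - 2 * e₃), sq_nonneg (τ - 2 * e₃)]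
    calc _ ≤ A * (3 * t ^ 2 + 3 * τ ^ 2 + 12 * e₃ ^ 2) := by gcongr
      _ = A * (3 * t ^ 2 + 3 * τ ^ 2) + 12 * (A * e₃ ^ 2) := by ring
      _ ≤ Q * (3 * t ^ 2 + 3 * τ ^ 2) + 12 * (c / 64) := by gcongr
      _ = _ := by ring
  have i4 : B * (t - 2 * e₄) ^ 2 ≤ Q * (2 * t ^ 2) + 1 / 8 * c := by
    have j1 : (t - 2 * e₄) ^ 2 ≤ 2 * t ^ 2 + 8 * e₄ ^ 2 := by
      nlinarith [sq_nonneg (t + 2 * e₄)]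
    calc _ ≤ B * (2 * t ^ 2 + 8 * e₄ ^ 2) := by gcongr
      _ = B * (2 * t ^ 2) + 8 * (B * e₄ ^ 2) := by ring
      _ ≤ Q * (2 * t ^ 2) + 8 * (c / 64) := by gcongr
      _ = _ := by ring
  have i5 : 5 * Q * t ^ 2 ≤ t * p * lam / 2 := by
    have := mul_le_mul_of_nonneg_left htp ht
    linarith
  have i6 : τ * δ + 4 * Q * τ ^ 2 = -(δ ^ 2 / (16 * Q)) := by
    rw [hτ]; field_simp; ring
  have i8 : δ ^ 2 / (32 * Q) = δ ^ 2 / (16 * Q) / 2 := by rw [div_div]; ring_nf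
  have hc : 0 ≤ c := by nlinarith [mul_nonneg hA0 (sq_nonneg e₃)]
  rw [i8]
  linarith

/-- The lower bound on n gives the n-binomial a variance of order αk too. The parameters e₃, e₄ are
of order (αk)^(-1/2), the inverse standard deviation, so they generate first moments at bounded
cost. -/
theorem exists_sum_weight_mul_exp_le (h0 : 0 < Ω) (h1 : Ω < 1) :
    ∃ K : ℝ, 0 < K ∧ ∀ (α : ℝ) (m n k l : ℕ), 0 < α → α < 1 → m + k = n + l → m ≤ n → m ≤ l →
      1 ≤ α * k → 1 / (2 * (1 + C Ω)) * k ≤ n → ∀ e₃ e₄ : ℝ, e₃ ^ 2 * (α * k) ≤ 1 / 64 →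
      e₄ ^ 2 * (α * k) ≤ 1 / 64 →
      ∑ u ∈ Finset.range (m + 1), weight (qpar Ω α) (rpar Ω α) m n k l u
        * Real.exp (-e₃ * ((m - u : ℕ) - n * rpar Ω α) - e₄ * ((l - u : ℕ) - k * rpar Ω α)) ≤
      K / √(α * k) * Real.exp (-rate Ω α m n k (l - m)) := by
  have hC := C_pos h0 h1
  set η := 1 / (2 * (1 + C Ω)) with hη
  set lam := 1 / (1 + C Ω) with hlam
  have hlam0 : 0 < lam := by positivity
  have hη0 : 0 < η := by positivity
  have hη1 : η ≤ 1 := by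
    rw [hη, div_le_one (by positivity)]; linarith
  have hlam1 : lam ≤ 1 := by rw [hlam, div_le_one (by positivity)]; linarith
  set c₀ := Real.exp (-3) * (η * (C Ω * lam * lam)) with hc₀
  have hc₀0 : 0 < c₀ := by positivity
  refine ⟨1 / √c₀ * Real.exp (C Ω / 6), by positivity, ?_⟩
  intro α m n k l ha ha1 h hmn hml hak hn e₃ e₄ he3 he4
  set q := qpar Ω α with hq
  set r := rpar Ω α with hr
  have hq0 : 0 < q := qpar_pos h0 h1 ha
  have hq1 : q < 1 := qpar_lt_one h0 h1 ha ha1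
  have hr0 : 0 < r := rpar_pos h0 h1 ha
  have hr1 : r < 1 := rpar_lt_one h0 h1 ha
  have hrq : r ≤ q := rpar_le_qpar h0 h1 ha
  have hrC : r ≤ C Ω * α := rpar_le h0 h1 ha
  have hrge : C Ω * lam * α ≤ r := by
    have := rpar_ge h0 h1 ha ha1
    rw [hlam]; convert this using 1; ring
  have hlamr : lam ≤ 1 - r := inv_le_one_sub_rpar h0 h1 ha ha1
  have hnk : n ≤ k := by omega
  have hmk : m ≤ k := by omega
  have hnk' : (n : ℝ) ≤ k := by exact_mod_cast hnk
  have hmk' : (m : ℝ) ≤ k := by exact_mod_cast hmk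
  have hk0 : (0 : ℝ) < k := by
    rcases Nat.eq_zero_or_pos k with hk | hk
    · subst hk; norm_num at hak
    · exact_mod_cast hk
  set Q := k * q with hQ
  have hQ0 : 0 < Q := by positivity
  have hmq : m * q ≤ Q := by rw [hQ]; gcongr
  have hnr : n * r ≤ Q := by rw [hQ]; gcongr
  have hkr : k * r ≤ Q := by rw [hQ]; gcongr
  have hnr0 : 0 ≤ n * r := by positivity
  have hmq0 : 0 ≤ m * q := by positivity
  set δ := m * q - n * r with hδ
  have hδQ : |δ| ≤ Q := abs_le.2 ⟨by linarith, by linarith⟩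
  set p := l - m with hp
  set t := tiltP Ω α p k with ht
  have ht0 : 0 ≤ t := le_min (by norm_num) (by positivity)
  have ht1 : t ≤ 1 / 4 := min_le_left _ _
  have ht2 : 10 * Q * t ≤ p * lam := by
    have : t ≤ p * lam / (10 * Q) := min_le_right _ _
    rw [le_div_iff₀ (by positivity)] at this
    linarith
  set τ := -δ / (8 * Q) with hτ
  have hτ1 : |τ| ≤ 1 / 8 := by
    rw [hτ, abs_div, abs_neg, abs_of_pos (by positivity : 0 < 8 * Q), div_le_iff₀ (by positivity)]
    linarith
  have hsmall : ∀ e : ℝ, e ^ 2 * (α * k) ≤ 1 / 64 → |e| ≤ 1 / 8 := fun e he => by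
    apply abs_le_of_sq_le_sq _ (by norm_num)
    nlinarith [sq_nonneg e]
  have he3' := abs_le.1 (hsmall e₃ he3)
  have he4' := abs_le.1 (hsmall e₄ he4)
  have hτ' := abs_le.1 hτ1
  -- The tilts stay in the admissible range: 1/4 + 1/8 + 2/8 ≤ 1.
  have h3 : |-t - τ - 2 * e₃| ≤ 1 := abs_le.2 ⟨by linarith, by linarith⟩
  have h4 : |t - 2 * e₄| ≤ 1 := abs_le.2 ⟨by linarith, by linarith⟩
  have hκ0 : 0 < η * (C Ω * lam * lam) * (α * k) := by positivity
  have hrr : C Ω * lam * lam * α ≤ r * (1 - r) := by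
    calc C Ω * lam * lam * α = (C Ω * lam * α) * lam := by ring
      _ ≤ r * (1 - r) := by gcongr
  have hkk : η * (C Ω * lam * lam) * (α * k) ≤ n * (r * (1 - r)) := by
    calc _ = (η * k) * (C Ω * lam * lam * α) := by ring
      _ ≤ n * (r * (1 - r)) := by gcongr
  have hkk' : η * (C Ω * lam * lam) * (α * k) ≤ k * (r * (1 - r)) := by
    refine hkk.trans ?_
    have : 0 ≤ r * (1 - r) := mul_nonneg hr0.le (by linarith)
    gcongr
  refine (sum_weight_mul_exp_le hq0.le hq1.le hr0.le hr1.le (hτ1.trans (by norm_num)) h3 h4 h hml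
    (by positivity) (fun v j => bin_tilt_mul_bin_tilt_le hr0.le hr1.le h3 h4 hκ0 hkk hkk' rfl v j)
    ).trans ?_
  have hpre : 1 / √(Real.exp (-3) * (η * (C Ω * lam * lam) * (α * k)))
      = 1 / √c₀ / √(α * k) := by
    rw [div_div, ← Real.sqrt_mul hc₀0.le]; congr 2; rw [hc₀]; ring
  rw [hpre]
  have hec : ∀ (N : ℕ) (e : ℝ), N ≤ k → e ^ 2 * (α * k) ≤ 1 / 64 → N * r * e ^ 2 ≤ C Ω / 64 :=
    fun N e hN he => by
      have hN' : (N : ℝ) ≤ k := by exact_mod_cast hN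
      calc N * r * e ^ 2 ≤ k * (C Ω * α) * e ^ 2 := by gcongr
        _ = C Ω * (e ^ 2 * (α * k)) := by ring
        _ ≤ C Ω * (1 / 64) := by gcongr
        _ = _ := by ring
  have hfin := tilt_exponent_le hQ0 hnr hnr0 hkr (by positivity) hmq ht0 ht2 hlamr
    (by positivity : (0 : ℝ) ≤ p) δ hτ (hec n e₃ hnk he3) (hec k e₄ le_rfl he4)
  calc _ ≤ 1 / √c₀ / √(α * k) * Real.exp (C Ω / 6 - rate Ω α m n k p) := by
        gcongr
        exact hfin
    _ = _ := by rw [sub_eq_add_neg, Real.exp_add]; ring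

end large

/-! ### The three sums in the three regimes -/

/-- Sum of the weights. -/
noncomputable def plainSum (Ω α : ℝ) (m n k l : ℕ) : ℝ :=
  ∑ u ∈ Finset.range (m + 1), weight (qpar Ω α) (rpar Ω α) m n k l u

/-- First absolute centered moment in the index `k`, normalized. -/
noncomputable def upperSum (Ω α : ℝ) (m n k l : ℕ) : ℝ :=
  (∑ u ∈ Finset.range (m + 1), weight (qpar Ω α) (rpar Ω α) m n k l u *
    |k * rpar Ω α - (l - u : ℕ)|) / √(α * k)

/-- First absolute centered moment in the index `n`, normalized. -/
noncomputable def lowerSum (Ω α : ℝ) (m n k l : ℕ) : ℝ :=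
  (∑ u ∈ Finset.range (m + 1), weight (qpar Ω α) (rpar Ω α) m n k l u *
    |n * rpar Ω α - (m - u : ℕ)|) / √(α * n)

theorem abs_le_exp_add_exp_neg (x : ℝ) : |x| ≤ Real.exp x + Real.exp (-x) := by
  have h1 := Real.add_one_le_exp x
  have h2 := Real.add_one_le_exp (-x)
  have h3 := Real.exp_pos x
  have h4 := Real.exp_pos (-x)
  exact abs_le.2 ⟨by linarith, by linarith⟩

/-- First absolute moments follow from exponential moments of both signs, at the scale of one
standard deviation. -/
theorem exists_sums_le_of_large (Ω : ℝ) (h0 : 0 < Ω) (h1 : Ω < 1) :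
    ∃ K : ℝ, 0 < K ∧ ∀ (α : ℝ) (m n k l : ℕ), 0 < α → α < 1 → m + k = n + l → m ≤ n → m ≤ l →
      1 ≤ α * k → 1 / (2 * (1 + C Ω)) * k ≤ n →
      plainSum Ω α m n k l ≤ K / √(α * k) * Real.exp (-rate Ω α m n k (l - m)) ∧
      upperSum Ω α m n k l ≤ K / √(α * k) * Real.exp (-rate Ω α m n k (l - m)) ∧
      lowerSum Ω α m n k l ≤ K / √(α * k) * Real.exp (-rate Ω α m n k (l - m)) := by
  obtain ⟨K, hK, H⟩ := exists_sum_weight_mul_exp_le h0 h1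
  have hC := C_pos h0 h1
  set η := 1 / (2 * (1 + C Ω)) with hη
  have hη0 : 0 < η := by positivity
  have hη1 : η ≤ 1 := by rw [hη, div_le_one (by positivity)]; linarith
  have hsη : √η ≤ 1 := Real.sqrt_le_one.2 hη1
  have hsη0 : 0 < √η := Real.sqrt_pos.2 hη0
  refine ⟨16 * K / √η, by positivity, ?_⟩
  intro α m n k l ha ha1 h hmn hml hak hn
  specialize H α m n k l ha ha1 h hmn hml hak hn
  set w := weight (qpar Ω α) (rpar Ω α) m n k l with hw
  have hw0 : ∀ u, 0 ≤ w u := fun u => weight_nonneg _ _ _ _ _ _ u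
  set B := K / √(α * k) * Real.exp (-rate Ω α m n k (l - m)) with hB
  have hak0 : 0 < α * k := by linarith
  have hB0 : 0 < B := by positivity
  have hBB : 16 * K / √η / √(α * k) * Real.exp (-rate Ω α m n k (l - m)) = 16 * B / √η := by
    rw [hB]; ring
  rw [hBB]
  have hB1 : 16 * B ≤ 16 * B / √η := le_div_self (by positivity) hsη0 hsη
  set ε := 1 / (8 * √(α * k)) with hε
  have hsak : 0 < √(α * k) := Real.sqrt_pos.2 hak0
  have hε0 : 0 < ε := by positivity
  have hε2 : ε ^ 2 * (α * k) ≤ 1 / 64 := by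
    rw [hε, div_pow, mul_pow, Real.sq_sqrt hak0.le]
    rw [div_mul_eq_mul_div, mul_div_mul_right _ _ hak0.ne']; norm_num
  have hε2' : (-ε) ^ 2 * (α * k) ≤ 1 / 64 := by rwa [neg_sq]
  have hz : (0 : ℝ) ^ 2 * (α * k) ≤ 1 / 64 := by norm_num
  have hmoment : ∀ x : ℕ → ℝ, (∑ u ∈ Finset.range (m + 1), w u * Real.exp (-ε * x u) ≤ B) →
      (∑ u ∈ Finset.range (m + 1), w u * Real.exp (ε * x u) ≤ B) →
      (∑ u ∈ Finset.range (m + 1), w u * |x u|) / √(α * k) ≤ 16 * B := by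
    intro x hx1 hx2
    rw [div_le_iff₀ hsak]
    have hpt : ∀ u ∈ Finset.range (m + 1), w u * |x u| ≤
        (w u * Real.exp (-ε * x u) + w u * Real.exp (ε * x u)) * (8 * √(α * k)) := by
      intro u _
      have := abs_le_exp_add_exp_neg (ε * x u)
      rw [abs_mul, abs_of_pos hε0, ← neg_mul] at this
      have h2 : |x u| = ε * |x u| * (8 * √(α * k)) := by rw [hε]; field_simp
      rw [h2]
      calc w u * (ε * |x u| * (8 * √(α * k)))
          ≤ w u * ((Real.exp (ε * x u) + Real.exp (-ε * x u)) * (8 * √(α * k))) := by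
            gcongr
            exact hw0 u
        _ = _ := by ring
    refine (Finset.sum_le_sum hpt).trans ?_
    rw [← Finset.sum_mul, Finset.sum_add_distrib]
    calc _ ≤ (B + B) * (8 * √(α * k)) := by gcongr
      _ = _ := by ring
  refine ⟨?_, ?_, ?_⟩
  · have := H 0 0 hz hz
    simp only [neg_zero, zero_mul, sub_zero, Real.exp_zero, mul_one] at this
    refine (this.trans ?_).trans hB1
    linarith
  · refine le_trans ?_ hB1
    have e1 := H 0 ε hz hε2
    have e2 := H 0 (-ε) hz hε2'
    simp only [neg_zero, zero_mul, zero_sub] at e1 e2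
    have := hmoment (fun u => ((l - u : ℕ) : ℝ) - k * rpar Ω α)
      (by simpa only [neg_mul] using e1) (by simpa only [neg_mul, neg_neg] using e2)
    unfold upperSum
    simpa only [abs_sub_comm] using this
  · have e1 := H ε 0 hε2 hz
    have e2 := H (-ε) 0 hε2' hz
    simp only [zero_mul, sub_zero, neg_neg] at e1 e2
    have := hmoment (fun u => ((m - u : ℕ) : ℝ) - n * rpar Ω α) e1 e2
    unfold lowerSum
    simp only [abs_sub_comm (n * rpar Ω α)]
    -- This sum is normalized by αn instead of αk; comparability of n and k costs 1/√η.
    have hcmp : √η * √(α * k) ≤ √(α * n) := by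
      rw [← Real.sqrt_mul hη0.le]
      apply Real.sqrt_le_sqrt
      calc η * (α * k) = α * (η * k) := by ring
        _ ≤ α * n := by gcongr
    have hS : 0 ≤ ∑ u ∈ Finset.range (m + 1), w u * |((m - u : ℕ) : ℝ) - n * rpar Ω α| :=
      Finset.sum_nonneg fun u _ => mul_nonneg (hw0 u) (abs_nonneg _)
    calc _ ≤ (∑ u ∈ Finset.range (m + 1), w u * |((m - u : ℕ) : ℝ) - n * rpar Ω α|)
          / (√η * √(α * k)) := by gcongr
      _ = (∑ u ∈ Finset.range (m + 1), w u * |((m - u : ℕ) : ℝ) - n * rpar Ω α|)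
          / √(α * k) / √η := by rw [div_div, mul_comm (√η)]
      _ ≤ 16 * B / √η := by gcongr

theorem mul_exp_neg_le {a : ℝ} (ha : 0 < a) (x : ℝ) : x * Real.exp (-(2 * a * x)) ≤
    1 / a * Real.exp (-(a * x)) := by
  have h2 : Real.exp (-(2 * a * x)) = Real.exp (-(a * x)) * Real.exp (-(a * x)) := by
    rw [← Real.exp_add]; congr 1; ring
  have h3 : a * x * Real.exp (-(a * x)) ≤ 1 := by
    have := Real.add_one_le_exp (a * x)
    rw [Real.exp_neg, ← div_eq_mul_inv, div_le_one (Real.exp_pos _)]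
    linarith
  rw [h2]
  calc _ = 1 / a * (a * x * Real.exp (-(a * x))) * Real.exp (-(a * x)) := by field_simp
    _ ≤ 1 / a * 1 * Real.exp (-(a * x)) := by gcongr
    _ = _ := by ring

theorem sq_mul_bin_rpar_le {Ω α : ℝ} (h0 : 0 < Ω) (h1 : Ω < 1) (ha : 0 < α) (n v : ℕ) :
    (n * rpar Ω α - v) ^ 2 * bin n (rpar Ω α) v ≤ C Ω * (α * n) := by
  refine (sq_mul_bin_le (rpar_pos h0 h1 ha).le (rpar_lt_one h0 h1 ha).le n v).trans ?_
  calc n * rpar Ω α ≤ n * (C Ω * α) := by gcongr; exact rpar_le h0 h1 ha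
    _ = _ := by ring

/-- Every j occurring is at least k - n ≥ (1-η)k, while the k-binomial has mean at most (1-2η)k
because 1-r ≥ 2η. This is a large deviation of order k; the other factors are bounded trivially or
by Chebyshev. -/
theorem exists_sums_le_of_far (Ω : ℝ) (h0 : 0 < Ω) (h1 : Ω < 1) :
    ∃ K c : ℝ, 0 < K ∧ 0 < c ∧ ∀ (α : ℝ) (m n k l : ℕ), 0 < α → α < 1 → m + k = n + l → m ≤ n →
      m ≤ l → 1 ≤ α * k → n ≤ 1 / (2 * (1 + C Ω)) * k →
      plainSum Ω α m n k l ≤ K * Real.exp (-(c * k)) ∧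
      upperSum Ω α m n k l ≤ K * Real.exp (-(c * k)) ∧
      lowerSum Ω α m n k l ≤ K * Real.exp (-(c * k)) := by
  have hC := C_pos h0 h1
  set η := 1 / (2 * (1 + C Ω)) with hη
  have hη0 : 0 < η := by positivity
  set c := η ^ 2 / 16 with hc
  have hc0 : 0 < c := by positivity
  refine ⟨1 + 1 / c + √(C Ω), c, by positivity, hc0, ?_⟩
  intro α m n k l ha ha1 h hmn hml hak hn
  set q := qpar Ω α with hq
  set r := rpar Ω α with hr
  have hq0 : 0 < q := qpar_pos h0 h1 ha
  have hq1 : q < 1 := qpar_lt_one h0 h1 ha ha1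
  have hr0 : 0 < r := rpar_pos h0 h1 ha
  have hr1 : r < 1 := rpar_lt_one h0 h1 ha
  have hrη : r ≤ 1 - 2 * η := by
    have := inv_le_one_sub_rpar h0 h1 ha ha1
    have h2 : 2 * η = 1 / (1 + C Ω) := by rw [hη]; field_simp
    linarith
  have hη1 : η ≤ 1 / 2 := by linarith
  have hak0 : 0 < α * k := by linarith
  have hk0 : (0 : ℝ) ≤ k := by positivity
  have hexp0 : ∀ x : ℝ, 0 < Real.exp x := Real.exp_pos
  have hb4 : ∀ u, u ≤ m → bin k r (l - u) ≤ Real.exp (-(2 * c * k)) ^ 2 := by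
    intro u hu
    -- The tilt η/2 produces the exponent -(η²/4)k or better, which is -4ck; the square root in the
    -- weights leaves -2ck, half of which is kept to absorb polynomial factors.
    have ht : |η / 2| ≤ 1 := abs_le.2 ⟨by linarith, by linarith⟩
    refine (bin_le_bin_tilt hr0.le hr1.le ht k (l - u)).trans ?_
    have g1 := bin_le_one (tilt_nonneg hr0.le hr1.le (η / 2)) (tilt_le_one hr0.le hr1.le (η / 2))
      k (l - u)
    rw [← Real.exp_nat_mul]
    refine (mul_le_of_le_one_left (hexp0 _).le g1).trans (Real.exp_le_exp.2 ?_)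
    have hj : (k : ℝ) - n ≤ (l - u : ℕ) := by
      have : k ≤ (l - u) + n := by omega
      have : (k : ℝ) ≤ (l - u : ℕ) + n := by exact_mod_cast this
      linarith
    have e1 : η / 2 * ((1 - η) * k) ≤ η / 2 * (l - u : ℕ) := by gcongr; linarith
    have e2 : k * r * (η / 2 + (η / 2) ^ 2) ≤ k * (1 - 2 * η) * (η / 2 + (η / 2) ^ 2) := by
      gcongr
    have e3 : 0 ≤ k * η ^ 3 := by positivity
    rw [hc]
    push_cast
    nlinarith
  have hbn : ∀ u, 0 ≤ bin n r (m - u) := fun u => bin_nonneg hr0.le hr1.le _ _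
  have hbk : ∀ u, 0 ≤ bin k r (l - u) := fun u => bin_nonneg hr0.le hr1.le _ _
  have hbn1 : ∀ u, bin n r (m - u) ≤ 1 := fun u => bin_le_one hr0.le hr1.le _ _
  have hE : Real.exp (-(2 * c * k)) ≤ Real.exp (-(c * k)) := by
    apply Real.exp_le_exp.2
    have : 0 ≤ c * k := by positivity
    linarith
  have hsC := Real.sqrt_nonneg (C Ω)
  have hc1 : 0 < 1 / c := by positivity
  have hE0 := hexp0 (-(c * k))
  refine ⟨?_, ?_, ?_⟩
  · have := sum_weight_mul_le (q := q) (r := r) (m := m) (n := n) (k := k) (l := l)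
      (f := fun _ => 1) (β := Real.exp (-(2 * c * k))) hq0.le hq1.le hml (hexp0 _).le
      (fun _ _ => zero_le_one) (fun u hu => by
        rw [one_pow, one_mul]
        exact (mul_le_of_le_one_left (hbk u) (hbn1 u)).trans (hb4 u hu))
    simp only [mul_one] at this
    refine this.trans (hE.trans ?_)
    nlinarith
  · have hdev : ∀ u, u ≤ m → |k * r - (l - u : ℕ)| ≤ k := fun u hu => by
      have i1 : ((l - u : ℕ) : ℝ) ≤ k := by
        have : l - u ≤ k := by omega
        exact_mod_cast this
      have i2 : (0 : ℝ) ≤ (l - u : ℕ) := by positivity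
      have i3 : k * r ≤ k := mul_le_of_le_one_right hk0 hr1.le
      have i4 : 0 ≤ k * r := by positivity
      exact abs_le.2 ⟨by linarith, by linarith⟩
    have := sum_weight_mul_le (q := q) (r := r) (m := m) (n := n) (k := k) (l := l)
      (f := fun u => |k * r - (l - u : ℕ)|) (β := k * Real.exp (-(2 * c * k))) hq0.le hq1.le hml
      (by positivity) (fun _ _ => abs_nonneg _) (fun u hu => by
        rw [mul_pow]
        have := hdev u hu
        have := (mul_le_of_le_one_left (hbk u) (hbn1 u)).trans (hb4 u hu)
        have := mul_nonneg (hbn u) (hbk u)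
        gcongr)
    unfold upperSum
    have hs1 : 1 ≤ √(α * k) := Real.one_le_sqrt.2 hak
    refine (div_le_self (Finset.sum_nonneg fun u _ => mul_nonneg (weight_nonneg _ _ _ _ _ _ u)
      (abs_nonneg _)) hs1).trans (this.trans ((mul_exp_neg_le hc0 k).trans ?_))
    gcongr
    linarith
  · have := sum_weight_mul_le (q := q) (r := r) (m := m) (n := n) (k := k) (l := l)
      (f := fun u => |n * r - (m - u : ℕ)|)
      (β := √(C Ω) * √(α * n) * Real.exp (-(2 * c * k))) hq0.le hq1.le hml
      (by positivity) (fun _ _ => abs_nonneg _) (fun u hu => by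
        rw [mul_pow, ← mul_assoc, mul_pow, Real.sq_sqrt hC.le, Real.sq_sqrt (by positivity),
          sq_abs]
        exact mul_le_mul (sq_mul_bin_rpar_le h0 h1 ha n (m - u)) (hb4 u hu) (hbk u)
          (by positivity))
    unfold lowerSum
    refine (div_le_div_of_nonneg_right this (Real.sqrt_nonneg _)).trans ?_
    -- For n = 0 the normalization is zero and the quotient is zero by convention.
    rcases (Real.sqrt_nonneg (α * n)).eq_or_lt with hs | hs
    · rw [← hs]; simp; positivity
    · rw [show √(C Ω) * √(α * n) * Real.exp (-(2 * c * k)) / √(α * n)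
        = √(C Ω) * Real.exp (-(2 * c * k)) by field_simp]
      calc _ ≤ √(C Ω) * Real.exp (-(c * k)) := by gcongr
        _ ≤ _ := by
          gcongr
          linarith [hc1]

/-- With truncated subtraction both j = 0 and j = 1 contribute 1. They can occur together only when
m = l, which accounts for the factor 2. -/
theorem sum_pow_pred_div_factorial_le {a : ℝ} {m l : ℕ} (ha : 0 ≤ a) (h : m ≤ l) :
    ∑ u ∈ Finset.range (m + 1), a ^ (l - u - 1) / (l - u - 1).factorial
      ≤ 2 * (a ^ (l - m - 1) / (l - m - 1).factorial * Real.exp a) := by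
  rcases h.eq_or_lt with rfl | hlt
  · rw [Finset.sum_range_succ]
    have h2 := (Finset.sum_range_reflect (fun i => a ^ i / (i.factorial : ℝ)) m).le.trans
      (Real.sum_le_exp_of_nonneg ha m)
    have h3 := Real.one_le_exp ha
    have h4 : ∀ u, m - u - 1 = m - 1 - u := fun u => by omega
    simp only [h4, Nat.sub_self]
    simp only [Nat.zero_sub, pow_zero, Nat.factorial_zero, Nat.cast_one, div_one, one_mul]
    linarith
  · have := sum_pow_div_factorial_le (m := m) (l := l - 1) ha (by omega)
    have h4 : ∀ u, l - u - 1 = l - 1 - u := fun u => by omega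
    simp only [h4]
    have h5 : 0 ≤ a ^ (l - 1 - m) / (l - 1 - m).factorial * Real.exp a := by positivity
    linarith

-- Poisson bounds on the l- and k-binomials give the weight at most (√a√b)^j/j! with a = kq, b = kr.
-- In the moment over k, the deviation is O(j) for j ≥ 1 and cancels one factor of j!, and one √b
-- pays for the normalization: hence the loss of one power. In the moment over n, Chebyshev on the
-- n-binomial pays for the normalization and no power is lost.
set_option maxHeartbeats 800000 in
theorem exists_sums_le_of_small (Ω : ℝ) (h0 : 0 < Ω) (h1 : Ω < 1) (B : ℝ) (hB : 0 < B) :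
    ∃ K : ℝ, 0 < K ∧ ∀ (α : ℝ) (m n k l : ℕ), 0 < α → α < 1 → m + k = n + l → m ≤ n → m ≤ l →
      α * k ≤ B →
      plainSum Ω α m n k l ≤ K * ((k * qpar Ω α) ^ (l - m) / (l - m).factorial) ∧
      upperSum Ω α m n k l ≤ K * ((k * qpar Ω α) ^ (l - m - 1) / (l - m - 1).factorial) ∧
      lowerSum Ω α m n k l ≤ K * ((k * qpar Ω α) ^ (l - m) / (l - m).factorial) := by
  have hC := C_pos h0 h1
  set c := C Ω with hc
  set E := Real.exp ((1 + c) * B) with hE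
  have hE0 : 0 < E := Real.exp_pos _
  -- The two summands serve j = 0 and j ≥ 1.
  set K₁ := c * √B + (c * B + 1) * (√c * √((1 + c) * B)) with hK₁
  have hK₁0 : 0 < K₁ := by positivity
  refine ⟨E + √c * E + 2 * K₁ * E, by positivity, ?_⟩
  intro α m n k l ha ha1 h hmn hml hak
  have hsq := sq_mul_bin_rpar_le h0 h1 ha n
  unfold plainSum upperSum lowerSum
  have hrC := rpar_le h0 h1 ha
  have hqC := qpar_le h0 h1 ha
  have hq0 := qpar_pos h0 h1 ha
  have hq1 := qpar_lt_one h0 h1 ha ha1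
  have hr0 := rpar_pos h0 h1 ha
  have hr1 := rpar_lt_one h0 h1 ha
  have hrq := rpar_le_qpar h0 h1 ha
  set q := qpar Ω α
  set r := rpar Ω α
  have hlk : (l : ℝ) ≤ k := by
    have : l ≤ k := by omega
    exact_mod_cast this
  have hk0 : (0 : ℝ) ≤ k := by positivity
  set a := k * q with haq
  have ha0 : 0 ≤ a := by positivity
  have haB : a ≤ (1 + c) * B := by
    calc a ≤ k * ((1 + c) * α) := by rw [haq]; gcongr
      _ = (1 + c) * (α * k) := by ring
      _ ≤ (1 + c) * B := by gcongr
  have haE : Real.exp a ≤ E := Real.exp_le_exp.2 haB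
  set b := k * r with hbr
  have hb0 : 0 ≤ b := by positivity
  have hba : b ≤ a := by rw [haq, hbr]; gcongr
  have hbα : b ≤ c * (α * k) := by
    calc b ≤ k * (c * α) := by rw [hbr]; gcongr
      _ = _ := by ring
  have n1 : ∀ u, 0 ≤ bin m q (m - u) := fun u => bin_nonneg hq0.le hq1.le _ _
  have n2 : ∀ u, 0 ≤ bin l q (l - u) := fun u => bin_nonneg hq0.le hq1.le _ _
  have n3 : ∀ u, 0 ≤ bin n r (m - u) := fun u => bin_nonneg hr0.le hr1.le _ _
  have n4 : ∀ u, 0 ≤ bin k r (l - u) := fun u => bin_nonneg hr0.le hr1.le _ _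
  have o1 : ∀ u, bin m q (m - u) ≤ 1 := fun u => bin_le_one hq0.le hq1.le _ _
  have o3 : ∀ u, bin n r (m - u) ≤ 1 := fun u => bin_le_one hr0.le hr1.le _ _
  have s2 : ∀ u, bin l q (l - u) ≤ a ^ (l - u) / (l - u).factorial := fun u => by
    refine (bin_le_pow_div_factorial hq0.le hq1.le l (l - u)).trans ?_
    rw [haq]; gcongr
  have s4 : ∀ u, bin k r (l - u) ≤ b ^ (l - u) / (l - u).factorial := fun u =>
    bin_le_pow_div_factorial hr0.le hr1.le k (l - u)
  have s24 : ∀ u, bin l q (l - u) * bin k r (l - u) ≤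
      ((√a * √b) ^ (l - u) / (l - u).factorial) ^ 2 := fun u => by
    have e : ((√a * √b) ^ (l - u) / ((l - u).factorial : ℝ)) ^ 2
        = a ^ (l - u) / (l - u).factorial * (b ^ (l - u) / (l - u).factorial) := by
      rw [div_pow, ← pow_mul, mul_comm (l - u) 2, pow_mul, mul_pow, Real.sq_sqrt ha0,
        Real.sq_sqrt hb0, mul_pow]
      ring
    rw [e]
    exact mul_le_mul (s2 u) (s4 u) (n4 u) (by positivity)
  have hab : √a * √b ≤ a := by
    rw [← Real.sqrt_mul ha0, Real.sqrt_le_left ha0, sq]; gcongr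
  have hw : ∀ u, weight q r m n k l u ≤ (√a * √b) ^ (l - u) / (l - u).factorial := fun u => by
    unfold weight
    rw [Real.sqrt_le_left (by positivity)]
    refine le_trans ?_ (s24 u)
    calc _ = (bin m q (m - u) * bin n r (m - u)) * (bin l q (l - u) * bin k r (l - u)) := by ring
      _ ≤ 1 * (bin l q (l - u) * bin k r (l - u)) := by
        gcongr
        · exact mul_nonneg (n2 u) (n4 u)
        · exact mul_le_one₀ (o1 u) (n3 u) (o3 u)
      _ = _ := one_mul _
  have hwa : ∀ u, (√a * √b) ^ (l - u) / ((l - u).factorial : ℝ)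
      ≤ a ^ (l - u) / (l - u).factorial := fun u => by gcongr
  have hsum := sum_pow_div_factorial_le ha0 hml
  have hX : 0 ≤ a ^ (l - m) / ((l - m).factorial : ℝ) := by positivity
  have hX' : 0 ≤ a ^ (l - m - 1) / ((l - m - 1).factorial : ℝ) := by positivity
  have hsc := Real.sqrt_nonneg c
  refine ⟨?_, ?_, ?_⟩
  · calc _ ≤ ∑ u ∈ Finset.range (m + 1), a ^ (l - u) / ((l - u).factorial : ℝ) :=
          Finset.sum_le_sum fun u _ => (hw u).trans (hwa u)
      _ ≤ a ^ (l - m) / (l - m).factorial * Real.exp a := hsum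
      _ ≤ a ^ (l - m) / (l - m).factorial * E := by gcongr
      _ ≤ _ := by
        rw [mul_comm]
        gcongr
        have : 0 ≤ √c * E + 2 * K₁ * E := by positivity
        linarith
  · rcases (Real.sqrt_nonneg (α * k)).eq_or_lt with hs | hs
    · rw [← hs, div_zero]; positivity
    rw [div_le_iff₀ hs]
    have hterm : ∀ u ∈ Finset.range (m + 1), weight q r m n k l u * |b - (l - u : ℕ)|
        ≤ K₁ * √(α * k) * (a ^ (l - u - 1) / (l - u - 1).factorial) := by
      intro u _
      have hsb : √b ≤ √c * √(α * k) := by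
        rw [← Real.sqrt_mul hC.le]; exact Real.sqrt_le_sqrt hbα
      rcases Nat.eq_zero_or_pos (l - u) with hj | hj
      · have hw1 := hw u
        rw [hj] at hw1 ⊢
        simp only [pow_zero, Nat.factorial_zero, Nat.cast_one, div_one, Nat.zero_sub,
          Nat.cast_zero, sub_zero, mul_one] at hw1 ⊢
        rw [abs_of_nonneg hb0]
        have : α * k ≤ √B * √(α * k) := by
          calc α * k = √(α * k) * √(α * k) := (Real.mul_self_sqrt (by positivity)).symm
            _ ≤ √B * √(α * k) := by gcongr
        calc weight q r m n k l u * b ≤ 1 * (c * (√B * √(α * k))) := by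
              gcongr
              exact hbα.trans (by gcongr)
          _ = c * √B * √(α * k) := by ring
          _ ≤ K₁ * √(α * k) := by
            gcongr
            rw [hK₁]
            have : 0 ≤ (c * B + 1) * (√c * √((1 + c) * B)) := by positivity
            linarith
      · obtain ⟨j, hj'⟩ : ∃ j, l - u = j + 1 := ⟨l - u - 1, by omega⟩
        have hw1 := hw u
        rw [hj'] at hw1 ⊢
        rw [Nat.add_sub_cancel]
        have hd : |b - (j + 1 : ℕ)| ≤ (c * B + 1) * (j + 1) := by
          have hbB : b ≤ c * B := hbα.trans (by gcongr)
          have hj0 : (0 : ℝ) ≤ j := by positivity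
          have hcB : 0 < c * B := by positivity
          push_cast
          refine abs_le.2 ⟨by nlinarith, by nlinarith⟩
        have hfact : (((j + 1).factorial : ℕ) : ℝ) = (j + 1) * j.factorial := by
          rw [Nat.factorial_succ]; push_cast; ring
        calc weight q r m n k l u * |b - (j + 1 : ℕ)|
            ≤ (√a * √b) ^ (j + 1) / (j + 1).factorial * ((c * B + 1) * (j + 1)) := by gcongr
          _ = (c * B + 1) * (√a * √b) * ((√a * √b) ^ j / j.factorial) := by
              rw [hfact, pow_succ]; field_simp
          _ ≤ (c * B + 1) * (√((1 + c) * B) * (√c * √(α * k))) * (a ^ j / j.factorial) := by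
              gcongr
          _ = (c * B + 1) * (√c * √((1 + c) * B)) * √(α * k) * (a ^ j / j.factorial) := by ring
          _ ≤ K₁ * √(α * k) * (a ^ j / j.factorial) := by
              gcongr
              rw [hK₁]
              have : 0 ≤ c * √B := by positivity
              linarith
    refine (Finset.sum_le_sum hterm).trans ?_
    rw [← Finset.mul_sum]
    calc _ ≤ K₁ * √(α * k) * (2 * (a ^ (l - m - 1) / (l - m - 1).factorial * Real.exp a)) := by
          gcongr
          exact sum_pow_pred_div_factorial_le ha0 hml
      _ ≤ K₁ * √(α * k) * (2 * (a ^ (l - m - 1) / (l - m - 1).factorial * E)) := by gcongr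
      _ = 2 * K₁ * E * (a ^ (l - m - 1) / (l - m - 1).factorial) * √(α * k) := by ring
      _ ≤ _ := by
        gcongr
        have : 0 ≤ E + √c * E := by positivity
        linarith
  · have hterm : ∀ u ∈ Finset.range (m + 1), weight q r m n k l u * |n * r - (m - u : ℕ)|
        ≤ √c * √(α * n) * (a ^ (l - u) / (l - u).factorial) := by
      intro u _
      have hY : 0 ≤ √c * √(α * n) * ((√a * √b) ^ (l - u) / ((l - u).factorial : ℝ)) := by
        positivity
      have : weight q r m n k l u * |n * r - (m - u : ℕ)|
          ≤ √c * √(α * n) * ((√a * √b) ^ (l - u) / (l - u).factorial) := by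
        unfold weight
        rw [← Real.sqrt_sq_eq_abs, ← Real.sqrt_mul' _ (sq_nonneg _), Real.sqrt_le_left hY,
          mul_pow, mul_pow, Real.sq_sqrt hC.le, Real.sq_sqrt (by positivity)]
        calc _ = bin m q (m - u) * ((n * r - (m - u : ℕ)) ^ 2 * bin n r (m - u)) *
              (bin l q (l - u) * bin k r (l - u)) := by ring
          _ ≤ 1 * (c * (α * n)) * ((√a * √b) ^ (l - u) / (l - u).factorial) ^ 2 := by
            have g1 := mul_nonneg (n2 u) (n4 u)
            have g2 := mul_nonneg (sq_nonneg (n * r - (m - u : ℕ))) (n3 u)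
            exact mul_le_mul (mul_le_mul (o1 u) (hsq (m - u)) g2 zero_le_one) (s24 u) g1
              (by positivity)
          _ = _ := by ring
      refine this.trans ?_
      gcongr
    rcases (Real.sqrt_nonneg (α * n)).eq_or_lt with hs | hs
    · rw [← hs, div_zero]; positivity
    rw [div_le_iff₀ hs]
    refine (Finset.sum_le_sum hterm).trans ?_
    rw [← Finset.mul_sum]
    calc _ ≤ √c * √(α * n) * (a ^ (l - m) / (l - m).factorial * E) := by
          gcongr
          exact hsum.trans (by gcongr)
      _ = √c * E * (a ^ (l - m) / (l - m).factorial) * √(α * n) := by ring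
      _ ≤ _ := by
        gcongr
        have : 0 ≤ E + 2 * K₁ * E := by positivity
        linarith

/-! ### From the three regimes to the bracket -/

section bracket

variable {Ω : ℝ}

theorem bracket_anti {c c' s α : ℝ} {h p k q : ℕ} (hc : c ≤ c') (hs : 0 ≤ s) (hα : 0 ≤ α) :
    bracket Ω c' s α h p k q ≤ bracket Ω c s α h p k q := by
  unfold bracket
  have e1 : Real.exp (-(c' * p ^ 2 / (1 + k * s)) - c' * s / (1 + k) * (h - k / (1 + C Ω)) ^ 2)
      ≤ Real.exp (-(c * p ^ 2 / (1 + k * s)) - c * s / (1 + k) * (h - k / (1 + C Ω)) ^ 2) := by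
    apply Real.exp_le_exp.2
    have i1 : c * p ^ 2 / (1 + k * s) ≤ c' * p ^ 2 / (1 + k * s) := by gcongr
    have i2 : c * s / (1 + k) * (h - k / (1 + C Ω)) ^ 2
      ≤ c' * s / (1 + k) * (h - k / (1 + C Ω)) ^ 2 := by gcongr
    linarith
  have e2 : Real.exp (-(c' * k * s) - c' * p) ≤ Real.exp (-(c * k * s) - c * p) := by
    apply Real.exp_le_exp.2
    have i1 : c * k * s ≤ c' * k * s := by gcongr
    have i2 : c * p ≤ c' * p := by gcongr
    linarith
  have e3 : 0 ≤ min 1 ((α * k) ^ q) := le_min zero_le_one (by positivity)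
  split_ifs <;> gcongr

theorem bracket_ge_first {c s α : ℝ} {h p k q : ℕ} (hα : 0 ≤ α) (hk : 1 < α * k) :
    Real.exp (-(c * p ^ 2 / (1 + k * s)) - c * s / (1 + k) * (h - k / (1 + C Ω)) ^ 2)
        / (1 + √(k * s)) ≤ bracket Ω c s α h p k q := by
  unfold bracket
  rw [if_pos hk]
  have e3 : 0 ≤ min 1 ((α * k) ^ q) := le_min zero_le_one (by positivity)
  exact le_add_of_nonneg_right (mul_nonneg e3 (Real.exp_pos _).le)

theorem bracket_ge_second (c s α : ℝ) (h p k q : ℕ) :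
    min 1 ((α * k) ^ q) * Real.exp (-(c * k * s) - c * p) ≤ bracket Ω c s α h p k q := by
  unfold bracket
  refine le_add_of_nonneg_left ?_
  split_ifs <;> positivity

theorem bracket_nonneg (c s : ℝ) {α : ℝ} (hα : 0 ≤ α) (h p k q : ℕ) :
    0 ≤ bracket Ω c s α h p k q := by
  refine le_trans ?_ (bracket_ge_second c s α h p k q)
  exact mul_nonneg (le_min zero_le_one (by positivity)) (Real.exp_pos _).le

theorem exp_le_bracket {c s α : ℝ} {h p k q : ℕ} (hk : 1 < α * k) :
    Real.exp (-(c * k * s) - c * p) ≤ bracket Ω c s α h p k q := by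
  refine le_trans ?_ (bracket_ge_second c s α h p k q)
  rw [min_eq_left (one_le_pow₀ hk.le), one_mul]

/-- The difference mq - nr is a multiple of (n-m) - n/(1+C). The Gaussian is therefore centered
where the m- and n-binomials have equal means. -/
theorem sq_div_le_rate {s β : ℝ} {m n k : ℕ} (h0 : 0 < Ω) (h1 : Ω < 1) (hβ : 0 < β) (hβ1 : β < 1)
    (hsβ : s ≤ β) (hk : 0 < k) (hmn : m ≤ n) :
    s / k * (((n - m : ℕ) : ℝ) - n / (1 + C Ω)) ^ 2 / 32 ≤
      (m * qpar Ω β - n * rpar Ω β) ^ 2 / (32 * (k * qpar Ω β)) := by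
  have hC := C_pos h0 h1
  have hX := denom_pos h0 h1 hβ.le
  have hk' : (0 : ℝ) < k := by exact_mod_cast hk
  have e : (m * qpar Ω β - n * rpar Ω β) ^ 2 / (32 * (k * qpar Ω β))
      = β / k * (((n - m : ℕ) : ℝ) - n / (1 + C Ω)) ^ 2 / 32
        * ((1 + C Ω) / (1 + C Ω * β)) := by
    rw [Nat.cast_sub hmn]
    unfold qpar rpar
    field_simp
    ring
  rw [e]
  have h2 : 1 ≤ (1 + C Ω) / (1 + C Ω * β) := by
    rw [one_le_div hX]; nlinarith
  calc _ ≤ β / k * (((n - m : ℕ) : ℝ) - n / (1 + C Ω)) ^ 2 / 32 := by gcongr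
    _ ≤ _ := le_mul_of_one_le_right (by positivity) h2

/-- Passing from the center nλ to k'λ, with h and k shifted by at most one, costs 1 + p² up to a
constant; the p² is later paid by the decay in p. -/
theorem gap_sq_le {lam h h' k k' n p : ℝ} (hl0 : 0 ≤ lam) (hl1 : lam ≤ 1) (hn : n = k - p)
    (hh' : h' ≤ h) (hh : h ≤ h' + 1) (hk' : k' ≤ k) (hk : k ≤ k' + 1) (hp : 0 ≤ p) :
    (h' - k' * lam) ^ 2 ≤ 3 * ((h - n * lam) ^ 2 + 1 + p ^ 2) := by
  set x := h - n * lam with hx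
  set e := h' - h + (k - k') * lam with he
  have hxe : h' - k' * lam = x + e - p * lam := by rw [hx, he, hn]; ring
  have hkl : 0 ≤ (k - k') * lam := mul_nonneg (by linarith) hl0
  have hkl' : (k - k') * lam ≤ 1 := by
    calc (k - k') * lam ≤ 1 * 1 := by gcongr; linarith
      _ = 1 := one_mul _
  have he1 : e ^ 2 ≤ 1 := by
    rw [sq_le_one_iff_abs_le_one]
    exact abs_le.2 ⟨by linarith, by linarith⟩
  have hpl : (p * lam) ^ 2 ≤ p ^ 2 := by
    gcongr; exact mul_le_of_le_one_right hp hl1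
  rw [hxe]
  nlinarith [sq_nonneg (x - e), sq_nonneg (x + p * lam), sq_nonneg (e + p * lam)]

/-- For p ≤ ks the optimal tilt is of order p/(ks) and gives the Gaussian term. For p > ks the tilt
is bounded below, so the decay is linear in p; it then dominates ks as well and falls under the
second term. -/
theorem exists_large_le_bracket (h0 : 0 < Ω) (h1 : Ω < 1) {L : ℝ} (hL : 1 ≤ L) :
    ∃ c K : ℝ, 0 < c ∧ 0 < K ∧ ∀ (s α β : ℝ) (m n k l k' h' q : ℕ), 0 < s → s ≤ α → s ≤ β →
      β ≤ L * s → β < 1 → m + k = n + l → m ≤ n → m ≤ l → k' ≤ k → k ≤ k' + 1 → h' ≤ n - m →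
      n - m ≤ h' + 1 → 1 < s * k' →
      1 / √(β * k) * Real.exp (-rate Ω β m n k (l - m)) ≤
        K * bracket Ω c s α h' (l - m) k' q := by
  have hC := C_pos h0 h1
  set lam := 1 / (1 + C Ω) with hlam
  have hlam0 : 0 < lam := by positivity
  have hlam1 : lam ≤ 1 := by rw [hlam, div_le_one (by positivity)]; linarith
  set L' := (1 + C Ω) * L with hL'
  have hL'0 : 0 < L' := by positivity
  set c₁ := min (1 / 4) (lam / (10 * L')) with hc₁
  have hc₁0 : 0 < c₁ := lt_min (by norm_num) (by positivity)
  -- The target exponent without c is at most 96 Dl + 5P + 3, with P = p²/(ks), while the available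
  -- rate is at least c₁λP/4 + Dl.
  set c := min (1 / 96) (c₁ * lam / 20) with hc
  have hc0 : 0 < c := lt_min (by norm_num) (by positivity)
  have hc96 : c ≤ 1 / 96 := min_le_left _ _
  have hc20 : c ≤ c₁ * lam / 20 := min_le_right _ _
  refine ⟨c, 2 * Real.exp (3 * c), hc0, by positivity, ?_⟩
  intro s α β m n k l k' h' q hs hsα hsβ hβL hβ1 h hmn hml hk'k hkk' hh' hh hsk
  have hβ := hs.trans_le hsβ
  have hs1 : s < 1 := hsβ.trans_lt hβ1
  have hα := hs.trans_le hsα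
  have hk'0 : 0 < k' := by
    rcases Nat.eq_zero_or_pos k' with h | h
    · subst h; norm_num at hsk
    · exact h
  have ck'k : (k' : ℝ) ≤ k := by exact_mod_cast hk'k
  have ckk' : (k : ℝ) ≤ k' + 1 := by exact_mod_cast hkk'
  have hk1 : (1 : ℝ) ≤ k := by exact_mod_cast (by omega : 1 ≤ k)
  have hk0 : (0 : ℝ) < k := by linarith
  have hskk : s * k' ≤ s * k := by gcongr
  have hks : 1 < k * s := by linarith
  have hαk' : 1 < α * k' := hsk.trans_le (by gcongr)
  set p := l - m with hp
  have hq0 := qpar_pos h0 h1 hβ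
  have hkq : k * qpar Ω β ≤ L' * (k * s) := by
    calc k * qpar Ω β ≤ k * ((1 + C Ω) * β) := by gcongr; exact qpar_le h0 h1 hβ
      _ ≤ k * ((1 + C Ω) * (L * s)) := by gcongr
      _ = _ := by rw [hL']; ring
  have htilt : min (1 / 4) (p / (k * s) * (lam / (10 * L'))) ≤ tiltP Ω β p k := by
    unfold tiltP
    apply min_le_min le_rfl
    calc p / (k * s) * (lam / (10 * L')) = p * lam / (10 * (L' * (k * s))) := by
          field_simp
      _ ≤ p * lam / (10 * (k * qpar Ω β)) := by gcongr
      _ = _ := by rw [hlam]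
  have hD0 : 0 ≤ (m * qpar Ω β - n * rpar Ω β) ^ 2 / (32 * (k * qpar Ω β)) := by positivity
  have hDl := sq_div_le_rate h0 h1 hβ hβ1 hsβ (by omega : 0 < k) hmn
  have hrate : rate Ω β m n k p = tiltP Ω β p k * p * lam / 4
    + (m * qpar Ω β - n * rpar Ω β) ^ 2 / (32 * (k * qpar Ω β)) := rfl
  set Dl := (m * qpar Ω β - n * rpar Ω β) ^ 2 / (32 * (k * qpar Ω β))
  have hsq1 : 1 ≤ √(k' * s) := Real.one_le_sqrt.2 (by linarith)
  have hsq2 : √(k' * s) ≤ √(β * k) := Real.sqrt_le_sqrt (by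
    calc (k' : ℝ) * s ≤ k * β := by gcongr
      _ = β * k := mul_comm _ _)
  have hp0 : (0 : ℝ) ≤ p := by positivity
  rcases le_or_gt (p : ℝ) (k * s) with hpk | hpk
  · have hP1 : p / (k * s) ≤ 1 := (div_le_one (by linarith)).2 hpk
    have hP0 : 0 ≤ p / (k * s) := by positivity
    set P := (p : ℝ) ^ 2 / (k * s) with hP
    have ht : c₁ * (p / (k * s)) ≤ tiltP Ω β p k := by
      refine le_trans (le_min ?_ ?_) htilt
      · calc c₁ * (p / (k * s)) ≤ 1 / 4 * 1 := by gcongr; exact min_le_left _ _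
          _ = 1 / 4 := mul_one _
      · rw [mul_comm]; gcongr; exact min_le_right _ _
    have hr1 : c₁ * lam / 4 * P ≤ tiltP Ω β p k * p * lam / 4 := by
      calc c₁ * lam / 4 * P = c₁ * (p / (k * s)) * p * lam / 4 := by rw [hP]; ring
        _ ≤ _ := by gcongr
    have hP0' : 0 ≤ P := by positivity
    have hb1 : p ^ 2 / (1 + k' * s) ≤ 2 * P := by
      rw [hP, ← mul_div_assoc, div_le_div_iff₀ (by positivity) (by positivity)]
      have hsc : k * s ≤ (k' + 1) * s := by gcongr
      have hks2 : k * s ≤ 2 * (1 + k' * s) := by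
        have : (0 : ℝ) ≤ k' * s := by positivity
        linarith
      calc (p : ℝ) ^ 2 * (k * s) ≤ (p : ℝ) ^ 2 * (2 * (1 + k' * s)) := by gcongr
        _ = _ := by ring
    have hb2 : s / (1 + k') * (h' - k' / (1 + C Ω)) ^ 2 ≤ 96 * Dl + 3 * P + 3 := by
      have cn : (n : ℝ) = k - p := by
        have : n + p = k := by omega
        have : (n : ℝ) + p = k := by exact_mod_cast this
        linarith
      set x : ℝ := ((n - m : ℕ) : ℝ) - n / (1 + C Ω) with hx
      have hsqr : (h' - k' / (1 + C Ω) : ℝ) ^ 2 ≤ 3 * (x ^ 2 + 1 + p ^ 2) := by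
        have := gap_sq_le hlam0.le hlam1 cn (by exact_mod_cast hh' : (h' : ℝ) ≤ (n - m : ℕ))
          (by exact_mod_cast hh) ck'k ckk' hp0
        rw [hlam, mul_one_div, mul_one_div] at this
        exact this
      have hsk1 : s / (1 + k') ≤ s / k := by gcongr; linarith
      have hsk2 : s / k ≤ 1 := (div_le_one hk0).2 (by linarith)
      have hsk3 : s / k * p ^ 2 ≤ P := by
        rw [hP, div_mul_eq_mul_div, div_le_div_iff₀ hk0 (by positivity)]
        have hss : s * s ≤ 1 := mul_le_one₀ hs1.le hs.le hs1.le
        calc s * (p : ℝ) ^ 2 * (k * s) = (p : ℝ) ^ 2 * k * (s * s) := by ring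
          _ ≤ (p : ℝ) ^ 2 * k * 1 := by gcongr
          _ = _ := mul_one _
      calc s / (1 + k') * (h' - k' / (1 + C Ω)) ^ 2
          ≤ s / k * (3 * (x ^ 2 + 1 + p ^ 2)) := by gcongr
        _ = 96 * (s / k * x ^ 2 / 32) + 3 * (s / k) + 3 * (s / k * p ^ 2) := by ring
        _ ≤ 96 * Dl + 3 * 1 + 3 * P := by gcongr
        _ = _ := by ring
    have hexp : Real.exp (-rate Ω β m n k p) ≤ Real.exp (3 * c) *
        Real.exp (-(c * p ^ 2 / (1 + k' * s))
          - c * s / (1 + k') * (h' - k' / (1 + C Ω)) ^ 2) := by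
      rw [← Real.exp_add]
      apply Real.exp_le_exp.2
      have j1 : c * p ^ 2 / (1 + k' * s) ≤ c * (2 * P) := by
        rw [mul_div_assoc]; gcongr
      have j2 : c * s / (1 + k') * (h' - k' / (1 + C Ω)) ^ 2 ≤ c * (96 * Dl + 3 * P + 3) := by
        rw [mul_div_assoc, mul_assoc]; gcongr
      have j3 : c * (5 * P) ≤ c₁ * lam / 20 * (5 * P) := by gcongr
      have j4 : c * (96 * Dl) ≤ 1 / 96 * (96 * Dl) := by gcongr
      rw [hrate]
      linarith
    have hpre : 1 / √(β * k) ≤ 2 / (1 + √(k' * s)) := by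
      rw [div_le_div_iff₀ (by linarith) (by linarith)]; linarith
    calc _ ≤ 2 / (1 + √(k' * s)) * (Real.exp (3 * c) *
          Real.exp (-(c * p ^ 2 / (1 + k' * s))
            - c * s / (1 + k') * (h' - k' / (1 + C Ω)) ^ 2)) := by gcongr
      _ = 2 * Real.exp (3 * c) * (Real.exp (-(c * p ^ 2 / (1 + k' * s))
            - c * s / (1 + k') * (h' - k' / (1 + C Ω)) ^ 2) / (1 + √(k' * s))) := by ring
      _ ≤ _ := by gcongr; exact bracket_ge_first hα.le hαk'
  · have ht : c₁ ≤ tiltP Ω β p k := by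
      refine le_trans (min_le_min le_rfl ?_) htilt
      have : 1 ≤ p / (k * s) := (one_le_div (by linarith)).2 hpk.le
      exact le_mul_of_one_le_left (by positivity) this
    have hr1 : c₁ * p * lam / 4 ≤ tiltP Ω β p k * p * lam / 4 := by gcongr
    have hexp : Real.exp (-rate Ω β m n k p) ≤ Real.exp (-(c * k' * s) - c * p) := by
      apply Real.exp_le_exp.2
      have j1 : c * k' * s ≤ c * p := by
        rw [mul_assoc]; gcongr; linarith
      have j2 : c * p ≤ c₁ * lam / 20 * p := by gcongr
      have j3 : 0 ≤ c₁ * lam * p := by positivity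
      rw [hrate]
      linarith
    have hpre : 1 / √(β * k) ≤ 1 := by
      rw [div_le_one (by linarith)]; linarith
    have hge : (1 : ℝ) ≤ 2 * Real.exp (3 * c) := by
      have := Real.one_le_exp (by positivity : 0 ≤ 3 * c); linarith
    calc _ ≤ 1 * Real.exp (-(c * k' * s) - c * p) := by gcongr
      _ ≤ 2 * Real.exp (3 * c) * bracket Ω c s α h' p k' q := by
        have := exp_le_bracket (Ω := Ω) (c := c) (s := s) (h := h') (p := p) (q := q) hαk'
        gcongr

/-- The factorial beats any geometric constant, so (const·sk')^q/q! is at most a constant times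
(sk')^q e^(-q). As sk' ≤ 1 and p ≤ q+1, replacing e^(-q) by the required exponential costs e². -/
theorem small_le_bracket (h0 : 0 < Ω) (h1 : Ω < 1) {L s α β : ℝ} {k k' h' p q : ℕ}
    (hL : 1 ≤ L) (hs : 0 < s) (hsα : s ≤ α) (hsβ : s ≤ β) (hβL : β ≤ L * s)
    (hk : q = 0 ∨ k ≤ 2 * k') (hpq : p ≤ q + 1) (hsk : s * k' ≤ 1) :
    (k * qpar Ω β) ^ q / q.factorial ≤
      Real.exp (2 * ((1 + C Ω) * L) * Real.exp 1 + 2) * bracket Ω 1 s α h' p k' q := by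
  have hC := C_pos h0 h1
  have hβ := hs.trans_le hsβ
  have hq0 := qpar_pos h0 h1 hβ
  set L' := (1 + C Ω) * L with hL'
  have hL'0 : 0 < L' := by positivity
  have hsk0 : 0 ≤ s * k' := by positivity
  have e1 : (k * qpar Ω β) ^ q ≤ (2 * L' * (s * k')) ^ q := by
    rcases hk with hk | hk
    · simp [hk]
    · have hk2 : (k : ℝ) ≤ 2 * k' := by exact_mod_cast hk
      refine pow_le_pow_left₀ (by positivity) ?_ q
      calc k * qpar Ω β ≤ 2 * k' * ((1 + C Ω) * β) := by gcongr; exact qpar_le h0 h1 hβ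
        _ ≤ 2 * k' * ((1 + C Ω) * (L * s)) := by gcongr
        _ = _ := by rw [hL']; ring
  have e2 : (2 * L' * Real.exp 1) ^ q / (q.factorial : ℝ) ≤ Real.exp (2 * L' * Real.exp 1) :=
    Real.pow_div_factorial_le_exp _ (by positivity) q
  have e3 : (1 : ℝ) = Real.exp 1 ^ q * Real.exp (-q) := by
    rw [← Real.exp_nat_mul, ← Real.exp_add]; simp
  have e4 : Real.exp (-q) ≤ Real.exp (2 + (-(1 * k' * s) - 1 * p)) := by
    apply Real.exp_le_exp.2
    have : (p : ℝ) ≤ q + 1 := by exact_mod_cast hpq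
    linarith
  have hα := hs.trans_le hsα
  have e6 : 0 ≤ min 1 ((α * k') ^ q) := le_min zero_le_one (by positivity)
  have e5 : (s * k') ^ q ≤ min 1 ((α * k') ^ q) :=
    le_min (pow_le_one₀ hsk0 hsk) (by gcongr)
  calc (k * qpar Ω β) ^ q / q.factorial ≤ (2 * L' * (s * k')) ^ q / q.factorial := by gcongr
    _ = (2 * L' * (s * k')) ^ q / q.factorial * 1 := (mul_one _).symm
    _ = (2 * L' * Real.exp 1) ^ q / q.factorial * ((s * k') ^ q * Real.exp (-q)) := by
        conv_lhs => rw [e3]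
        rw [mul_pow (2 * L'), mul_pow (2 * L')]; ring
    _ ≤ Real.exp (2 * L' * Real.exp 1) * (min 1 ((α * k') ^ q) *
          Real.exp (2 + (-(1 * k' * s) - 1 * p))) := by gcongr
    _ = Real.exp (2 * L' * Real.exp 1 + 2) *
          (min 1 ((α * k') ^ q) * Real.exp (-(1 * k' * s) - 1 * p)) := by
        rw [Real.exp_add 2, Real.exp_add _ 2]; ring
    _ ≤ _ := by gcongr; exact bracket_ge_second 1 s α h' p k' q

/-- The three regimes of the estimates combine to the bracket. -/
theorem exists_le_bracket (h0 : 0 < Ω) (h1 : Ω < 1) {L : ℝ} (hL : 1 ≤ L) {K₁ K₂ K₃ c₂ : ℝ}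
    (hK₁ : 0 < K₁) (hK₂ : 0 < K₂) (hK₃ : 0 < K₃) (hc₂ : 0 < c₂) :
    ∃ c K : ℝ, 0 < c ∧ 0 < K ∧ ∀ (s α β V : ℝ) (m n k l k' h' q : ℕ), 0 < s → s ≤ α → s ≤ β →
      β ≤ L * s → β < 1 → m + k = n + l → m ≤ n → m ≤ l → k' ≤ k → k ≤ k' + 1 → h' ≤ n - m →
      n - m ≤ h' + 1 → (q = 0 ∨ k ≤ 2 * k') → l - m ≤ q + 1 →
      (1 ≤ β * k → 1 / (2 * (1 + C Ω)) * k ≤ n →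
        V ≤ K₁ / √(β * k) * Real.exp (-rate Ω β m n k (l - m))) →
      (1 ≤ β * k → n ≤ 1 / (2 * (1 + C Ω)) * k → V ≤ K₂ * Real.exp (-(c₂ * k))) →
      (β * k ≤ 2 * L → V ≤ K₃ * ((k * qpar Ω β) ^ q / q.factorial)) →
      V ≤ K * bracket Ω c s α h' (l - m) k' q := by
  obtain ⟨c₁, K, hc₁, hK, H⟩ := exists_large_le_bracket h0 h1 hL
  set E := Real.exp (2 * ((1 + C Ω) * L) * Real.exp 1 + 2) with hE
  have hE0 : 0 < E := Real.exp_pos _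
  set c := min c₁ (min (c₂ / 2) 1) with hc
  have hc0 : 0 < c := by positivity
  refine ⟨c, K₁ * K + K₂ + K₃ * E, hc0, by positivity, ?_⟩
  intro s α β V m n k l k' h' q hs hsα hsβ hβL hβ1 h hmn hml hk'k hkk' hh' hh hq hpq R1 R2 R3
  have hα := hs.trans_le hsα
  have hβ := hs.trans_le hsβ
  have hbr := bracket_nonneg (Ω := Ω) c s hα.le h' (l - m) k' q
  set b := bracket Ω c s α h' (l - m) k' q with hb
  have ck'k : (k' : ℝ) ≤ k := by exact_mod_cast hk'k
  have ckk' : (k : ℝ) ≤ k' + 1 := by exact_mod_cast hkk'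
  -- Splitting at the lower end s of the slice makes the bound valid for every α in it: sk' > 1
  -- forces αk' > 1 and switches the indicator on, while for sk' ≤ 1 the second term suffices.
  rcases le_or_gt (s * k') 1 with hsk | hsk
  · have hβk : β * k ≤ 2 * L := by
      have : s * k ≤ 2 := by nlinarith
      calc β * k ≤ L * s * k := by gcongr
        _ = L * (s * k) := by ring
        _ ≤ L * 2 := by gcongr
        _ = _ := by ring
    have := small_le_bracket (h' := h') (α := α) h0 h1 hL hs hsα hsβ hβL hq hpq hsk
    have h2 := bracket_anti (Ω := Ω) (h := h') (p := l - m) (k := k') (q := q)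
      ((min_le_right _ _).trans (min_le_right _ _) : c ≤ 1) hs.le hα.le
    calc V ≤ K₃ * ((k * qpar Ω β) ^ q / q.factorial) := R3 hβk
      _ ≤ K₃ * (E * bracket Ω 1 s α h' (l - m) k' q) := by gcongr
      _ ≤ K₃ * (E * b) := by gcongr
      _ = K₃ * E * b := by ring
      _ ≤ _ := by
        gcongr
        have : 0 ≤ K₁ * K + K₂ := by positivity
        linarith
  · have hβk : 1 ≤ β * k := hsk.le.trans (by gcongr)
    rcases le_total (1 / (2 * (1 + C Ω)) * k) (n : ℝ) with hn | hn
    · have h1' := H s α β m n k l k' h' q hs hsα hsβ hβL hβ1 h hmn hml hk'k hkk' hh' hh hsk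
      have h2 := bracket_anti (Ω := Ω) (h := h') (p := l - m) (k := k') (q := q)
        (min_le_left _ _ : c ≤ c₁) hs.le hα.le
      calc V ≤ K₁ / √(β * k) * Real.exp (-rate Ω β m n k (l - m)) := R1 hβk hn
        _ = K₁ * (1 / √(β * k) * Real.exp (-rate Ω β m n k (l - m))) := by ring
        _ ≤ K₁ * (K * bracket Ω c₁ s α h' (l - m) k' q) := by gcongr
        _ ≤ K₁ * (K * b) := by gcongr
        _ = K₁ * K * b := by ring
        _ ≤ _ := by
          gcongr
          have : 0 ≤ K₂ + K₃ * E := by positivity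
          linarith
    · have hαk' : 1 < α * k' := hsk.trans_le (by gcongr)
      have h2 : Real.exp (-(c₂ * k)) ≤ b := by
        refine le_trans (Real.exp_le_exp.2 ?_) (exp_le_bracket hαk')
        have hcc : c ≤ c₂ / 2 := (min_le_right _ _).trans (min_le_left _ _)
        have hpk : ((l - m : ℕ) : ℝ) ≤ k := by
          have : l - m ≤ k := by omega
          exact_mod_cast this
        have i1 : c * k' * s ≤ c₂ / 2 * k := by
          calc c * k' * s ≤ c₂ / 2 * k * 1 := by gcongr; linarith
            _ = _ := mul_one _
        have i2 : c * (l - m : ℕ) ≤ c₂ / 2 * k := by gcongr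
        linarith
      calc V ≤ K₂ * Real.exp (-(c₂ * k)) := R2 hβk hn
        _ ≤ K₂ * b := by gcongr
        _ ≤ _ := by
          gcongr
          have : 0 ≤ K₁ * K + K₃ * E := by positivity
          linarith

end bracket

/-- All three sums are controlled by the bracket, uniformly over a slice. -/
theorem exists_sums_le_bracket {Ω L : ℝ} (h0 : 0 < Ω) (h1 : Ω < 1) (hL : 1 ≤ L) :
    ∃ c K : ℝ, 0 < c ∧ 0 < K ∧ ∀ (s α β : ℝ) (m n k l : ℕ), 0 < s → s ≤ α → s ≤ β →
      β ≤ L * s → β < 1 → m ≤ n → m ≤ l →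
      (m + k = n + l → plainSum Ω β m n k l ≤
        K * bracket Ω c s α (n - m) (l - m) k (l - m)) ∧
      (m + 1 + k = n + l → upperSum Ω β m n (k + 1) l ≤
        K * bracket Ω c s α (n - m) (l - m) k (l - m - 1)) ∧
      (m + k = n + 1 + l → lowerSum Ω β m (n + 1) k l ≤
        K * bracket Ω c s α (n - m) (l - m) k (l - m)) := by
  obtain ⟨K₁, hK₁, H1⟩ := exists_sums_le_of_large Ω h0 h1
  obtain ⟨K₂, c₂, hK₂, hc₂, H2⟩ := exists_sums_le_of_far Ω h0 h1
  obtain ⟨K₃, hK₃, H3⟩ := exists_sums_le_of_small Ω h0 h1 (2 * L) (by positivity)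
  obtain ⟨c, K, hc, hK, H⟩ := exists_le_bracket h0 h1 hL hK₁ hK₂ hK₃ hc₂
  refine ⟨c, K, hc, hK, ?_⟩
  intro s α β m n k l hs hsα hsβ hβL hβ1 hmn hml
  have hβ := hs.trans_le hsβ
  refine ⟨fun h => ?_, fun h => ?_, fun h => ?_⟩
  · exact H s α β _ m n k l k (n - m) (l - m) hs hsα hsβ hβL hβ1 h hmn hml le_rfl (by omega)
      le_rfl (by omega) (Or.inr (by omega)) (by omega)
      (fun a b => (H1 β m n k l hβ hβ1 h hmn hml a b).1)
      (fun a b => (H2 β m n k l hβ hβ1 h hmn hml a b).1)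
      (fun a => (H3 β m n k l hβ hβ1 h hmn hml a).1)
  · have h' : m + (k + 1) = n + l := by omega
    -- The bracket has k where the sum has k+1. If k = 0, the conservation law forces l-m ≤ 1, so
    -- the exponent l-m-1 is zero and the comparison of k+1 with 2k is not needed.
    exact H s α β _ m n (k + 1) l k (n - m) (l - m - 1) hs hsα hsβ hβL hβ1 h' hmn hml
      (by omega) le_rfl le_rfl (by omega) (by omega) (by omega)
      (fun a b => (H1 β m n (k + 1) l hβ hβ1 h' hmn hml a b).2.1)
      (fun a b => (H2 β m n (k + 1) l hβ hβ1 h' hmn hml a b).2.1)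
      (fun a => (H3 β m n (k + 1) l hβ hβ1 h' hmn hml a).2.1)
  · have hmn' : m ≤ n + 1 := by omega
    exact H s α β _ m (n + 1) k l k (n - m) (l - m) hs hsα hsβ hβL hβ1 h hmn' hml
      le_rfl (by omega) (by omega) (by omega) (Or.inr (by omega)) (by omega)
      (fun a b => (H1 β m (n + 1) k l hβ hβ1 h hmn' hml a b).2.2)
      (fun a b => (H2 β m (n + 1) k l hβ hβ1 h hmn' hml a b).2.2)
      (fun a => (H3 β m (n + 1) k l hβ hβ1 h hmn' hml a).2.2)

/-! ### Clifford algebra: diagonalizing the spin factor -/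

section clifford

variable {γ : Fin 2 → Matrix (Fin 2) (Fin 2) ℂ}

theorem IsCliffordRep.mul_self (h : IsCliffordRep γ) (μ : Fin 2) : γ μ * γ μ = -1 := by
  have := h μ μ
  rw [if_pos rfl, ← two_smul ℂ] at this
  have h2 : (2 : ℂ) • (γ μ * γ μ) = (2 : ℂ) • (-1 : Matrix (Fin 2) (Fin 2) ℂ) := by
    rw [this]; simp
  exact smul_right_injective _ (two_ne_zero (α := ℂ)) h2

theorem IsCliffordRep.one_mul_zero (h : IsCliffordRep γ) : γ 1 * γ 0 = -(γ 0 * γ 1) := by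
  have := h 1 0
  rw [if_neg (by decide)] at this
  exact eq_neg_of_add_eq_zero_left this

theorem IsCliffordRep.zero_mul_mul (h : IsCliffordRep γ) : γ 0 * (γ 0 * γ 1) = -γ 1 := by
  rw [← mul_assoc, h.mul_self]; simp

theorem IsCliffordRep.one_mul_mul (h : IsCliffordRep γ) : γ 1 * (γ 0 * γ 1) = γ 0 := by
  rw [← mul_assoc, h.one_mul_zero, neg_mul, mul_assoc, h.mul_self]; simp

theorem Theta_inv {θ : ℝ} (hθ : 0 < θ) : (Theta θ)⁻¹ = !![0, 1 / θ; -(1 / θ), 0] := by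
  apply Matrix.inv_eq_right_inv
  have := hθ.ne'
  ext a b
  fin_cases a <;> fin_cases b <;> simp [Theta, Matrix.mul_apply, Fin.sum_univ_two, this]

theorem commXTilde_eq {θ : ℝ} (hθ : 0 < θ) (Γ : ℕ → ℕ → ℕ → ℕ → ℝ) (m n k l : ℕ) :
    commXTilde θ Γ m n k l =
      ![((2 / θ : ℝ) : ℂ) * commX1 θ Γ m n k l, -(((2 / θ : ℝ) : ℂ) * commX0 θ Γ m n k l)] := by
  ext ν
  unfold commXTilde
  rw [Theta_inv hθ]
  fin_cases ν <;> simp [commX, Fin.sum_univ_two, div_eq_mul_inv]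

/-- The two chiral combinations of the Dirac matrices diagonalize the spinorial factor. -/
theorem chiral_mul_spin (h : IsCliffordRep γ) {ε : ℂ} (hε : ε ^ 2 = 1) (P Q z s t : ℂ) :
    ((Complex.I * P) • (z • γ 0 + (ε * Complex.I * z) • γ 1)
        + Q • ((ε * Complex.I * z) • γ 0 + (-z) • γ 1)) *
      (s • (1 : Matrix (Fin 2) (Fin 2) ℂ) - (Complex.I * t) • (γ 0 * γ 1)) =
    (Complex.I * z * ((P + ε * Q) * (s + ε * t))) • (γ 0 + (ε * Complex.I) • γ 1) := by
  have hI := Complex.I_sq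
  simp only [mul_sub, mul_smul_comm, mul_one, add_mul, smul_mul_assoc, h.zero_mul_mul,
    h.one_mul_mul]
  ext a b
  simp only [Matrix.add_apply, Matrix.sub_apply, Matrix.smul_apply, Matrix.neg_apply, smul_eq_mul]
  linear_combination (-(Complex.I ^ 2 * P * t * z * γ 1 a b + Q * ε * Complex.I ^ 2 * t * z * γ 1 a b
    + Complex.I * t * Q * z * γ 0 a b) - Q * z * s * γ 1 a b * Complex.I ^ 2) * hε
    + (-(Q * z * s * γ 1 a b) - ε * Complex.I * P * t * z * γ 0 a b) * hI

/-- When the two commutators differ by the factor ±i, the slashed vector and its dual share one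
chiral combination, and the matrix integrand reduces to a scalar times it. -/
theorem Gcomm_eq (h : IsCliffordRep γ) {Ω θ α : ℝ} (hθ : 0 < θ) {m n k l : ℕ} {z : ℂ} {ε : ℝ}
    (hε : ε ^ 2 = 1) (h0 : commX0 θ (kernel Ω α) m n k l = z)
    (h1 : commX1 θ (kernel Ω α) m n k l = ε * Complex.I * z) :
    Gcomm γ Ω θ α m n k l =
      (Complex.I * z * (((OmegaTilde Ω θ * ((2 - α) / α) + ε * (Ω * (2 / θ))) *
        ((2 - α) / (2 * √(1 - α)) + ε * (α / (2 * √(1 - α)))) : ℝ) : ℂ)) •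
        (γ 0 + ((ε : ℂ) * Complex.I) • γ 1) := by
  have hε' : (ε : ℂ) ^ 2 = 1 := by exact_mod_cast hε
  have := chiral_mul_spin h hε' ((OmegaTilde Ω θ * ((2 - α) / α) : ℝ) : ℂ)
    ((Ω * (2 / θ) : ℝ) : ℂ) z (((2 - α) / (2 * √(1 - α)) : ℝ) : ℂ)
    ((α / (2 * √(1 - α)) : ℝ) : ℂ)
  push_cast at this ⊢
  rw [← this]
  unfold Gcomm slash spinFactor
  rw [commXTilde_eq hθ]
  simp only [commX, Fin.sum_univ_two, Matrix.cons_val_zero, Matrix.cons_val_one, h0, h1]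
  congr 1
  · congr 1
    · push_cast; rfl
    · simp only [smul_add, smul_smul]
      congr 2 <;> push_cast <;> ring
  · push_cast; rfl

end clifford

/-! ### Measurability and integration over a slice -/

theorem measurable_kernel (Ω : ℝ) (m n k l : ℕ) : Measurable fun α => kernel Ω α m n k l := by
  unfold kernel kernelB
  split_ifs
  · fun_prop
  · fun_prop

theorem measurable_Gcomm (γ : Fin 2 → Matrix (Fin 2) (Fin 2) ℂ) (Ω θ : ℝ) (m n k l : ℕ)
    (a b : Fin 2) : Measurable fun α => Gcomm γ Ω θ α m n k l a b := by
  have hk := measurable_kernel Ω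
  simp only [Gcomm, slash, spinFactor, commXTilde, commX, commX0, commX1, Fin.sum_univ_two,
    Matrix.mul_apply, Matrix.add_apply, Matrix.sub_apply, Matrix.smul_apply, smul_eq_mul,
    Matrix.cons_val_zero, Matrix.cons_val_one]
  fun_prop

theorem measurable_Gmass (γ : Fin 2 → Matrix (Fin 2) (Fin 2) ℂ) (Ω μ : ℝ) (m n k l : ℕ)
    (a b : Fin 2) : Measurable fun α => Gmass γ Ω μ α m n k l a b := by
  have hk := measurable_kernel Ω
  simp only [Gmass, spinFactor, Fin.sum_univ_two,
    Matrix.mul_apply, Matrix.sub_apply, Matrix.smul_apply, smul_eq_mul]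
  fun_prop

theorem intervalIntegrable_one_sub_rpow (a b : ℝ) :
    IntervalIntegrable (fun x : ℝ => (1 - x) ^ (-(1 / 2) : ℝ)) volume a b := by
  have := (intervalIntegral.intervalIntegrable_rpow' (r := (-(1 / 2) : ℝ)) (by norm_num)
    (a := 1 - a) (b := 1 - b)).comp_sub_left 1
  simpa using this

/-- The integral is 2(√(1-a) - √(1-b)); rationalizing turns it into a bound proportional to the
length b - a, even when b = 1. -/
theorem integral_one_sub_rpow_le {a b : ℝ} (hab : a ≤ b) (ha : a < 1) (hb : b ≤ 1) :
    ∫ x in a..b, (1 - x) ^ (-(1 / 2) : ℝ) ≤ 2 * (b - a) / √(1 - a) := by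
  rw [intervalIntegral.integral_comp_sub_left (fun x => x ^ (-(1 / 2) : ℝ)),
    integral_rpow (Or.inl (by norm_num))]
  rw [show (-(1 / 2) + 1 : ℝ) = 1 / 2 by norm_num, ← Real.sqrt_eq_rpow, ← Real.sqrt_eq_rpow]
  have h1 : 0 < √(1 - a) := Real.sqrt_pos.2 (by linarith)
  have h2 := Real.sqrt_nonneg (1 - b)
  have h3 := Real.sq_sqrt (by linarith : 0 ≤ 1 - a)
  have h4 := Real.sq_sqrt (by linarith : 0 ≤ 1 - b)
  have h5 : √(1 - b) ≤ √(1 - a) := Real.sqrt_le_sqrt (by linarith)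
  rw [le_div_iff₀ h1]
  nlinarith

/-- Integrability and size of an integrand with an inverse square root singularity at `1`. -/
theorem intervalIntegrable_and_norm_integral_le {F : ℝ → ℂ} (hF : Measurable F) {a b Y : ℝ}
    (hab : a ≤ b) (ha : a < 1) (hb : b ≤ 1) (hY : 0 ≤ Y)
    (h : ∀ x, a ≤ x → x ≤ b → x < 1 → ‖F x‖ ≤ Y / √(1 - x)) :
    IntervalIntegrable F volume a b ∧ ‖∫ x in a..b, F x‖ ≤ Y * (2 * (b - a) / √(1 - a)) := by
  have hg := (intervalIntegrable_one_sub_rpow a b).const_mul Y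
  have hle : ∀ x, a ≤ x → x ≤ b → x ≠ 1 → ‖F x‖ ≤ Y * (1 - x) ^ (-(1 / 2) : ℝ) := by
    intro x hx1 hx2 hx
    have hx3 : x < 1 := lt_of_le_of_ne (hx2.trans hb) hx
    refine (h x hx1 hx2 hx3).trans_eq ?_
    rw [Real.rpow_neg (by linarith), ← Real.sqrt_eq_rpow, div_eq_mul_inv]
  have hae : ∀ᵐ x : ℝ, x ≠ 1 := by simp [ae_iff]
  constructor
  · refine hg.mono_fun hF.aestronglyMeasurable ?_
    rw [uIoc_of_le hab]
    filter_upwards [ae_restrict_mem measurableSet_Ioc, ae_restrict_of_ae hae] with x hx hx1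
    exact (hle x hx.1.le hx.2 hx1).trans (le_abs_self _)
  · have h2 : ‖∫ x in a..b, F x‖ ≤ ∫ x in a..b, Y * (1 - x) ^ (-(1 / 2) : ℝ) := by
      refine intervalIntegral.norm_integral_le_of_norm_le hab ?_ hg
      filter_upwards [hae] with x hx1 hx
      exact hle x hx.1.le hx.2 hx1
    refine h2.trans ?_
    rw [intervalIntegral.integral_const_mul]
    gcongr
    exact integral_one_sub_rpow_le hab ha hb


/-! ### Pointwise bounds on the integrands -/

/-- The combination of centered moments that controls the commutator part. -/
noncomputable def momentSum (Ω α : ℝ) (m n k l : ℕ) : ℝ :=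
  if m + 1 + k = n + l then upperSum Ω α m n (k + 1) l
  else if m + k = n + 1 + l then lowerSum Ω α m (n + 1) k l else 0

/-- The gain of √α: the prefactor 1/√(k+1) equals √α/√(α(k+1)), whose denominator normalizes the
centered moment. -/
theorem abs_ladder_le {Ω α : ℝ} (h0 : 0 < Ω) (h1 : Ω < 1) (ha : 0 < α) (ha1 : α < 1)
    {m n k l : ℕ} (h : m + 1 + k = n + l) :
    |√n * kernel Ω α m (n - 1) k l - √((k : ℝ) + 1) * kernel Ω α m n (k + 1) l| ≤
      (1 + C Ω) * √α * ((∑ u ∈ Finset.range (min m l + 1),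
        weight (qpar Ω α) (rpar Ω α) m n (k + 1) l u *
          |((k + 1 : ℕ) : ℝ) * rpar Ω α - (l - u : ℕ)|) / √(α * (k + 1 : ℕ))) := by
  have hC := C_pos h0 h1
  have hX := denom_pos h0 h1 ha.le
  have hX1 : 1 + C Ω * α ≤ 1 + C Ω := by nlinarith
  have hk : 0 < √((k : ℝ) + 1) := Real.sqrt_pos.2 (by positivity)
  have hsα : 0 < √α := Real.sqrt_pos.2 ha
  rw [ladder_eq_sum h0 h1 ha.le ha1 h, abs_mul, abs_of_pos (by positivity)]
  have hs : |∑ u ∈ Finset.range (min m l + 1), weight (qpar Ω α) (rpar Ω α) m n (k + 1) l u *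
      (((k : ℝ) + 1) * rpar Ω α - (l - u : ℕ))| ≤ ∑ u ∈ Finset.range (min m l + 1),
        weight (qpar Ω α) (rpar Ω α) m n (k + 1) l u *
          |((k + 1 : ℕ) : ℝ) * rpar Ω α - (l - u : ℕ)| := by
    refine (Finset.abs_sum_le_sum_abs _ _).trans (Finset.sum_le_sum fun u _ => ?_)
    rw [abs_mul, abs_of_nonneg (weight_nonneg _ _ _ _ _ _ u)]
    push_cast
    rfl
  have hS := (abs_nonneg _).trans hs
  set S := ∑ u ∈ Finset.range (min m l + 1), weight (qpar Ω α) (rpar Ω α) m n (k + 1) l u *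
          |((k + 1 : ℕ) : ℝ) * rpar Ω α - (l - u : ℕ)|
  calc _ ≤ (1 + C Ω) / √((k : ℝ) + 1) * S := by gcongr
    _ = _ := by
      rw [Real.sqrt_mul ha.le]
      push_cast
      field_simp

theorem weight_swap (q r : ℝ) (m n k l u : ℕ) : weight q r l k n m u = weight q r m n k l u := by
  unfold weight
  congr 1; ring

/-- The commutators in the two sectors allowed by the conservation laws. -/
theorem exists_commX_eq {Ω α θ : ℝ} (h0 : 0 < Ω) (h1 : Ω < 1) (ha : 0 < α) (ha1 : α < 1)
    {m n k l : ℕ} (hml : m ≤ l) : ∃ S ε : ℝ, (ε = 1 ∨ ε = -1) ∧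
      commX0 θ (kernel Ω α) m n k l = ((2 * Real.pi * θ * √(θ / 8) * S : ℝ) : ℂ) ∧
      commX1 θ (kernel Ω α) m n k l =
        ε * Complex.I * ((2 * Real.pi * θ * √(θ / 8) * S : ℝ) : ℂ) ∧
      |S| ≤ ((1 + Ω) / (1 - Ω) + 1) * ((1 + C Ω) * √α * momentSum Ω α m n k l) := by
  have hΩ : 0 < 1 - Ω := by linarith
  have hmin : min m l = m := min_eq_left hml
  set ρ := (1 + Ω) / (1 - Ω) with hρ
  have hρ0 : 0 ≤ ρ + 1 := by positivity
  -- These four facts dispose of lowered indices: at index zero the truncated subtraction is masked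
  -- by the vanishing square root, elsewhere the conservation law fails.
  have zm : ∀ k l, m + k ≠ n + l + 1 → √(m : ℝ) * kernel Ω α (m - 1) n k l = 0 := by
    intro k l hne
    rcases Nat.eq_zero_or_pos m with h | h
    · simp [h]
    · rw [kernel_eq_zero (by omega), mul_zero]
  have zn : ∀ m k l, m + k + 1 ≠ n + l → √(n : ℝ) * kernel Ω α m (n - 1) k l = 0 := by
    intro m k l hne
    rcases Nat.eq_zero_or_pos n with h | h
    · simp [h]
    · rw [kernel_eq_zero (by omega), mul_zero]
  have zk : ∀ m n l, m + k ≠ n + l + 1 → √(k : ℝ) * kernel Ω α m n (k - 1) l = 0 := by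
    intro m n l hne
    rcases Nat.eq_zero_or_pos k with h | h
    · simp [h]
    · rw [kernel_eq_zero (by omega), mul_zero]
  have zl : ∀ m n k, m + k + 1 ≠ n + l → √(l : ℝ) * kernel Ω α m n k (l - 1) = 0 := by
    intro m n k hne
    rcases Nat.eq_zero_or_pos l with h | h
    · simp [h]
    · rw [kernel_eq_zero (by omega), mul_zero]
  by_cases hI : m + 1 + k = n + l
  · have hl := ladder_up h0 h1 ha ha1 hI
    have hb := abs_ladder_le h0 h1 ha ha1 hI
    rw [hmin] at hb
    set D := √n * kernel Ω α m (n - 1) k l - √((k : ℝ) + 1) * kernel Ω α m n (k + 1) l with hD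
    have y1 := zm k l (by omega)
    have y2 := zk m n l (by omega)
    have y3 : kernel Ω α m n k (l + 1) = 0 := kernel_eq_zero (by omega)
    have y4 : kernel Ω α m (n + 1) k l = 0 := kernel_eq_zero (by omega)
    refine ⟨(ρ + 1) * D, 1, Or.inl rfl, ?_, ?_, ?_⟩
    · unfold commX0
      rw [y1, y2, y3, y4]
      congr 2
      linarith
    · unfold commX1
      rw [y1, y2, y3, y4, Complex.ofReal_one, one_mul]
      congr 3
      linarith
    · rw [momentSum, if_pos hI, abs_mul, abs_of_nonneg hρ0]
      gcongr
      exact hb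
  by_cases hII : m + k = n + 1 + l
  · have hII' : l + 1 + n = k + m := by omega
    have hl := ladder_up h0 h1 ha ha1 hII'
    have hb := abs_ladder_le h0 h1 ha ha1 hII'
    rw [min_comm, hmin] at hb
    simp only [weight_swap] at hb
    have sw := kernel_swap h0 h1 ha.le ha1
    rw [sw m n k (l + 1), sw (m - 1) n k l, sw m n (k - 1) l, sw m (n + 1) k l, ← hρ] at hl
    rw [sw m n (k - 1) l, sw m (n + 1) k l] at hb
    rw [abs_sub_comm] at hb
    set D := √((n : ℝ) + 1) * kernel Ω α m (n + 1) k l - √k * kernel Ω α m n (k - 1) l with hD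
    have y1 := zn m k l (by omega)
    have y2 := zl m n k (by omega)
    have y3 : kernel Ω α (m + 1) n k l = 0 := kernel_eq_zero (by omega)
    have y4 : kernel Ω α m n (k + 1) l = 0 := kernel_eq_zero (by omega)
    refine ⟨(ρ + 1) * D, -1, Or.inr rfl, ?_, ?_, ?_⟩
    · unfold commX0
      rw [y1, y2, y3, y4]
      congr 2
      linarith
    · unfold commX1
      rw [y1, y2, y3, y4]
      push_cast
      have hl' := congrArg (Complex.ofReal) hl
      have hD' := congrArg (Complex.ofReal) hD
      push_cast at hl' hD'
      linear_combination (Complex.I * (2 * Real.pi * θ * (√(θ / 8) : ℝ))) * hl'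
        + (Complex.I * (2 * Real.pi * θ * (√(θ / 8) : ℝ))) * (ρ + 1) * hD'
    · rw [momentSum, if_neg hI, if_pos hII, abs_mul, abs_of_nonneg hρ0]
      gcongr
      exact hb
  · refine ⟨0, 1, Or.inl rfl, ?_, ?_, ?_⟩
    · unfold commX0
      rw [zm k l (by omega), zn m k l (by omega), zk m n l (by omega), zl m n k (by omega),
        kernel_eq_zero (by omega : m + 1 + k ≠ n + l), kernel_eq_zero (by omega : m + k ≠ n + (l + 1)),
        kernel_eq_zero (by omega : m + k ≠ n + 1 + l), kernel_eq_zero (by omega : m + (k + 1) ≠ n + l)]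
      simp
    · unfold commX1
      rw [zm k l (by omega), zn m k l (by omega), zk m n l (by omega), zl m n k (by omega),
        kernel_eq_zero (by omega : m + 1 + k ≠ n + l), kernel_eq_zero (by omega : m + k ≠ n + (l + 1)),
        kernel_eq_zero (by omega : m + k ≠ n + 1 + l), kernel_eq_zero (by omega : m + (k + 1) ≠ n + l)]
      simp
    · rw [momentSum, if_neg hI, if_neg hII]
      simp

/-- Total size of the entries of the Dirac matrices and of their product. -/
noncomputable def gammaSize (γ : Fin 2 → Matrix (Fin 2) (Fin 2) ℂ) : ℝ :=
  1 + ∑ a, ∑ b, (‖γ 0 a b‖ + ‖γ 1 a b‖ + ‖(γ 0 * γ 1) a b‖)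

theorem entries_le_gammaSize (γ : Fin 2 → Matrix (Fin 2) (Fin 2) ℂ) (a b : Fin 2) :
    1 + (‖γ 0 a b‖ + ‖γ 1 a b‖ + ‖(γ 0 * γ 1) a b‖) ≤ gammaSize γ := by
  unfold gammaSize
  gcongr
  calc _ ≤ ∑ b, (‖γ 0 a b‖ + ‖γ 1 a b‖ + ‖(γ 0 * γ 1) a b‖) :=
        Finset.single_le_sum (f := fun b => ‖γ 0 a b‖ + ‖γ 1 a b‖ + ‖(γ 0 * γ 1) a b‖)
          (fun _ _ => by positivity) (Finset.mem_univ b)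
    _ ≤ _ := Finset.single_le_sum
          (f := fun a => ∑ b, (‖γ 0 a b‖ + ‖γ 1 a b‖ + ‖(γ 0 * γ 1) a b‖))
          (fun _ _ => by positivity) (Finset.mem_univ a)

/-- Since Ω(2/θ) = Ω̃, the product factors exactly: equality holds for ε = 1, and for ε = -1 there
is an additional (1-α)² ≤ 1. -/
theorem spin_coefficient_le {Ω θ α ε : ℝ} (h0 : 0 < Ω) (hθ : 0 < θ) (ha : 0 < α) (ha1 : α < 1)
    (hε : ε = 1 ∨ ε = -1) :
    |(OmegaTilde Ω θ * ((2 - α) / α) + ε * (Ω * (2 / θ))) *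
        ((2 - α) / (2 * √(1 - α)) + ε * (α / (2 * √(1 - α))))|
      ≤ OmegaTilde Ω θ * (2 / α) / √(1 - α) := by
  have hw : 0 < √(1 - α) := Real.sqrt_pos.2 (by linarith)
  have hz : 0 < 1 - α := by linarith
  unfold OmegaTilde
  rcases hε with rfl | rfl
  · rw [abs_of_nonneg (by
      have : 0 ≤ 2 - α := by linarith
      positivity)]
    apply le_of_eq
    field_simp
    ring
  · rw [show (2 * Ω / θ * ((2 - α) / α) + -1 * (Ω * (2 / θ))) *
        ((2 - α) / (2 * √(1 - α)) + -1 * (α / (2 * √(1 - α))))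
      = 2 * Ω / θ * (2 / α) / √(1 - α) * ((1 - α) * (1 - α)) by field_simp; ring,
      abs_of_nonneg (by positivity)]
    have : (1 - α) * (1 - α) ≤ 1 := by nlinarith
    exact mul_le_of_le_one_right (by positivity) this

/-- The factor 2/α from the spin structure meets the √α from the ladder identity, leaving 1/√α. -/
theorem norm_Gcomm_le {γ : Fin 2 → Matrix (Fin 2) (Fin 2) ℂ} (hγ : IsCliffordRep γ)
    {Ω θ α : ℝ} (h0 : 0 < Ω) (h1 : Ω < 1) (hθ : 0 < θ) (ha : 0 < α) (ha1 : α < 1) {m n k l : ℕ}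
    (hml : m ≤ l) (a b : Fin 2) :
    ‖Gcomm γ Ω θ α m n k l a b‖ ≤ 2 * OmegaTilde Ω θ * (2 * Real.pi * θ * √(θ / 8)) *
      (((1 + Ω) / (1 - Ω) + 1) * (1 + C Ω)) * gammaSize γ *
        (momentSum Ω α m n k l / √α) / √(1 - α) := by
  obtain ⟨S, ε, hε, e0, e1, hS⟩ := exists_commX_eq (θ := θ) (n := n) (k := k) h0 h1 ha ha1 hml
  have hε2 : ε ^ 2 = 1 := by rcases hε with rfl | rfl <;> norm_num
  have hεn : ‖(ε : ℂ)‖ = 1 := by rcases hε with rfl | rfl <;> simp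
  rw [Gcomm_eq hγ hθ hε2 e0 e1]
  have hg := entries_le_gammaSize γ a b
  have hsα : 0 < √α := Real.sqrt_pos.2 ha
  have hw : 0 < √(1 - α) := Real.sqrt_pos.2 (by linarith)
  have hO : 0 < OmegaTilde Ω θ := by unfold OmegaTilde; positivity
  have hcoef := spin_coefficient_le h0 hθ ha ha1 hε
  rw [Matrix.smul_apply, smul_eq_mul, norm_mul, norm_mul, norm_mul, Complex.norm_I, one_mul,
    Complex.norm_real, Complex.norm_real, Real.norm_eq_abs, Real.norm_eq_abs, abs_mul,
    abs_of_nonneg (by positivity : 0 ≤ 2 * Real.pi * θ * √(θ / 8))]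
  have hent : ‖(γ 0 + ((ε : ℂ) * Complex.I) • γ 1) a b‖ ≤ gammaSize γ := by
    rw [Matrix.add_apply, Matrix.smul_apply, smul_eq_mul]
    refine (norm_add_le _ _).trans ?_
    rw [norm_mul, norm_mul, hεn, Complex.norm_I, one_mul, one_mul]
    have := norm_nonneg ((γ 0 * γ 1) a b)
    linarith
  calc _ ≤ 2 * Real.pi * θ * √(θ / 8) *
        (((1 + Ω) / (1 - Ω) + 1) * ((1 + C Ω) * √α * momentSum Ω α m n k l)) *
        (OmegaTilde Ω θ * (2 / α) / √(1 - α)) * gammaSize γ := by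
        have := (abs_nonneg S).trans hS
        gcongr
    _ = _ := by
      have hαs : α = √α * √α := (Real.mul_self_sqrt ha.le).symm
      have e : 2 / α = 2 / (√α * √α) := by rw [← hαs]
      rw [e]
      field_simp

theorem norm_Gmass_le (γ : Fin 2 → Matrix (Fin 2) (Fin 2) ℂ) (μ : ℝ)
    {Ω α : ℝ} (h0 : 0 < Ω) (h1 : Ω < 1) (ha : 0 < α) (ha1 : α < 1) {m n k l : ℕ}
    (hml : m ≤ l) (a b : Fin 2) :
    ‖Gmass γ Ω μ α m n k l a b‖ ≤ |μ| * gammaSize γ *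
      (if m + k = n + l then plainSum Ω α m n k l else 0) / √(1 - α) := by
  have hw : 0 < √(1 - α) := Real.sqrt_pos.2 (by linarith)
  have hg := entries_le_gammaSize γ a b
  have hk : |kernel Ω α m n k l| ≤ if m + k = n + l then plainSum Ω α m n k l else 0 := by
    split_ifs with h
    · rw [kernel_eq_sum_weight h0 h1 ha.le ha1 h, min_eq_left hml, abs_of_nonneg
        (Finset.sum_nonneg fun u _ => weight_nonneg _ _ _ _ _ _ u)]
      rfl
    · rw [kernel_eq_zero h, abs_zero]
  have hs : ‖spinFactor γ α a b‖ ≤ gammaSize γ / √(1 - α) := by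
    unfold spinFactor
    rw [Matrix.sub_apply, Matrix.smul_apply, Matrix.smul_apply, smul_eq_mul, smul_eq_mul]
    refine (norm_sub_le _ _).trans ?_
    rw [norm_mul, norm_mul, norm_mul, Complex.norm_I, one_mul, Complex.norm_real,
      Complex.norm_real, Real.norm_eq_abs, Real.norm_eq_abs,
      abs_of_nonneg (div_nonneg (by linarith) (by positivity)), abs_of_nonneg (by positivity)]
    have o1 : ‖(1 : Matrix (Fin 2) (Fin 2) ℂ) a b‖ ≤ 1 := by
      rw [Matrix.one_apply]; split_ifs <;> simp
    have c1 : (2 - α) / (2 * √(1 - α)) ≤ 1 / √(1 - α) := by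
      rw [div_le_div_iff₀ (by positivity) hw]; nlinarith
    have c2 : α / (2 * √(1 - α)) ≤ 1 / √(1 - α) := by
      rw [div_le_div_iff₀ (by positivity) hw]; nlinarith
    calc _ ≤ 1 / √(1 - α) * 1 + 1 / √(1 - α) * ‖(γ 0 * γ 1) a b‖ := by gcongr
      _ = (1 + ‖(γ 0 * γ 1) a b‖) / √(1 - α) := by ring
      _ ≤ _ := by
        gcongr
        have := norm_nonneg (γ 0 a b)
        have := norm_nonneg (γ 1 a b)
        linarith
  unfold Gmass
  rw [smul_mul_assoc, one_mul, Matrix.smul_apply, smul_eq_mul, norm_mul, Complex.norm_real,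
    norm_neg, norm_mul, Real.norm_eq_abs, Real.norm_eq_abs]
  have := (abs_nonneg _).trans hk
  calc _ ≤ |μ| * (if m + k = n + l then plainSum Ω α m n k l else 0) *
        (gammaSize γ / √(1 - α)) := by gcongr
    _ = _ := by ring

/-- Uniform pointwise bounds on both integrands over a slice. -/
theorem exists_norm_le_bracket {Ω L : ℝ} (h0 : 0 < Ω) (h1 : Ω < 1) (hL : 1 ≤ L) :
    ∃ c : ℝ, 0 < c ∧ ∀ (θ μ : ℝ) (γ : Fin 2 → Matrix (Fin 2) (Fin 2) ℂ), 0 < θ →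
      IsCliffordRep γ → ∃ K : ℝ, 0 < K ∧ ∀ (s α β : ℝ) (m n k l : ℕ) (a b : Fin 2), 0 < s →
        s ≤ α → s ≤ β → β ≤ L * s → β < 1 → m ≤ n → m ≤ l →
        ‖Gcomm γ Ω θ β m n k l a b‖ ≤
          K * bracket Ω c s α (n - m) (l - m) k (min (l - m) (k - n)) / √s / √(1 - β) ∧
        ‖Gmass γ Ω μ β m n k l a b‖ ≤
          K * bracket Ω c s α (n - m) (l - m) k (l - m) / √(1 - β) := by
  obtain ⟨c, K, hc, hK, H⟩ := exists_sums_le_bracket h0 h1 hL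
  have hC := C_pos h0 h1
  have hΩ : 0 < 1 - Ω := by linarith
  refine ⟨c, hc, fun θ μ γ hθ hγ => ?_⟩
  have hO : 0 < OmegaTilde Ω θ := by unfold OmegaTilde; positivity
  have hG : 0 < gammaSize γ := by unfold gammaSize; positivity
  set K₁ := 2 * OmegaTilde Ω θ * (2 * Real.pi * θ * √(θ / 8)) *
      (((1 + Ω) / (1 - Ω) + 1) * (1 + C Ω)) * gammaSize γ with hK₁
  have hK₁0 : 0 < K₁ := by
    have := Real.pi_pos
    have : 0 < √(θ / 8) := Real.sqrt_pos.2 (by positivity)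
    positivity
  have hK₂0 : 0 ≤ |μ| * gammaSize γ := by positivity
  refine ⟨K₁ * K + |μ| * gammaSize γ * K, by positivity, ?_⟩
  intro s α β m n k l a b hs hsα hsβ hβL hβ1 hmn hml
  have hβ := hs.trans_le hsβ
  have hα := hs.trans_le hsα
  have hss : 0 < √s := Real.sqrt_pos.2 hs
  have hw : 0 < √(1 - β) := Real.sqrt_pos.2 (by linarith)
  obtain ⟨H1, H2, H3⟩ := H s α β m n k l hs hsα hsβ hβL hβ1 hmn hml
  constructor
  · refine (norm_Gcomm_le hγ h0 h1 hθ hβ hβ1 hml a b).trans ?_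
    have hbr := bracket_nonneg (Ω := Ω) c s hα.le (n - m) (l - m) k (min (l - m) (k - n))
    set B := bracket Ω c s α (n - m) (l - m) k (min (l - m) (k - n)) with hB
    have hm : momentSum Ω β m n k l ≤ K * B := by
      unfold momentSum
      split_ifs with hI hII
      · have e : min (l - m) (k - n) = l - m - 1 := by omega
        rw [hB, e]; exact H2 hI
      · have e : min (l - m) (k - n) = l - m := by omega
        rw [hB, e]; exact H3 hII
      · positivity
    rw [← hK₁]
    calc _ ≤ K₁ * (K * B / √s) / √(1 - β) := by gcongr
      _ = K₁ * K * B / √s / √(1 - β) := by ring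
      _ ≤ _ := by
        gcongr
        have : 0 ≤ |μ| * gammaSize γ * K := by positivity
        linarith
  · refine (norm_Gmass_le γ μ h0 h1 hβ hβ1 hml a b).trans ?_
    have hbr := bracket_nonneg (Ω := Ω) c s hα.le (n - m) (l - m) k (l - m)
    set B := bracket Ω c s α (n - m) (l - m) k (l - m) with hB
    have hm : (if m + k = n + l then plainSum Ω β m n k l else 0) ≤ K * B := by
      split_ifs with h
      · exact H1 h
      · positivity
    calc _ ≤ |μ| * gammaSize γ * (K * B) / √(1 - β) := by gcongr
      _ = |μ| * gammaSize γ * K * B / √(1 - β) := by ring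
      _ ≤ _ := by
        gcongr
        have : 0 ≤ K₁ * K := by positivity
        linarith

theorem norm_slice_le {Ω θ M : ℝ} {i : ℕ} {F : ℝ → Matrix (Fin 2) (Fin 2) ℂ} {a b : Fin 2}
    {Y : ℝ} (h0 : 0 < Ω)
    (h : ‖∫ α in (M ^ (-2 * (i : ℤ)))..(M ^ (-2 * ((i : ℤ) - 1))), F α a b‖ ≤ Y) :
    ‖slice Ω θ M i F a b‖ ≤ 2 * Ω / (θ ^ 2 * Real.pi ^ 2) * Y := by
  unfold slice
  rw [norm_mul, Complex.norm_real, norm_neg, Real.norm_of_nonneg (by positivity)]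
  gcongr

end GrossNeveu

/-! ### Integration over the slice -/

theorem theorem5p1 (Ω : ℝ) (hΩ0 : 0 < Ω) (hΩ1 : Ω < 1) (M : ℝ) (hM : 1 < M) :
    ∃ c : ℝ, 0 < c ∧
      ∀ (θ μ : ℝ) (γ : Fin 2 → Matrix (Fin 2) (Fin 2) ℂ), 0 < θ → GrossNeveu.IsCliffordRep γ →
        ∃ K : ℝ, 0 < K ∧ ∀ i m n k l : ℕ, 1 ≤ i → m ≤ n → m ≤ l →
          -- the entries of both integrands are integrable over the slice
          (∀ a b : Fin 2,
            IntervalIntegrable (fun α => GrossNeveu.Gcomm γ Ω θ α m n k l a b) volume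
              (M ^ (-2 * (i : ℤ))) (M ^ (-2 * ((i : ℤ) - 1))) ∧
            IntervalIntegrable (fun α => GrossNeveu.Gmass γ Ω μ α m n k l a b) volume
              (M ^ (-2 * (i : ℤ))) (M ^ (-2 * ((i : ℤ) - 1)))) ∧
          -- and the bounds hold, with `h = n - m`, `p = l - m` and any `α` in the slice
          ∀ α ∈ Icc (M ^ (-2 * (i : ℤ))) (M ^ (-2 * ((i : ℤ) - 1))), ∀ a b : Fin 2,
            ‖GrossNeveu.GcommSlice γ Ω θ M i m n k l a b‖ ≤
              K * M ^ (-(i : ℤ)) *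
                GrossNeveu.bracket Ω c (M ^ (-2 * (i : ℤ))) α (n - m) (l - m) k
                  (min (l - m) (k - n)) ∧
            ‖GrossNeveu.GmassSlice γ Ω θ μ M i m n k l a b‖ ≤
              K * M ^ (-2 * (i : ℤ)) *
                GrossNeveu.bracket Ω c (M ^ (-2 * (i : ℤ))) α (n - m) (l - m) k (l - m) := by
  have hM0 : 0 < M := by linarith
  -- M² is the ratio of the endpoints of a slice.
  have hL : 1 ≤ M ^ 2 := one_le_pow₀ hM.le
  obtain ⟨c, hc, H⟩ := GrossNeveu.exists_norm_le_bracket hΩ0 hΩ1 hL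
  refine ⟨c, hc, fun θ μ γ hθ hγ => ?_⟩
  obtain ⟨K, hK, H⟩ := H θ μ γ hθ hγ
  set d := 1 - (M ^ 2)⁻¹ with hd
  have hM2 : 1 < M ^ 2 := one_lt_pow₀ hM (by norm_num)
  have hd0 : 0 < d := by
    have := inv_lt_one_of_one_lt₀ hM2
    linarith
  have hsd : 0 < √d := Real.sqrt_pos.2 hd0
  have hpi := Real.pi_pos
  refine ⟨2 * Ω / (θ ^ 2 * Real.pi ^ 2) * (K * (2 * M ^ 2 / √d)), by positivity, ?_⟩
  intro i m n k l hi hmn hml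
  set s := M ^ (-2 * (i : ℤ)) with hs
  set e := M ^ (-2 * ((i : ℤ) - 1)) with he
  have hs0 : 0 < s := zpow_pos hM0 _
  have hes : e = M ^ 2 * s := by
    rw [he, hs, ← zpow_natCast M 2, ← zpow_add₀ hM0.ne']; congr 1; push_cast; ring
  have hse : s ≤ e := by rw [hes]; exact le_mul_of_one_le_left hs0.le hL
  -- Here i ≥ 1 enters; for i = 1 the upper endpoint is the singular point 1, but the lower one
  -- stays at distance at least d = 1 - M^(-2) from it.
  have he1 : e ≤ 1 := zpow_le_one_of_nonpos₀ hM.le (by omega)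
  have hsd' : d ≤ 1 - s := by
    have : M ^ 2 * s ≤ 1 := hes ▸ he1
    have : s ≤ (M ^ 2)⁻¹ := by
      rw [← one_div, le_div_iff₀ (by positivity)]; linarith
    linarith
  have hs1 : s < 1 := by linarith
  have hss : M ^ (-(i : ℤ)) = √s := by
    rw [eq_comm, Real.sqrt_eq_iff_mul_self_eq hs0.le (zpow_pos hM0 _).le, hs,
      ← zpow_add₀ hM0.ne']
    congr 1; ring
  have hlen : 2 * (e - s) / √(1 - s) ≤ 2 * M ^ 2 / √d * s := by
    calc 2 * (e - s) / √(1 - s) ≤ 2 * e / √d := by gcongr; linarith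
      _ = _ := by rw [hes]; ring
  have hss0 : 0 < √s := Real.sqrt_pos.2 hs0
  have key := fun (α : ℝ) (hα : s ≤ α) (a b : Fin 2) =>
    have hb := fun q => GrossNeveu.bracket_nonneg (Ω := Ω) c s (hs0.le.trans hα) (n - m) (l - m) k q
    And.intro
      (GrossNeveu.intervalIntegrable_and_norm_integral_le
        (GrossNeveu.measurable_Gcomm γ Ω θ m n k l a b) hse hs1 he1
        (div_nonneg (mul_nonneg hK.le (hb (min (l - m) (k - n)))) hss0.le)
        (fun β h1 h2 h3 => (H s α β m n k l a b hs0 hα h1 (hes ▸ h2) h3 hmn hml).1))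
      (GrossNeveu.intervalIntegrable_and_norm_integral_le
        (GrossNeveu.measurable_Gmass γ Ω μ m n k l a b) hse hs1 he1
        (mul_nonneg hK.le (hb (l - m)))
        (fun β h1 h2 h3 => (H s α β m n k l a b hs0 hα h1 (hes ▸ h2) h3 hmn hml).2))
  -- Integrability does not involve α, so the lower endpoint serves as the reference point.
  refine ⟨fun a b => ⟨(key s le_rfl a b).1.1, (key s le_rfl a b).2.1⟩, ?_⟩
  intro α hα a b
  have hb := fun q => GrossNeveu.bracket_nonneg (Ω := Ω) c s (hs0.le.trans hα.1) (n - m) (l - m) k q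
  constructor
  · refine (GrossNeveu.norm_slice_le hΩ0 (key α hα.1 a b).1.2).trans ?_
    have hb' := hb (min (l - m) (k - n))
    set B := GrossNeveu.bracket Ω c s α (n - m) (l - m) k (min (l - m) (k - n))
    rw [hss]
    -- The slice length, of order s, against 1/√s leaves √s = M^(-i).
    calc _ ≤ 2 * Ω / (θ ^ 2 * Real.pi ^ 2) * (K * B / √s * (2 * M ^ 2 / √d * s)) := by gcongr
      _ = 2 * Ω / (θ ^ 2 * Real.pi ^ 2) * (K * B / √s * (2 * M ^ 2 / √d * (√s * √s))) := by
        rw [Real.mul_self_sqrt hs0.le]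
      _ = _ := by field_simp
  · refine (GrossNeveu.norm_slice_le hΩ0 (key α hα.1 a b).2.2).trans ?_
    have hb' := hb (l - m)
    set B := GrossNeveu.bracket Ω c s α (n - m) (l - m) k (l - m)
    calc _ ≤ 2 * Ω / (θ ^ 2 * Real.pi ^ 2) * (K * B * (2 * M ^ 2 / √d * s)) := by gcongr
      _ = _ := by ring
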